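/- **Strings.** Let the string alphabet consist of the letters $z\in\{a,b,c,d\}$, the barred letters $\bar z$, and the brackets $\langle,\rangle$. For a letter $z$ let $Z=\{z\langle^k\bar z^k\rangle^k\mid k\ge 0\}$, and let $\mathsf{CSD}_s=\{A^nB^mC^nD^m\mid n,m\ge 1\}$ be the set of all concatenations of $n$ blocks from $A$, $m$ from $B$, $n$ from $C$ and $m$ from $D$ (the numbers $k$ are independent for different blocks). Let $\mathsf{Sep}=\{a/c,c/a,b/d,d/b\}$. **The relation.** Let $\mathsf{CSD}$ be a relation between strings and finite directed edge-labelled multigraphs which relates exactly the strings of $\mathsf{CSD}_s$ to some graph, and in which every graph related to $s$ has, for each of the eight symbols $z\in\{a,b,c,d,\bar a,\bar b,\bar c,\bar d\}$, exactly as many $z$-edges as $s$ has $z$-tokens. **The grammar.** Let $G$ be a linear monadic context-free tree grammar (nonterminals of rank $\le 1$, the variable occurs at most once on the right-hand side of a rule) over a finite ranked signature $\Delta$, whose symbols of rank $0$ are labelled by a token or by the empty string. Write $\mathrm{yd}(t)$ for the string of leaf labels of a tree $t$ from left to right; for a context $C$ (a tree with exactly one hole), $\mathrm{yd}(C)$ is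 the string to the left of the hole followed by the string to its right. Let $k\in\mathbb N_0$, let $\mathrm{HR}_k$ be the algebra of s-graphs with $k$ source names (constants, parallel composition, renaming and forgetting of sources), and let $h$ be a linear nondeleting tree homomorphism from trees over $\Delta$ to terms over $\mathrm{HR}_k$. Let $\mathrm{graph}(t)=[\![h(t)]\!]$; the graph generated by a context is obtained by evaluating it with the empty graph in the hole. Assume $$\mathsf{CSD}=\mathrm{REL}(G,h,\mathrm{HR}_k)=\{(\mathrm{yd}(t),\mathrm{graph}(t))\mid t\in L(G)\},$$ graphs being taken up to isomorphism and without their source names. Put $\mathbf T=L(G)$. **Pumping height.** Leaves have height $1$ and the hole of a context has height $0$. A number $p$ is a pumping height of $\mathbf T$ if every $t\in\mathbf T$ of height $>p$ can be written $t=C_1[C_2[C_3[C_4[t_5]]]]$ with $\mathrm{height}(C_2[C_3[C_4]])\le p$, $\mathrm{height}(C_2)+\mathrm{height}(C_4)>0$ and $C_1[v^i[t_5]]\in\mathbf T$ for all $i\ge 0$, where $v^0=C_3$ and $v^{i+1}=C_2[v^i[C_4]]$. **Separation.** For $x/y\in\mathsf{Sep}$ and $l\in\mathbb N_0$, an $x,y,l$-separation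 of a tree $t$ is a decomposition $t=D_x[D_0[t_y]]$ into contexts $D_x,D_0$ and a tree $t_y$ such that $\mathrm{yd}(D_x)$ contains no $y$, $\mathrm{yd}(D_0)$ contains at most $l$ occurrences of $x$, and $\mathrm{yd}(t_y)$ contains no $x$. It is minimal if $\mathrm{height}(D_0)$ is minimal among all $x,y,l$-separations of $t$. The tree $t$ is $x,y,l$-separated if it has an $x,y,l$-separation. It is $x,y,l$-asynchronous if it has a minimal $x,y,l$-separation $t=D_x[D_0[t_y]]$ such that $t_0=D_0[t_y]$ satisfies $$e^{t_0}_{\bar x}\le n^t_x\,l+m^t_{\bar x}(l+1),\qquad e^{t_0}_{\bar y}\ge n^t_{\bar y}-n^t_x\,l-m^t_{\bar y},$$ where $e^{t_0}_z$ is the number of $z$-edges of $\mathrm{graph}(t_0)$, $n^t_z$ is the number of $z$-tokens in $\mathrm{yd}(t)$, and $m^t_z$ is the maximal length of a contiguous substring of $\mathrm{yd}(t)$ consisting only of $z$-tokens. **Lemma 8.** $\mathbf T$ has a pumping height. Let $p$ be any pumping height of $\mathbf T$. There is a number $l_0$ such that every context over $\Delta$ of height at most $p$ generates at most $l_0$ string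 tokens and at most $l_0$ edges; and for every such number $l_0$ (in particular for the least one), for all $x/y\in\mathsf{Sep}$ and all $t\in\mathbf T$: if $t$ is $x,y,l_0$-separated, then $t$ is $x,y,l_0$-asynchronous. -/

import Mathlib

namespace SemCap

/-! ## Tokens and strings -/

/-- The four core letters. -/
inductive Letter where
  | a | b | c | d
  deriving DecidableEq

/-- The eight symbols `z` and `z̄`, for a core letter `z`.  They occur both as tokens of strings and
as edge labels of graphs. -/
inductive Sym where
  | core (z : Letter)
  | bar (z : Letter)
  deriving DecidableEq

/-- The string alphabet: the eight symbols and the two brackets `⟨` and `⟩`. -/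
inductive Token where
  | sym (s : Sym)
  | lbr
  | rbr
  deriving DecidableEq

/-- The token `z`. -/
abbrev Token.core (z : Letter) : Token := .sym (.core z)

/-- The token `z̄`. -/
abbrev Token.bar (z : Letter) : Token := .sym (.bar z)

/-- `Sep x y` means `x/y ∈ Sep = {a/c, c/a, b/d, d/b}`. -/
inductive Sep : Letter → Letter → Prop
  | ac : Sep .a .c
  | ca : Sep .c .a
  | bd : Sep .b .d
  | db : Sep .d .b

/-- The length of a longest contiguous substring of `s` consisting only of `z`-tokens. -/
noncomputable def maxRun (z : Token) (s : List Token) : ℕ :=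
  sSup {n : ℕ | List.replicate n z <:+: s}

/-- The block `z ⟨ᵏ z̄ᵏ ⟩ᵏ`. -/
def block (z : Letter) (k : ℕ) : List Token :=
  Token.core z :: (List.replicate k Token.lbr ++ List.replicate k (Token.bar z) ++
    List.replicate k Token.rbr)

/-- The concatenation of the blocks `z ⟨ᵏ z̄ᵏ ⟩ᵏ`, for `k` running through the list `l`. -/
def blocks (z : Letter) (l : List ℕ) : List Token :=
  l.flatMap (block z)

/-- The string language `{Aⁿ Bᵐ Cⁿ Dᵐ | n, m ≥ 1}`, where `Z = {z ⟨ᵏ z̄ᵏ ⟩ᵏ | k ≥ 0}` is the set of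
blocks of the letter `z`. -/
def CSDs : Set (List Token) :=
  {s | ∃ ka kb kc kd : List ℕ, 1 ≤ ka.length ∧ 1 ≤ kb.length ∧
    kc.length = ka.length ∧ kd.length = kb.length ∧
    s = blocks .a ka ++ blocks .b kb ++ blocks .c kc ++ blocks .d kd}

/-! ## Graphs and s-graphs -/

/-- Finite directed multigraphs with labelled edges.  The labels are the eight symbols, and possibly
some further labels from `Λ`. -/
structure Graph (Λ : Type) where
  V : Type
  E : Type
  finV : Finite V
  finE : Finite E
  src : E → V
  tgt : E → V
  lab : E → Sym ⊕ Λ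

/-- The number of edges. -/
noncomputable def Graph.size {Λ : Type} (g : Graph Λ) : ℕ := Nat.card g.E

/-- The number of `z`-edges. -/
noncomputable def Graph.edgeCount {Λ : Type} (g : Graph Λ) (z : Sym) : ℕ :=
  Nat.card {e : g.E // g.lab e = Sum.inl z}

/-- Isomorphism of graphs. -/
def Graph.Iso {Λ : Type} (g g' : Graph Λ) : Prop :=
  ∃ (φ : g.V ≃ g'.V) (ψ : g.E ≃ g'.E), ∀ e : g.E,
    g'.src (ψ e) = φ (g.src e) ∧ g'.tgt (ψ e) = φ (g.tgt e) ∧ g'.lab (ψ e) = g.lab e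

/-- An s-graph with source names in `Fin k`: a graph together with a partial map that assigns
vertices to source names. -/
structure SGraph (Λ : Type) (k : ℕ) extends Graph Λ where
  source : Fin k → Option V

namespace SGraph

variable {Λ : Type} {k : ℕ}

/-- The empty s-graph. -/
def empty (Λ : Type) (k : ℕ) : SGraph Λ k where
  V := Empty
  E := Empty
  finV := inferInstance
  finE := inferInstance
  src := Empty.elim
  tgt := Empty.elim
  lab := Empty.elim
  source := fun _ => none

/-- Two vertices of a disjoint union are to be merged: they carry the same source name. -/
inductive Glue (g h : SGraph Λ k) : g.V ⊕ h.V → g.V ⊕ h.V → Prop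
  | mk (a : Fin k) (u : g.V) (v : h.V) (hu : g.source a = some u) (hv : h.source a = some v) :
      Glue g h (Sum.inl u) (Sum.inr v)

/-- Parallel composition `g ∥ h`: the disjoint union, in which vertices that carry the same source
name are merged (`Quot` is the quotient by the equivalence relation generated by `Glue`). -/
def par (g h : SGraph Λ k) : SGraph Λ k where
  V := Quot (Glue g h)
  E := g.E ⊕ h.E
  finV :=
    have := g.finV
    have := h.finV
    Finite.of_surjective (Quot.mk (Glue g h)) Quot.mk_surjective
  finE :=
    have := g.finE
    have := h.finE
    inferInstance
  src := Sum.elim (fun e => Quot.mk _ (Sum.inl (g.src e))) (fun e => Quot.mk _ (Sum.inr (h.src e)))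
  tgt := Sum.elim (fun e => Quot.mk _ (Sum.inl (g.tgt e))) (fun e => Quot.mk _ (Sum.inr (h.tgt e)))
  lab := Sum.elim g.lab h.lab
  source := fun a =>
    match g.source a, h.source a with
    | some u, _ => some (Quot.mk _ (Sum.inl u))
    | none, some v => some (Quot.mk _ (Sum.inr v))
    | none, none => none

/-- Renaming: the source named `a` is renamed to `σ a`. -/
def rename (σ : Equiv.Perm (Fin k)) (g : SGraph Λ k) : SGraph Λ k where
  toGraph := g.toGraph
  source := fun a => g.source (σ.symm a)

/-- Forgetting the source name `a`. -/
def forget (a : Fin k) (g : SGraph Λ k) : SGraph Λ k where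
  toGraph := g.toGraph
  source := Function.update g.source a none

end SGraph

/-- Terms with variables `x₀, …, xₙ₋₁` over the operations of the algebra `HR_k` of s-graphs with
`k` source names: constants, parallel composition, renaming and forgetting of source names. -/
inductive HRTerm (Λ : Type) (k : ℕ) (n : ℕ) : Type 1 where
  | var (i : Fin n)
  | const (g : SGraph Λ k)
  | par (u v : HRTerm Λ k n)
  | rename (σ : Equiv.Perm (Fin k)) (u : HRTerm Λ k n)
  | forget (a : Fin k) (u : HRTerm Λ k n)

namespace HRTerm

variable {Λ : Type} {k n : ℕ}

/-- The value of a term in `HR_k`, for given values of the variables. -/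
def eval (ρ : Fin n → SGraph Λ k) : HRTerm Λ k n → SGraph Λ k
  | var i => ρ i
  | const g => g
  | par u v => (u.eval ρ).par (v.eval ρ)
  | rename σ u => (u.eval ρ).rename σ
  | forget a u => (u.eval ρ).forget a

/-- The number of occurrences of the variable `i` in a term. -/
def occ (i : Fin n) : HRTerm Λ k n → ℕ
  | var j => if j = i then 1 else 0
  | const _ => 0
  | par u v => u.occ i + v.occ i
  | rename _ u => u.occ i
  | forget _ u => u.occ i

end HRTerm

/-! ## Trees and contexts -/

/-- A finite ranked signature.  A symbol of rank 0 is a leaf label: it is displayed in strings as one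
token, or as the empty string (`none`).  The token is relevant for symbols of rank 0 only. -/
structure Signature where
  Op : Type
  finOp : Finite Op
  rank : Op → ℕ
  token : Op → Option Token

/-- Trees over a ranked signature. -/
inductive Tree (Δ : Signature) : Type where
  | node (f : Δ.Op) (ts : Fin (Δ.rank f) → Tree Δ)

/-- Contexts: trees with exactly one occurrence of a hole.  In `node f i ts C`, the `i`-th child is
the context `C` and the other children are the trees `ts j`. -/
inductive Ctx (Δ : Signature) : Type where
  | hole
  | node (f : Δ.Op) (i : Fin (Δ.rank f)) (ts : {j : Fin (Δ.rank f) // j ≠ i} → Tree Δ) (C : Ctx Δ)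

namespace Tree

variable {Δ : Signature}

/-- The height of a tree; leaves have height 1. -/
def height : Tree Δ → ℕ
  | node _ ts => 1 + Finset.univ.sup fun j => (ts j).height

/-- The projective (context-free) yield: the string of the leaves, from left to right. -/
def yield : Tree Δ → List Token
  | node f ts =>
    if Δ.rank f = 0 then (Δ.token f).toList else (List.ofFn fun j => (ts j).yield).flatten

end Tree

namespace Ctx

variable {Δ : Signature}

/-- `C[t]`: the tree `t` is put into the hole. -/
def plug : Ctx Δ → Tree Δ → Tree Δ
  | hole, t => t
  | node f i ts C, t => .node f fun j => if h : j = i then C.plug t else ts ⟨j, h⟩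

/-- `C[D]`: the context `D` is put into the hole. -/
def comp : Ctx Δ → Ctx Δ → Ctx Δ
  | hole, D => D
  | node f i ts C, D => node f i ts (C.comp D)

/-- The height of a context; the hole has height 0. -/
def height : Ctx Δ → ℕ
  | hole => 0
  | node _ _ ts C => 1 + max C.height (Finset.univ.sup fun j => (ts j).height)

/-- The string generated to the left of the hole. -/
def left : Ctx Δ → List Token
  | hole => []
  | node _ i ts C =>
    (List.ofFn fun j => if h : j < i then (ts ⟨j, h.ne⟩).yield else []).flatten ++ C.left

/-- The string generated to the right of the hole. -/
def right : Ctx Δ → List Token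
  | hole => []
  | node _ i ts C =>
    C.right ++ (List.ofFn fun j => if h : i < j then (ts ⟨j, h.ne'⟩).yield else []).flatten

/-- The yield of a context. -/
def yield (C : Ctx Δ) : List Token := C.left ++ C.right

/-- `pump C₂ C₃ C₄ i` is `vⁱ`, with `v⁰ = C₃` and `vⁱ⁺¹ = C₂[vⁱ[C₄]]`. -/
def pump (C₂ C₃ C₄ : Ctx Δ) : ℕ → Ctx Δ
  | 0 => C₃
  | i + 1 => C₂.comp ((pump C₂ C₃ C₄ i).comp C₄)

end Ctx

/-! ## Linear monadic context-free tree grammars -/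

/-- Sentential forms over a signature, with nonterminals of rank 0 in `N₀` and of rank 1 in `N₁`, and
a variable `x`. -/
inductive Form (Δ : Signature) (N₀ N₁ : Type) : Type where
  | x
  | node (f : Δ.Op) (ts : Fin (Δ.rank f) → Form Δ N₀ N₁)
  | nt₀ (A : N₀)
  | nt₁ (A : N₁) (u : Form Δ N₀ N₁)

namespace Form

variable {Δ : Signature} {N₀ N₁ : Type}

/-- The number of occurrences of the variable. -/
def occ : Form Δ N₀ N₁ → ℕ
  | x => 1
  | node _ ts => ∑ j, (ts j).occ
  | nt₀ _ => 0
  | nt₁ _ u => u.occ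

/-- Substitution of `s` for the variable. -/
def subst (s : Form Δ N₀ N₁) : Form Δ N₀ N₁ → Form Δ N₀ N₁
  | x => s
  | node f ts => node f fun j => subst s (ts j)
  | nt₀ A => nt₀ A
  | nt₁ A u => nt₁ A (subst s u)

/-- A tree as a sentential form. -/
def ofTree : Tree Δ → Form Δ N₀ N₁
  | .node f ts => node f fun j => ofTree (ts j)

end Form

/-- Linear monadic context-free tree grammars: nonterminals have rank 0 or 1; the rules are `A → u`
where `u` has no variable, and `A(x) → u` where `x` occurs at most once in `u`. -/
structure LMCFTG (Δ : Signature) where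
  N₀ : Type
  N₁ : Type
  finN₀ : Finite N₀
  finN₁ : Finite N₁
  start : N₀
  rules₀ : Set (N₀ × Form Δ N₀ N₁)
  rules₁ : Set (N₁ × Form Δ N₀ N₁)
  fin₀ : rules₀.Finite
  fin₁ : rules₁.Finite
  closed : ∀ r ∈ rules₀, r.2.occ = 0
  linear : ∀ r ∈ rules₁, r.2.occ ≤ 1

namespace LMCFTG

variable {Δ : Signature}

/-- One derivation step. -/
inductive Step (G : LMCFTG Δ) : Form Δ G.N₀ G.N₁ → Form Δ G.N₀ G.N₁ → Prop
  | rule₀ {A : G.N₀} {u : Form Δ G.N₀ G.N₁} (h : (A, u) ∈ G.rules₀) : Step G (.nt₀ A) u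
  | rule₁ {A : G.N₁} {u : Form Δ G.N₀ G.N₁} (h : (A, u) ∈ G.rules₁) (s : Form Δ G.N₀ G.N₁) :
      Step G (.nt₁ A s) (Form.subst s u)
  | node (f : Δ.Op) (ts : Fin (Δ.rank f) → Form Δ G.N₀ G.N₁) (i : Fin (Δ.rank f))
      {u : Form Δ G.N₀ G.N₁} (h : Step G (ts i) u) :
      Step G (.node f ts) (.node f (Function.update ts i u))
  | nt₁ (A : G.N₁) {s u : Form Δ G.N₀ G.N₁} (h : Step G s u) : Step G (.nt₁ A s) (.nt₁ A u)

/-- The tree language generated by a grammar. -/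
def language (G : LMCFTG Δ) : Set (Tree Δ) :=
  {t | Relation.ReflTransGen G.Step (.nt₀ G.start) (Form.ofTree t)}

end LMCFTG

/-! ## Semantic interpretation of trees -/

/-- Tree homomorphisms from trees over `Δ` to terms over `HR_k`; they are linear and nondeleting,
i.e. every variable occurs exactly once in the image of a symbol. -/
structure Hom (Δ : Signature) (Λ : Type) (k : ℕ) where
  image : (f : Δ.Op) → HRTerm Λ k (Δ.rank f)
  occ_eq_one : ∀ (f : Δ.Op) (i : Fin (Δ.rank f)), (image f).occ i = 1

namespace Hom

variable {Δ : Signature} {Λ : Type} {k : ℕ}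

/-- The s-graph `⟦h(t)⟧` of a tree `t`. -/
def graph (h : Hom Δ Λ k) : Tree Δ → SGraph Λ k
  | .node f ts => (h.image f).eval fun j => h.graph (ts j)

/-- The s-graph generated by a context alone, i.e. with the empty s-graph in place of the hole. -/
def ctxGraph (h : Hom Δ Λ k) : Ctx Δ → SGraph Λ k
  | .hole => SGraph.empty Λ k
  | .node f i ts C =>
    (h.image f).eval fun j => if hj : j = i then h.ctxGraph C else h.graph (ts ⟨j, hj⟩)

end Hom

/-- The relation `REL((G, yield), h, HR_k)` between strings and graphs (graphs are considered up to
isomorphism, and without their source names). -/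
def REL {Δ : Signature} {Λ : Type} {k : ℕ} (G : LMCFTG Δ) (h : Hom Δ Λ k) :
    Set (List Token × Graph Λ) :=
  {q | ∃ t ∈ G.language, t.yield = q.1 ∧ (h.graph t).toGraph.Iso q.2}

/-- Relations between strings and graphs that relate exactly the strings of `CSDs`, each of them only
to graphs with exactly one `z`-edge for every `z`-token of the string, for all eight symbols `z`. -/
structure IsCSD {Λ : Type} (R : Set (List Token × Graph Λ)) : Prop where
  strings : ∀ s : List Token, (∃ g, (s, g) ∈ R) ↔ s ∈ CSDs
  edges : ∀ (s : List Token) (g : Graph Λ), (s, g) ∈ R →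
    ∀ z : Sym, g.edgeCount z = s.count (Token.sym z)

/-! ## Pumping -/

/-- `(C₁, C₂, C₃, C₄, t₅)` is a pumping decomposition of `t` in `T`, for the bound `p`. -/
structure IsPumpingDecomposition {Δ : Signature} (T : Set (Tree Δ)) (p : ℕ) (t : Tree Δ)
    (C₁ C₂ C₃ C₄ : Ctx Δ) (t₅ : Tree Δ) : Prop where
  eq : t = C₁.plug (C₂.plug (C₃.plug (C₄.plug t₅)))
  height_le : (C₂.comp (C₃.comp C₄)).height ≤ p
  height_pos : 0 < C₂.height + C₄.height
  mem : ∀ i : ℕ, C₁.plug ((Ctx.pump C₂ C₃ C₄ i).plug t₅) ∈ T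

/-- `p` is a pumping height of `T`: every tree of `T` of height greater than `p` has a pumping
decomposition. -/
def IsPumpingHeight {Δ : Signature} (T : Set (Tree Δ)) (p : ℕ) : Prop :=
  ∀ t ∈ T, p < t.height → ∃ C₁ C₂ C₃ C₄ t₅, IsPumpingDecomposition T p t C₁ C₂ C₃ C₄ t₅

/-- Every context of height at most `p` generates at most `l` string tokens and at most `l` edges. -/
def IsGenerationBound {Δ : Signature} {Λ : Type} {k : ℕ} (h : Hom Δ Λ k) (p l : ℕ) : Prop :=
  ∀ C : Ctx Δ, C.height ≤ p → C.yield.length ≤ l ∧ (h.ctxGraph C).size ≤ l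

/-! ## Separation and asynchrony -/

/-- `t = Dx[D₀[ty]]` is an `x,y,l`-separation of `t`. -/
structure IsSeparation {Δ : Signature} (x y : Letter) (l : ℕ) (t : Tree Δ)
    (Dx D₀ : Ctx Δ) (ty : Tree Δ) : Prop where
  eq : t = Dx.plug (D₀.plug ty)
  outer : Dx.yield.count (Token.core y) = 0
  middle : D₀.yield.count (Token.core x) ≤ l
  inner : ty.yield.count (Token.core x) = 0

/-- A separation is minimal if the height of its middle context is minimal. -/
def IsMinimalSeparation {Δ : Signature} (x y : Letter) (l : ℕ) (t : Tree Δ)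
    (Dx D₀ : Ctx Δ) (ty : Tree Δ) : Prop :=
  IsSeparation x y l t Dx D₀ ty ∧
    ∀ Ex E₀ sy, IsSeparation x y l t Ex E₀ sy → D₀.height ≤ E₀.height

/-- `t` is `x,y,l`-separated. -/
def Separated {Δ : Signature} (x y : Letter) (l : ℕ) (t : Tree Δ) : Prop :=
  ∃ Dx D₀ ty, IsSeparation x y l t Dx D₀ ty

/-- `t` is `x,y,l`-asynchronous: it has a minimal `x,y,l`-separation `Dx[D₀[ty]]` such that, for
`t₀ = D₀[ty]`, the number of `x̄`-edges of `t₀` is at most `nₓ l + m_x̄ (l + 1)` and the number of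
`ȳ`-edges of `t₀` is at least `n_ȳ - nₓ l - m_ȳ` (an integer).  Here `n_z` is the number of
`z`-tokens, and `m_z` the maximal length of a sequence of consecutive `z`-tokens, in the yield
of `t`. -/
def Asynchronous {Δ : Signature} {Λ : Type} {k : ℕ} (h : Hom Δ Λ k) (x y : Letter) (l : ℕ)
    (t : Tree Δ) : Prop :=
  ∃ Dx D₀ ty, IsMinimalSeparation x y l t Dx D₀ ty ∧
    (h.graph (D₀.plug ty)).edgeCount (.bar x) ≤
      t.yield.count (Token.core x) * l + maxRun (Token.bar x) t.yield * (l + 1) ∧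
    ((h.graph (D₀.plug ty)).edgeCount (.bar y) : ℤ) ≥
      (t.yield.count (Token.bar y) : ℤ) - t.yield.count (Token.core x) * l -
        maxRun (Token.bar y) t.yield

end SemCap

namespace SemCap

/-! ## Trees and contexts -/

/-! Pumping height: if no form repeats on a path of a derivation, the derived tree has bounded
height. A repetition among forms deriving trees, or among consecutive forms deriving contexts, is a
loop: it is cut out if it generates nothing and pumped otherwise (`Der.repeatFree_or_pumpable`). A
generation bound exists because only finitely many contexts have height at most `p`.

Asynchrony: since `h` is linear and nondeleting, edge counts are sums of node weights
(`Hom.count_graph`), and on trees of the language the weight for `z̄` equals the number of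
`z̄`-tokens. Consider a cut `E[t]` of such a tree with no `y` in `E`; it is applied to `E = Dx`, `t
= D₀[ty]`. The core is `cutBound`: edges and tokens of `t` differ, in the relevant directions, by at
most `nₓ l`, plus a term of at most one run for `ȳ`.

The proof is by induction on the number of nodes. In a tree of height at most `p`, the context `E`
has at most `l` tokens and edges, and the discrepancy of `t` is opposite to that of `E`. A higher
tree is pumped down to `C₁[C₃[t₅]]`, which is cut at a corresponding place. If this removes a letter
`x`, then `nₓ l` drops by at least `l`, which pays for the change of the discrepancy. Otherwise
neither `x` nor `y` is pumped. A pumped string with `z̄` but without `z` would then, when squared,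
have its `z̄`s in a single block and hence contain no brackets; pumping it would destroy the balance
of bars and brackets in suitable prefixes, suffixes or stretches next to a core letter
(`core_mem_of_pump_prefix` and its variants). So the discrepancy does not grow, except when `C₄`
writes `ȳ` into a block that spans `t₅`; there the bounds are read off the string
(`CutBound.of_tail`). Pumping down does not lengthen the longest run of `ȳ` (`maxRun_pumped_le`).

Finally, `D₀[ty]` has at most `l` letters `x`, so its `x̄` form at most `l + 1` groups, each within
a run. The `ȳ` outside `D₀[ty]` can only continue its last `y`-block, so they share one run with the
tail of that block (`CutBound.count_bar_le`). -/

theorem flatten_ofFn_split {α : Type*} : ∀ {n : ℕ} (g : Fin n → List α) (i : Fin n),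
    (List.ofFn g).flatten = (List.ofFn fun j => if j < i then g j else []).flatten ++ g i ++
      (List.ofFn fun j => if i < j then g j else []).flatten
  | 0, _, i => i.elim0
  | n + 1, g, i => by
    refine Fin.cases ?_ (fun i => ?_) i
    · have h : (fun j : Fin n => if (0 : Fin (n + 1)) < j.succ then g j.succ else []) =
          fun j => g j.succ := by
        funext j
        simp [Fin.succ_pos]
      simp [List.ofFn_succ]
    · simp only [List.ofFn_succ, List.flatten_cons, Fin.succ_pos, if_true, Fin.succ_lt_succ_iff,
        Fin.not_lt_zero, if_false, List.nil_append]
      rw [flatten_ofFn_split (fun j => g j.succ) i]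
      simp

theorem sum_dite_split {n : ℕ} (i : Fin n) (a b : ℕ) (g : (j : Fin n) → j ≠ i → ℕ) :
    (∑ j, if h : j = i then a + b else g j h) = (∑ j, if h : j = i then a else g j h) + b := by
  have : ∀ j, (if h : j = i then a + b else g j h) =
      (if h : j = i then a else g j h) + if j = i then b else 0 := by
    intro j
    split_ifs <;> simp
  simp [this, Finset.sum_add_distrib]

section Trees

variable {Δ : Signature}

/-- The total weight of the nodes of a tree. -/
def Tree.weight (c : Δ.Op → ℕ) : Tree Δ → ℕ
  | .node f ts => c f + ∑ j, (ts j).weight c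

/-- The total weight of the nodes of a context. -/
def Ctx.weight (c : Δ.Op → ℕ) : Ctx Δ → ℕ
  | .hole => 0
  | .node f i ts C => c f + ∑ j, if h : j = i then C.weight c else (ts ⟨j, h⟩).weight c

namespace Ctx

theorem weight_plug (c : Δ.Op → ℕ) (C : Ctx Δ) (t : Tree Δ) :
    (C.plug t).weight c = C.weight c + t.weight c := by
  induction C with
  | hole => simp [plug, weight]
  | node f i ts C ih =>
    have : ∀ j, Tree.weight c (if h : j = i then C.plug t else ts ⟨j, h⟩) =
        if h : j = i then C.weight c + t.weight c else (ts ⟨j, h⟩).weight c := by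
      intro j
      split_ifs <;> simp [ih]
    simp only [plug, Tree.weight, weight, this, sum_dite_split]
    ring

theorem weight_comp (c : Δ.Op → ℕ) (C D : Ctx Δ) :
    (C.comp D).weight c = C.weight c + D.weight c := by
  induction C with
  | hole => simp [comp, weight]
  | node f i ts C ih =>
    simp only [comp, weight, ih, sum_dite_split]
    ring

theorem plug_comp (C D : Ctx Δ) (t : Tree Δ) : (C.comp D).plug t = C.plug (D.plug t) := by
  induction C with
  | hole => rfl
  | node f i ts C ih => simp [comp, plug, ih]

theorem comp_assoc (C D E : Ctx Δ) : (C.comp D).comp E = C.comp (D.comp E) := by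
  induction C with
  | hole => rfl
  | node f i ts C ih => simp [comp, ih]

@[simp] theorem hole_comp (C : Ctx Δ) : hole.comp C = C := rfl

@[simp] theorem hole_plug (t : Tree Δ) : hole.plug t = t := rfl

@[simp] theorem comp_hole (C : Ctx Δ) : C.comp hole = C := by
  induction C with
  | hole => rfl
  | node f i ts C ih => simp [comp, ih]

theorem left_comp (C D : Ctx Δ) : (C.comp D).left = C.left ++ D.left := by
  induction C with
  | hole => rfl
  | node f i ts C ih => simp [comp, left, ih]

theorem right_comp (C D : Ctx Δ) : (C.comp D).right = D.right ++ C.right := by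
  induction C with
  | hole => simp [comp, right]
  | node f i ts C ih => simp [comp, right, ih]

theorem yield_plug (C : Ctx Δ) (t : Tree Δ) :
    (C.plug t).yield = C.left ++ t.yield ++ C.right := by
  induction C with
  | hole => simp [plug, left, right]
  | node f i ts C ih =>
    have h0 : Δ.rank f ≠ 0 := (i.pos).ne'
    simp only [plug, Tree.yield, h0, if_false]
    rw [flatten_ofFn_split _ i]
    simp only [dif_pos, ih, left, right, List.append_assoc]
    congr 2
    · congr 1
      funext j
      by_cases h : j < i
      · simp [h, h.ne]
      · simp [h]
    · congr 4
      funext j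
      by_cases h : i < j
      · simp [h, h.ne']
      · simp [h]

theorem height_le_plug (C : Ctx Δ) (t : Tree Δ) : C.height ≤ (C.plug t).height := by
  induction C with
  | hole => simp [height]
  | node f i ts C ih =>
    simp only [height, plug, Tree.height]
    refine Nat.add_le_add_left (max_le ?_ (Finset.sup_le fun j _ => ?_)) 1
    · refine ih.trans ?_
      simpa using Finset.le_sup (f := fun j =>
        Tree.height (if h : j = i then C.plug t else ts ⟨j, h⟩)) (Finset.mem_univ i)
    · simpa [j.2] using Finset.le_sup (f := fun j =>
        Tree.height (if h : j = i then C.plug t else ts ⟨j, h⟩)) (Finset.mem_univ (j : Fin _))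

theorem height_plug_le (C : Ctx Δ) (t : Tree Δ) : (C.plug t).height ≤ C.height + t.height := by
  induction C with
  | hole => simp [height]
  | node f i ts C ih =>
    simp only [height, plug, Tree.height]
    rw [Nat.add_assoc]
    refine Nat.add_le_add_left (Finset.sup_le fun j _ => ?_) 1
    by_cases h : j = i
    · simp only [h, dif_pos]
      exact ih.trans (Nat.add_le_add_right (le_max_left _ _) _)
    · simp only [h, dif_neg, not_false_eq_true]
      refine le_trans ?_ (Nat.le_add_right _ _)
      exact (Finset.le_sup (f := fun j => (ts j).height) (Finset.mem_univ ⟨j, h⟩)).trans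
        (le_max_right _ _)

theorem height_comp_le (C D : Ctx Δ) : (C.comp D).height ≤ C.height + D.height := by
  induction C with
  | hole => simp [height]
  | node f i ts C ih =>
    simp only [height, comp]
    omega

theorem weight_pos {C : Ctx Δ} (h : 0 < C.height) : 0 < C.weight fun _ => 1 := by
  cases C with
  | hole => simp [height] at h
  | node f i ts C => simp only [weight]; omega

theorem eq_hole {C : Ctx Δ} (h : C.height = 0) : C = hole := by
  cases C with
  | hole => rfl
  | node f i ts C => simp only [height] at h; omega

/-- In the tree `C.plug u`, the subtree `w` and the hole of `C` are at incomparable positions;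
`G u` is the context that remains if `w` is removed. -/
structure Incomparable (C : Ctx Δ) (w : Tree Δ) (G : Tree Δ → Ctx Δ) : Prop where
  plug_eq : ∀ u, (G u).plug w = C.plug u
  side : (∃ α β γ, ∀ u, (G u).left = α ∧ (G u).right = β ++ u.yield ++ γ) ∨
    ∃ α β γ, ∀ u, (G u).left = α ++ u.yield ++ β ∧ (G u).right = γ
  yield_sublist : w.yield.Sublist C.yield
  weight_le : ∀ c, w.weight c ≤ C.weight c

theorem Incomparable.node {C : Ctx Δ} {w : Tree Δ} {G : Tree Δ → Ctx Δ} (h : C.Incomparable w G)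
    (f : Δ.Op) (i : Fin (Δ.rank f)) (ts : {j : Fin (Δ.rank f) // j ≠ i} → Tree Δ) :
    (node f i ts C).Incomparable w fun u => node f i ts (G u) where
  plug_eq u := by simp [plug, h.plug_eq]
  side := by
    have hl : ∀ D, (Ctx.node f i ts D).left = (Ctx.node f i ts hole).left ++ D.left :=
      fun D => left_comp (Ctx.node f i ts hole) D
    have hr : ∀ D, (Ctx.node f i ts D).right = D.right ++ (Ctx.node f i ts hole).right :=
      fun D => right_comp (Ctx.node f i ts hole) D
    rcases h.side with ⟨α, β, γ, hs⟩ | ⟨α, β, γ, hs⟩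
    · refine Or.inl ⟨(Ctx.node f i ts hole).left ++ α, β, γ ++ (Ctx.node f i ts hole).right,
        fun u => ⟨?_, ?_⟩⟩
      · rw [hl, (hs u).1]
      · rw [hr, (hs u).2, ← List.append_assoc]
    · refine Or.inr ⟨(Ctx.node f i ts hole).left ++ α, β, γ ++ (Ctx.node f i ts hole).right,
        fun u => ⟨?_, ?_⟩⟩
      · rw [hl, (hs u).1]
        simp only [List.append_assoc]
      · rw [hr, (hs u).2]
  yield_sublist := by
    refine h.yield_sublist.trans ?_
    simp only [yield, left, right, List.append_assoc]
    refine List.Sublist.trans ?_ (List.sublist_append_right _ _)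
    rw [← List.append_assoc]
    exact List.sublist_append_left _ _
  weight_le c := by
    refine (h.weight_le c).trans ?_
    simp only [weight]
    have := Finset.single_le_sum (f := fun j => if h : j = i then C.weight c
      else (ts ⟨j, h⟩).weight c) (fun _ _ => Nat.zero_le _) (Finset.mem_univ i)
    simp only [dif_pos] at this
    omega

/-- The paths part at this node, so `w` lies in a side tree of `C`. The order of `i` and `j` decides
on which side of the new hole the yield of `u` appears. -/
theorem incomparable_of_ne {f : Δ.Op} {i j : Fin (Δ.rank f)} (hij : i ≠ j)
    (ts : {k : Fin (Δ.rank f) // k ≠ i} → Tree Δ) (ss : {k : Fin (Δ.rank f) // k ≠ j} → Tree Δ)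
    (C D : Ctx Δ) (w : Tree Δ) (hD : ts ⟨j, hij.symm⟩ = D.plug w)
    (hts : ∀ k (h : k ≠ i) (h' : k ≠ j), ts ⟨k, h⟩ = ss ⟨k, h'⟩) :
    (node f i ts C).Incomparable w fun u =>
      node f j (fun k => if k.1 = i then C.plug u else ss k) D where
  plug_eq u := by
    simp only [plug, Tree.node.injEq, heq_eq_eq, true_and]
    funext k
    by_cases h : k = j
    · subst h
      simp [hij.symm, hD]
    · by_cases h' : k = i
      · simp [h']
        exact fun h => absurd h hij
      · simp [h, h', hts]
  side := by
    rcases lt_or_gt_of_ne hij with h | h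
    · right
      refine ⟨(List.ofFn fun k => if k < i then
          (if h : k < j then (ss ⟨k, h.ne⟩).yield else []) else []).flatten ++ C.left,
        C.right ++ (List.ofFn fun k => if i < k then
          (if h : k < j then (ss ⟨k, h.ne⟩).yield else []) else []).flatten ++ D.left,
        D.right ++ (List.ofFn fun k => if h : j < k then (ss ⟨k, h.ne'⟩).yield else []).flatten,
        fun u => ⟨?_, ?_⟩⟩
      · simp only [left]
        rw [flatten_ofFn_split _ i]
        simp only [h, dif_pos, if_pos, yield_plug, List.append_assoc]
        congr 2
        · congr 1
          funext k
          by_cases hk : k < i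
          · simp [hk, hk.ne]
          · simp [hk]
        · congr 5
          funext k
          by_cases hk : i < k
          · simp [hk, hk.ne']
          · simp [hk]
      · simp only [right]
        congr 3
        funext k
        by_cases hk : j < k
        · simp [hk, (h.trans hk).ne']
        · simp [hk]
    · left
      refine ⟨(List.ofFn fun k => if h : k < j then (ss ⟨k, h.ne⟩).yield else []).flatten ++ D.left,
        D.right ++ (List.ofFn fun k => if k < i then
          (if h : j < k then (ss ⟨k, h.ne'⟩).yield else []) else []).flatten ++ C.left,
        C.right ++ (List.ofFn fun k => if i < k then
          (if h : j < k then (ss ⟨k, h.ne'⟩).yield else []) else []).flatten,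
        fun u => ⟨?_, ?_⟩⟩
      · simp only [left]
        congr 3
        funext k
        by_cases hk : k < j
        · simp [hk, (hk.trans h).ne]
        · simp [hk]
      · simp only [right]
        rw [flatten_ofFn_split _ i]
        simp only [h, dif_pos, if_pos, yield_plug, List.append_assoc]
        congr 2
        · congr 2
          funext k
          by_cases hk : k < i
          · simp [hk, hk.ne]
          · simp [hk]
        · congr 5
          funext k
          by_cases hk : i < k
          · simp [hk, hk.ne']
          · simp [hk]
  yield_sublist := by
    have h1 : w.yield.Sublist (ts ⟨j, hij.symm⟩).yield := by
      rw [hD, yield_plug, List.append_assoc]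
      exact (List.sublist_append_left _ _).trans (List.sublist_append_right _ _)
    refine h1.trans ?_
    rcases lt_or_gt_of_ne hij with h | h
    · refine List.Sublist.trans ?_ (List.sublist_append_right _ _)
      refine List.Sublist.trans ?_ (List.sublist_append_right _ _)
      refine List.sublist_flatten_of_mem ?_
      rw [List.mem_ofFn]
      exact ⟨j, by simp [h]⟩
    · refine List.Sublist.trans ?_ (List.sublist_append_left _ _)
      refine List.Sublist.trans ?_ (List.sublist_append_left _ _)
      refine List.sublist_flatten_of_mem ?_
      rw [List.mem_ofFn]
      exact ⟨j, by simp [h]⟩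
  weight_le c := by
    have h1 : w.weight c ≤ (ts ⟨j, hij.symm⟩).weight c := by
      rw [hD, weight_plug]
      omega
    refine h1.trans ?_
    simp only [weight]
    have := Finset.single_le_sum (f := fun k => if h : k = i then C.weight c
      else (ts ⟨k, h⟩).weight c) (fun _ _ => Nat.zero_le _) (Finset.mem_univ j)
    simp only [hij.symm, dif_neg, not_false_eq_true] at this
    omega

/-- The possible relative positions of two subtrees of a tree. -/
theorem compare (C : Ctx Δ) : ∀ (D : Ctx Δ) (u w : Tree Δ), C.plug u = D.plug w →
    (∃ F, C = D.comp F ∧ w = F.plug u) ∨ (∃ F, D = C.comp F ∧ u = F.plug w) ∨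
      ∃ G, D = G u ∧ C.Incomparable w G := by
  induction C with
  | hole => exact fun D u w h => Or.inr (Or.inl ⟨D, rfl, h⟩)
  | node f i ts C ih =>
    intro D u w h
    cases D with
    | hole => exact Or.inl ⟨_, rfl, h.symm⟩
    | node g j ss D =>
      simp only [plug, Tree.node.injEq] at h
      obtain ⟨rfl, h⟩ := h
      have h := congrFun (eq_of_heq h)
      by_cases hij : i = j
      · subst hij
        have hts : ts = ss := by
          funext k
          simpa [k.2] using h k
        subst hts
        have hi := h i
        simp only [dif_pos] at hi
        rcases ih D u w hi with ⟨F, rfl, rfl⟩ | ⟨F, rfl, rfl⟩ | ⟨G, rfl, hG⟩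
        · exact Or.inl ⟨F, rfl, rfl⟩
        · exact Or.inr (Or.inl ⟨F, rfl, rfl⟩)
        · exact Or.inr (Or.inr ⟨_, rfl, hG.node f i ts⟩)
      · refine Or.inr (Or.inr ⟨_, ?_, incomparable_of_ne hij ts ss C D w ?_ ?_⟩)
        · congr 1
          funext k
          split_ifs with hk
          · have := h i
            simp only [dif_pos, hij, dif_neg, not_false_eq_true] at this
            rw [this]
            congr 1
            exact Subtype.ext hk
          · rfl
        · simpa [Ne.symm hij] using h j
        · intro k hk hk'
          simpa [hk, hk'] using h k

end Ctx

end Trees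

/-! ## Numbers of edges -/

section Edges

variable {Λ : Type} {k n : ℕ}

/-- The number of edges with a label that satisfies `P`. -/
noncomputable def Graph.count (P : Sym ⊕ Λ → Prop) (g : Graph Λ) : ℕ :=
  Nat.card {e : g.E // P (g.lab e)}

theorem SGraph.count_empty (P : Sym ⊕ Λ → Prop) : (SGraph.empty Λ k).toGraph.count P = 0 := by
  have : IsEmpty {e : (SGraph.empty Λ k).E // P ((SGraph.empty Λ k).lab e)} :=
    ⟨fun e => nomatch e.1⟩
  exact Nat.card_of_isEmpty

theorem SGraph.count_par (P : Sym ⊕ Λ → Prop) (g g' : SGraph Λ k) :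
    (g.par g').toGraph.count P = g.toGraph.count P + g'.toGraph.count P := by
  have := g.finE
  have := g'.finE
  rw [Graph.count, Graph.count, Graph.count, ← Nat.card_sum]
  exact Nat.card_congr Equiv.subtypeSum

/-- Parallel composition merges vertices only, and renaming and forgetting leave the graph
unchanged; hence edges are never identified or lost. -/
theorem HRTerm.count_eval (P : Sym ⊕ Λ → Prop) (ρ : Fin n → SGraph Λ k) (u : HRTerm Λ k n) :
    (u.eval ρ).toGraph.count P = (u.eval fun _ => SGraph.empty Λ k).toGraph.count P +
      ∑ i, u.occ i * (ρ i).toGraph.count P := by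
  induction u with
  | var i => simp [eval, occ, SGraph.count_empty]
  | const g => simp [eval, occ]
  | par u v hu hv =>
    simp only [eval, occ, SGraph.count_par, hu, hv, add_mul, Finset.sum_add_distrib]
    ring
  | rename σ u hu => exact hu
  | forget a u hu => exact hu

namespace Hom

variable {Δ : Signature} (h : Hom Δ Λ k)

/-- The number of edges with a label that satisfies `P` contributed by a symbol. -/
noncomputable def opCount (P : Sym ⊕ Λ → Prop) (f : Δ.Op) : ℕ :=
  ((h.image f).eval fun _ => SGraph.empty Λ k).toGraph.count P

/-- Linearity and nondeletion make every multiplicity in `HRTerm.count_eval` equal to 1, so the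
count is additive over nodes. -/
theorem count_graph (P : Sym ⊕ Λ → Prop) (t : Tree Δ) :
    (h.graph t).toGraph.count P = t.weight (h.opCount P) := by
  induction t with
  | node f ts ih =>
    simp only [graph, Tree.weight]
    rw [HRTerm.count_eval]
    simp [h.occ_eq_one, ih, opCount]

theorem count_ctxGraph (P : Sym ⊕ Λ → Prop) (C : Ctx Δ) :
    (h.ctxGraph C).toGraph.count P = C.weight (h.opCount P) := by
  induction C with
  | hole => exact SGraph.count_empty P
  | node f i ts C ih =>
    simp only [ctxGraph, Ctx.weight]
    rw [HRTerm.count_eval]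
    simp only [h.occ_eq_one, one_mul, opCount]
    congr 1
    refine Finset.sum_congr rfl fun j _ => ?_
    split_ifs
    · exact ih
    · exact h.count_graph P _

/-- The number of `z`-edges contributed by a symbol. -/
noncomputable def edges (z : Sym) : Δ.Op → ℕ := h.opCount fun l => l = Sum.inl z

theorem edgeCount_graph (z : Sym) (t : Tree Δ) :
    (h.graph t).edgeCount z = t.weight (h.edges z) :=
  h.count_graph (fun l => l = Sum.inl z) t

theorem sum_edges_le (C : Ctx Δ) (z : Sym) : C.weight (h.edges z) ≤ (h.ctxGraph C).size := by
  have := (h.ctxGraph C).finE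
  rw [edges, ← h.count_ctxGraph, Graph.size]
  exact Finite.card_subtype_le _

end Hom

end Edges

/-! ## Contexts of bounded height -/

section Bounded

variable {Δ : Signature}

theorem finite_height_le (n : ℕ) : {t : Tree Δ | t.height ≤ n}.Finite := by
  have := Δ.finOp
  induction n with
  | zero =>
    convert Set.finite_empty
    ext t
    cases t
    simp [Tree.height]
  | succ n ih =>
    have := ih.to_subtype
    refine (Set.finite_range fun q : (f : Δ.Op) × (Fin (Δ.rank f) → {t : Tree Δ | t.height ≤ n}) =>
      Tree.node q.1 fun j => (q.2 j).1).subset ?_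
    rintro ⟨f, ts⟩ ht
    simp only [Tree.height, Set.mem_ofPred_eq] at ht
    have h1 : (Finset.univ.sup fun j => (ts j).height) ≤ n := by omega
    exact ⟨⟨f, fun j => ⟨ts j, (Finset.le_sup (f := fun j => (ts j).height)
      (Finset.mem_univ j)).trans h1⟩⟩, rfl⟩

theorem finite_ctx_height_le (n : ℕ) : {C : Ctx Δ | C.height ≤ n}.Finite := by
  have := Δ.finOp
  induction n with
  | zero =>
    refine (Set.finite_singleton Ctx.hole).subset fun C hC => ?_
    exact Ctx.eq_hole (Nat.le_zero.mp hC)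
  | succ n ih =>
    have := ih.to_subtype
    have := (finite_height_le (Δ := Δ) n).to_subtype
    refine ((Set.finite_singleton Ctx.hole).union (Set.finite_range
      fun q : (f : Δ.Op) × (i : Fin (Δ.rank f)) × ({j : Fin (Δ.rank f) // j ≠ i} →
        {t : Tree Δ | t.height ≤ n}) × {C : Ctx Δ | C.height ≤ n} =>
      Ctx.node q.1 q.2.1 (fun j => (q.2.2.1 j).1) q.2.2.2.1)).subset ?_
    rintro (_ | ⟨f, i, ts, C⟩) hC
    · exact Or.inl rfl
    · simp only [Ctx.height, Set.mem_ofPred_eq] at hC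
      have h1 : (Finset.univ.sup fun j => (ts j).height) ≤ n := by omega
      exact Or.inr ⟨⟨f, i, fun j => ⟨ts j, (Finset.le_sup (f := fun j => (ts j).height)
        (Finset.mem_univ j)).trans h1⟩, ⟨C, by show C.height ≤ n; omega⟩⟩, rfl⟩

theorem exists_generationBound {Λ : Type} {k : ℕ} (h : Hom Δ Λ k) (p : ℕ) :
    ∃ l, IsGenerationBound h p l := by
  obtain ⟨l, hl⟩ := ((finite_ctx_height_le (Δ := Δ) p).image
    fun C => C.yield.length + (h.ctxGraph C).size).bddAbove
  refine ⟨l, fun C hC => ?_⟩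
  have := hl ⟨C, hC, rfl⟩
  simp only at this
  omega

end Bounded

end SemCap
namespace SemCap

/-! ## Big-step semantics of grammars -/

section Grammar

variable {Δ : Signature}

namespace Form

variable {N₀ N₁ : Type}

theorem subst_x (u : Form Δ N₀ N₁) : subst x u = u := by
  induction u with
  | x => rfl
  | node f ts ih => simp [subst, ih]
  | nt₀ A => rfl
  | nt₁ A u ih => simp [subst, ih]

theorem subst_of_occ_eq_zero (s u : Form Δ N₀ N₁) (h : u.occ = 0) : subst s u = u := by
  induction u with
  | x => simp [occ] at h
  | node f ts ih =>
    simp only [occ, Finset.sum_eq_zero_iff, Finset.mem_univ, true_imp_iff] at h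
    simp only [subst, node.injEq, heq_eq_eq, true_and]
    exact funext fun j => ih j (h j)
  | nt₀ A => rfl
  | nt₁ A u ih => simp only [subst, ih h]

/-- The set of subforms of a form. -/
def subforms : Form Δ N₀ N₁ → Set (Form Δ N₀ N₁)
  | x => {x}
  | node f ts => insert (node f ts) (⋃ j, subforms (ts j))
  | nt₀ A => {nt₀ A}
  | nt₁ A u => insert (nt₁ A u) (subforms u)

theorem self_mem_subforms (u : Form Δ N₀ N₁) : u ∈ u.subforms := by
  cases u <;> simp [subforms]

theorem finite_subforms (u : Form Δ N₀ N₁) : u.subforms.Finite := by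
  induction u with
  | x => exact Set.finite_singleton _
  | node f ts ih => exact (Set.finite_iUnion ih).insert _
  | nt₀ A => exact Set.finite_singleton _
  | nt₁ A u ih => exact ih.insert _

theorem mem_subforms_of_node {u : Form Δ N₀ N₁} {f : Δ.Op} {ts : Fin (Δ.rank f) → Form Δ N₀ N₁}
    (h : node f ts ∈ u.subforms) (j : Fin (Δ.rank f)) : ts j ∈ u.subforms := by
  induction u with
  | x => simp [subforms] at h
  | node g ss ih =>
    rcases h with h | h
    · simp only [node.injEq] at h
      obtain ⟨rfl, h⟩ := h
      obtain rfl := eq_of_heq h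
      exact Or.inr (Set.mem_iUnion.mpr ⟨j, self_mem_subforms _⟩)
    · obtain ⟨i, hi⟩ := Set.mem_iUnion.mp h
      exact Or.inr (Set.mem_iUnion.mpr ⟨i, ih i hi⟩)
  | nt₀ A => simp [subforms] at h
  | nt₁ A u ih =>
    rcases h with h | h
    · exact absurd h (by simp)
    · exact Or.inr (ih h)

theorem mem_subforms_of_nt₁ {u : Form Δ N₀ N₁} {A : N₁} {v : Form Δ N₀ N₁}
    (h : nt₁ A v ∈ u.subforms) : v ∈ u.subforms := by
  induction u with
  | x => simp [subforms] at h
  | node g ss ih =>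
    rcases h with h | h
    · exact absurd h (by simp)
    · obtain ⟨i, hi⟩ := Set.mem_iUnion.mp h
      exact Or.inr (Set.mem_iUnion.mpr ⟨i, ih i hi⟩)
  | nt₀ A => simp [subforms] at h
  | nt₁ A u ih =>
    rcases h with h | h
    · obtain ⟨rfl, rfl⟩ := (nt₁.injEq ..).mp h
      exact Or.inr (self_mem_subforms _)
    · exact Or.inr (ih h)

end Form

/-- A tree or a context. -/
inductive Val (Δ : Signature) : Type where
  | tree (t : Tree Δ)
  | ctx (C : Ctx Δ)

namespace LMCFTG

/-- `G.Der φ (.tree t)`: the form `φ` derives the tree `t`, whatever is substituted for the variable;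
`G.Der φ (.ctx C)`: the form `φ` derives the context `C`, with the variable in the hole. -/
inductive Der (G : LMCFTG Δ) : Form Δ G.N₀ G.N₁ → Val Δ → Prop
  | node (f : Δ.Op) (φs : Fin (Δ.rank f) → Form Δ G.N₀ G.N₁) (ts : Fin (Δ.rank f) → Tree Δ)
      (h : ∀ j, Der G (φs j) (.tree (ts j))) : Der G (.node f φs) (.tree (.node f ts))
  | nt₀ {A : G.N₀} {u : Form Δ G.N₀ G.N₁} {t : Tree Δ} (h : (A, u) ∈ G.rules₀)
      (hu : Der G u (.tree t)) : Der G (.nt₀ A) (.tree t)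
  | plug {A : G.N₁} {u v : Form Δ G.N₀ G.N₁} {C : Ctx Δ} {t : Tree Δ} (h : (A, u) ∈ G.rules₁)
      (hu : Der G u (.ctx C)) (hv : Der G v (.tree t)) : Der G (.nt₁ A v) (.tree (C.plug t))
  | erase {A : G.N₁} {u : Form Δ G.N₀ G.N₁} (v : Form Δ G.N₀ G.N₁) {t : Tree Δ}
      (h : (A, u) ∈ G.rules₁) (hu : Der G u (.tree t)) : Der G (.nt₁ A v) (.tree t)
  | hole : Der G .x (.ctx .hole)
  | ctxNode (f : Δ.Op) (φs : Fin (Δ.rank f) → Form Δ G.N₀ G.N₁) (i : Fin (Δ.rank f))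
      (ts : {j : Fin (Δ.rank f) // j ≠ i} → Tree Δ) (C : Ctx Δ) (hC : Der G (φs i) (.ctx C))
      (h : ∀ j : {j : Fin (Δ.rank f) // j ≠ i}, Der G (φs j) (.tree (ts j))) :
      Der G (.node f φs) (.ctx (.node f i ts C))
  | comp {A : G.N₁} {u v : Form Δ G.N₀ G.N₁} {C D : Ctx Δ} (h : (A, u) ∈ G.rules₁)
      (hu : Der G u (.ctx C)) (hv : Der G v (.ctx D)) : Der G (.nt₁ A v) (.ctx (C.comp D))

variable {G : LMCFTG Δ}

/-- The children are rewritten one after the other, by induction on the set of finished children. -/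
theorem reflTransGen_node (f : Δ.Op) (a b : Fin (Δ.rank f) → Form Δ G.N₀ G.N₁)
    (h : ∀ j, Relation.ReflTransGen G.Step (a j) (b j)) :
    Relation.ReflTransGen G.Step (.node f a) (.node f b) := by
  have key : ∀ S : Finset (Fin (Δ.rank f)), Relation.ReflTransGen G.Step (.node f a)
      (.node f fun j => if j ∈ S then b j else a j) := by
    intro S
    induction S using Finset.induction_on with
    | empty => simpa using Relation.ReflTransGen.refl
    | insert i S hi ih =>
      refine ih.trans ?_
      have hlift : ∀ u, Relation.ReflTransGen G.Step (a i) u → Relation.ReflTransGen G.Step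
          (.node f fun j => if j ∈ S then b j else a j)
          (.node f (Function.update (fun j => if j ∈ S then b j else a j) i u)) := by
        intro u hu
        induction hu with
        | refl =>
          have : Function.update (fun j => if j ∈ S then b j else a j) i (a i) =
              fun j => if j ∈ S then b j else a j := by
            rw [Function.update_eq_self_iff]
            simp [hi]
          rw [this]
        | tail _ hs ih =>
          refine ih.tail ?_
          have := Step.node f (Function.update (fun j => if j ∈ S then b j else a j) i _) i
            (by simpa using hs)
          simpa using this
      convert hlift _ (h i) using 2
      funext j
      by_cases hj : j = i
      · subst hj
        simp
      · simp [hj]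
  simpa using key Finset.univ

theorem Der.sound {φ : Form Δ G.N₀ G.N₁} {v : Val Δ} (h : G.Der φ v) :
    match v with
    | .tree t => ∀ s, Relation.ReflTransGen G.Step (.subst s φ) (.ofTree t)
    | .ctx C => ∀ s t, Relation.ReflTransGen G.Step s (.ofTree t) →
        Relation.ReflTransGen G.Step (.subst s φ) (.ofTree (C.plug t)) := by
  induction h with
  | node f φs ts h ih => exact fun s => reflTransGen_node f _ _ fun j => ih j s
  | nt₀ h hu ih =>
    intro s
    refine Relation.ReflTransGen.head (Step.rule₀ h) ?_
    simpa [Form.subst_x] using ih .x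
  | plug h hu hv ihu ihv =>
    intro s
    exact Relation.ReflTransGen.head (Step.rule₁ h _) (ihu _ _ (ihv s))
  | erase v h hu ih =>
    intro s
    exact Relation.ReflTransGen.head (Step.rule₁ h _) (ih _)
  | hole => exact fun s t hs => hs
  | ctxNode f φs i ts C hC h ihC ih =>
    intro s t hs
    simp only [Ctx.plug, Form.ofTree, Form.subst]
    refine reflTransGen_node f _ _ fun j => ?_
    by_cases hj : j = i
    · subst hj
      simpa using ihC s t hs
    · simpa [hj] using ih ⟨j, hj⟩ s
  | comp h hu hv ihu ihv =>
    intro s t hs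
    rw [Ctx.plug_comp]
    exact Relation.ReflTransGen.head (Step.rule₁ h _) (ihu _ _ (ihv s t hs))

/-- With linearity, this confines the variable to the one child that derives a context. -/
theorem Der.occ_pos {φ : Form Δ G.N₀ G.N₁} {v : Val Δ} (h : G.Der φ v) :
    match v with
    | .tree _ => True
    | .ctx _ => 0 < φ.occ := by
  induction h with
  | hole => simp [Form.occ]
  | ctxNode f φs i ts C hC h ihC ih =>
    exact lt_of_lt_of_le ihC (Finset.single_le_sum (f := fun j => (φs j).occ)
      (fun _ _ => Nat.zero_le _) (Finset.mem_univ i))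
  | comp h hu hv ihu ihv => exact ihv
  | _ => trivial

/-- Linearity enters here: at most one child of a node can need the substituted form `s`, and the
path to it becomes the context. If no child needs it, the same tree is derived without `s`. -/
theorem Der.of_subst {s u : Form Δ G.N₀ G.N₁} (hu : u.occ ≤ 1) {t : Tree Δ}
    (h : G.Der (.subst s u) (.tree t)) :
    G.Der u (.tree t) ∨ ∃ C t', G.Der u (.ctx C) ∧ G.Der s (.tree t') ∧ t = C.plug t' := by
  induction u generalizing t with
  | x => exact Or.inr ⟨.hole, t, .hole, h, rfl⟩
  | node f φs ih =>
    cases h with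
    | node _ _ ts h =>
      have hle : ∀ j, (φs j).occ ≤ 1 := fun j =>
        (Finset.single_le_sum (f := fun j => (φs j).occ)
          (fun _ _ => Nat.zero_le _) (Finset.mem_univ j)).trans hu
      by_cases hall : ∀ j, G.Der (φs j) (.tree (ts j))
      · exact Or.inl (.node f φs ts hall)
      · push Not at hall
        obtain ⟨i, hi⟩ := hall
        obtain ⟨C, t', hC, ht', hti⟩ := (ih i (hle i) (h i)).resolve_left hi
        refine Or.inr ⟨.node f i (fun j => ts j) C, t', .ctxNode f φs i _ C hC fun j => ?_, ht', ?_⟩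
        · have h0 : (φs j).occ = 0 := by
            have hpos : 0 < (φs i).occ := hC.occ_pos
            have h2 : ∑ k ∈ {i, j.1}, (φs k).occ ≤ ∑ k, (φs k).occ :=
              Finset.sum_le_sum_of_subset (Finset.subset_univ _)
            rw [Finset.sum_pair j.2.symm] at h2
            simp only [Form.occ] at hu
            omega
          have : G.Der (Form.subst s (φs j)) (.tree (ts j)) := h j
          rwa [Form.subst_of_occ_eq_zero _ _ h0] at this
        · simp only [Ctx.plug, Tree.node.injEq, heq_eq_eq, true_and]
          funext j
          by_cases hj : j = i
          · subst hj
            simp [hti]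
          · simp [hj]
  | nt₀ A => exact Or.inl h
  | nt₁ A v ih =>
    cases h with
    | plug h hw hv =>
      rcases ih hu hv with hv | ⟨C, t', hC, ht', rfl⟩
      · exact Or.inl (.plug h hw hv)
      · exact Or.inr ⟨_, t', .comp h hw hC, ht', (Ctx.plug_comp _ _ _).symm⟩
    | erase _ h hw => exact Or.inl (.erase _ h hw)

/-- Closure under backward steps; starting from `Der.ofTree` it gives completeness of the big-step
semantics. -/
theorem Der.of_step {φ ψ : Form Δ G.N₀ G.N₁} (hs : G.Step φ ψ) {t : Tree Δ}
    (h : G.Der ψ (.tree t)) : G.Der φ (.tree t) := by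
  induction hs generalizing t with
  | rule₀ hr => exact .nt₀ hr h
  | rule₁ hr s =>
    rcases Der.of_subst (G.linear _ hr) h with h | ⟨C, t', hC, ht', rfl⟩
    · exact .erase _ hr h
    · exact .plug hr hC ht'
  | node f φs i hs ih =>
    cases h with
    | node _ _ ts h =>
      refine .node f φs ts fun j => ?_
      have hj := h j
      by_cases hji : j = i
      · subst hji
        rw [Function.update_self] at hj
        exact ih hj
      · rwa [Function.update_of_ne hji] at hj
  | nt₁ A hs ih =>
    cases h with
    | plug h hu hv => exact .plug h hu (ih hv)
    | erase _ h hu => exact .erase _ h hu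

theorem Der.ofTree (t : Tree Δ) : G.Der (.ofTree t) (.tree t) := by
  induction t with
  | node f ts ih => exact .node f _ ts ih

theorem Der.of_reflTransGen {φ : Form Δ G.N₀ G.N₁} {t : Tree Δ}
    (h : Relation.ReflTransGen G.Step φ (.ofTree t)) : G.Der φ (.tree t) := by
  induction h using Relation.ReflTransGen.head_induction_on with
  | refl => exact Der.ofTree t
  | head hs _ ih => exact ih.of_step hs

theorem mem_language_iff {t : Tree Δ} : t ∈ G.language ↔ G.Der (.nt₀ G.start) (.tree t) :=
  ⟨Der.of_reflTransGen, fun h => h.sound .x⟩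

/-! ## Derivations without repetitions -/

theorem node_eq_plug {f : Δ.Op} (ts : Fin (Δ.rank f) → Tree Δ) (i : Fin (Δ.rank f)) (K : Ctx Δ)
    (r : Tree Δ) : (Ctx.node f i (fun j => ts j) K).plug r =
      .node f (Function.update ts i (K.plug r)) := by
  simp only [Ctx.plug, Tree.node.injEq, heq_eq_eq, true_and]
  funext j
  by_cases hj : j = i
  · subst hj
    simp
  · simp [hj]

theorem Der.node_update {f : Δ.Op} {φs : Fin (Δ.rank f) → Form Δ G.N₀ G.N₁}
    {ts : Fin (Δ.rank f) → Tree Δ} (h : ∀ j, G.Der (φs j) (.tree (ts j))) (i : Fin (Δ.rank f))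
    {r : Tree Δ} (hr : G.Der (φs i) (.tree r)) :
    G.Der (.node f φs) (.tree (.node f (Function.update ts i r))) := by
  refine .node f φs _ fun j => ?_
  by_cases hj : j = i
  · subst hj
    simpa using hr
  · simpa [hj] using h j

theorem Der.ctxNode_update {f : Δ.Op} {φs : Fin (Δ.rank f) → Form Δ G.N₀ G.N₁}
    {i : Fin (Δ.rank f)} {ts : {j : Fin (Δ.rank f) // j ≠ i} → Tree Δ} {C : Ctx Δ}
    (hC : G.Der (φs i) (.ctx C))
    (h : ∀ j : {j : Fin (Δ.rank f) // j ≠ i}, G.Der (φs j) (.tree (ts j)))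
    (j : {j : Fin (Δ.rank f) // j ≠ i})
    {r : Tree Δ} (hr : G.Der (φs j) (.tree r)) :
    G.Der (.node f φs) (.ctx (.node f i (Function.update ts j r) C)) := by
  refine .ctxNode f φs i _ C hC fun k => ?_
  by_cases hk : k = j
  · subst hk
    simpa using hr
  · simpa [hk] using h k

/-- A side tree of a context is seen through a hole only after the original hole is filled. This is
why pumping inside a context is described by a map `κ` and by what it gives for each filling `s`. -/
theorem ctxNode_update_plug {f : Δ.Op} {i : Fin (Δ.rank f)}
    (ts : {j : Fin (Δ.rank f) // j ≠ i} → Tree Δ) (C : Ctx Δ) (j : {j : Fin (Δ.rank f) // j ≠ i})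
    (s : Tree Δ) : ∃ K : Ctx Δ, ∀ r, (Ctx.node f i (Function.update ts j r) C).plug s = K.plug r := by
  refine ⟨.node f j.1 (fun k => if h : k.1 = i then C.plug s else ts ⟨k, h⟩) .hole, fun r => ?_⟩
  simp only [Ctx.plug, Tree.node.injEq, heq_eq_eq, true_and]
  funext k
  by_cases hk : k = i
  · subst hk
    simp [Ne.symm j.2]
  · by_cases hkj : k = j.1
    · subst hkj
      simp [j.2]
    · have : (⟨k, hk⟩ : {j : Fin (Δ.rank f) // j ≠ i}) ≠ j := fun h => hkj (by rw [← h])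
      simp [hk, hkj, this]

section Pumping

variable [DecidableEq (Form Δ G.N₀ G.N₁)] (W : Finset (Form Δ G.N₀ G.N₁))

/-- Derivations in which, on every path, the forms that derive trees are pairwise distinct and belong
to `S`, and consecutive forms that derive contexts are pairwise distinct and belong to `W`; for the
consecutive forms at the beginning, `W` is replaced by `U`. -/
inductive RepeatFree : Finset (Form Δ G.N₀ G.N₁) → Finset (Form Δ G.N₀ G.N₁) →
    Form Δ G.N₀ G.N₁ → Val Δ → Prop
  | node {S U : Finset (Form Δ G.N₀ G.N₁)} (f : Δ.Op) (φs : Fin (Δ.rank f) → Form Δ G.N₀ G.N₁)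
      (ts : Fin (Δ.rank f) → Tree Δ) (hS : .node f φs ∈ S)
      (h : ∀ j, RepeatFree (S.erase (.node f φs)) W (φs j) (.tree (ts j))) :
      RepeatFree S U (.node f φs) (.tree (.node f ts))
  | nt₀ {S U : Finset (Form Δ G.N₀ G.N₁)} {A : G.N₀} {u : Form Δ G.N₀ G.N₁} {t : Tree Δ}
      (hS : .nt₀ A ∈ S) (h : (A, u) ∈ G.rules₀) (hu : RepeatFree (S.erase (.nt₀ A)) W u (.tree t)) :
      RepeatFree S U (.nt₀ A) (.tree t)
  | plug {S U : Finset (Form Δ G.N₀ G.N₁)} {A : G.N₁} {u v : Form Δ G.N₀ G.N₁} {C : Ctx Δ}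
      {t : Tree Δ} (hS : .nt₁ A v ∈ S) (h : (A, u) ∈ G.rules₁)
      (hu : RepeatFree (S.erase (.nt₁ A v)) W u (.ctx C))
      (hv : RepeatFree (S.erase (.nt₁ A v)) W v (.tree t)) :
      RepeatFree S U (.nt₁ A v) (.tree (C.plug t))
  | erase {S U : Finset (Form Δ G.N₀ G.N₁)} {A : G.N₁} {u v : Form Δ G.N₀ G.N₁} {t : Tree Δ}
      (hS : .nt₁ A v ∈ S) (h : (A, u) ∈ G.rules₁)
      (hu : RepeatFree (S.erase (.nt₁ A v)) W u (.tree t)) : RepeatFree S U (.nt₁ A v) (.tree t)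
  | hole {S U : Finset (Form Δ G.N₀ G.N₁)} : RepeatFree S U .x (.ctx .hole)
  | ctxNode {S U : Finset (Form Δ G.N₀ G.N₁)} (f : Δ.Op) (φs : Fin (Δ.rank f) → Form Δ G.N₀ G.N₁)
      (i : Fin (Δ.rank f)) (ts : {j : Fin (Δ.rank f) // j ≠ i} → Tree Δ) (C : Ctx Δ)
      (hU : .node f φs ∈ U) (hC : RepeatFree S (U.erase (.node f φs)) (φs i) (.ctx C))
      (h : ∀ j : {j : Fin (Δ.rank f) // j ≠ i}, RepeatFree S W (φs j) (.tree (ts j))) :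
      RepeatFree S U (.node f φs) (.ctx (.node f i ts C))
  | comp {S U : Finset (Form Δ G.N₀ G.N₁)} {A : G.N₁} {u v : Form Δ G.N₀ G.N₁} {C D : Ctx Δ}
      (hU : .nt₁ A v ∈ U) (h : (A, u) ∈ G.rules₁)
      (hu : RepeatFree S (U.erase (.nt₁ A v)) u (.ctx C))
      (hv : RepeatFree S (U.erase (.nt₁ A v)) v (.ctx D)) :
      RepeatFree S U (.nt₁ A v) (.ctx (C.comp D))

variable {W} {S U : Finset (Form Δ G.N₀ G.N₁)} {φ : Form Δ G.N₀ G.N₁} {v : Val Δ}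

theorem RepeatFree.der (h : RepeatFree W S U φ v) : G.Der φ v := by
  induction h with
  | node f φs ts hS h ih => exact .node f φs ts ih
  | nt₀ hS h hu ih => exact .nt₀ h ih
  | plug hS h hu hv ihu ihv => exact .plug h ihu ihv
  | erase hS h hu ih => exact .erase _ h ih
  | hole => exact .hole
  | ctxNode f φs i ts C hU hC h ihC ih => exact .ctxNode f φs i ts C ihC ih
  | comp hU h hu hv ihu ihv => exact .comp h ihu ihv

theorem RepeatFree.mono (h : RepeatFree W S U φ v) {S' U' : Finset (Form Δ G.N₀ G.N₁)}
    (hS' : S ⊆ S') (hU' : U ⊆ U') : RepeatFree W S' U' φ v := by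
  induction h generalizing S' U' with
  | node f φs ts hS h ih =>
    exact .node f φs ts (hS' hS) fun j => ih j (Finset.erase_subset_erase _ hS') subset_rfl
  | nt₀ hS h hu ih => exact .nt₀ (hS' hS) h (ih (Finset.erase_subset_erase _ hS') subset_rfl)
  | plug hS h hu hv ihu ihv =>
    exact .plug (hS' hS) h (ihu (Finset.erase_subset_erase _ hS') subset_rfl)
      (ihv (Finset.erase_subset_erase _ hS') subset_rfl)
  | erase hS h hu ih => exact .erase (hS' hS) h (ih (Finset.erase_subset_erase _ hS') subset_rfl)
  | hole => exact .hole
  | ctxNode f φs i ts C hU hC h ihC ih =>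
    exact .ctxNode f φs i ts C (hU' hU) (ihC hS' (Finset.erase_subset_erase _ hU'))
      fun j => ih j hS' subset_rfl
  | comp hU h hu hv ihu ihv =>
    exact .comp (hU' hU) h (ihu hS' (Finset.erase_subset_erase _ hU'))
      (ihv hS' (Finset.erase_subset_erase _ hU'))

/-- A bound on the height of contexts, if `a` bounds the height of trees. -/
def ctxBound (a : ℕ) : ℕ → ℕ
  | 0 => 0
  | u + 1 => 1 + 2 * ctxBound a u + a

/-- A bound on the height of trees. -/
def treeBound (n : ℕ) : ℕ → ℕ
  | 0 => 0
  | s + 1 => 1 + ctxBound (treeBound n s) n + treeBound n s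

/-- Every step uses up a form of `S` or of `U`. The recursion of `ctxBound` pays for a node, for
both factors of a composition and for a side tree; that of `treeBound` for a node, or a context and
the tree in its hole. -/
theorem RepeatFree.height_le (h : RepeatFree W S U φ v) :
    match v with
    | .tree t => t.height ≤ treeBound W.card S.card
    | .ctx C => C.height ≤ ctxBound (treeBound W.card S.card) U.card := by
  induction h with
  | node f φs ts hS h ih =>
    simp only [Finset.card_erase_of_mem hS] at ih
    obtain ⟨n, hn⟩ := Nat.exists_eq_add_one.mpr (Finset.card_pos.mpr ⟨_, hS⟩)
    simp only [hn, Nat.add_sub_cancel, treeBound, Tree.height] at ih ⊢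
    have := Finset.sup_le (s := Finset.univ) fun j _ => ih j
    omega
  | nt₀ hS h hu ih =>
    simp only [Finset.card_erase_of_mem hS] at ih
    obtain ⟨n, hn⟩ := Nat.exists_eq_add_one.mpr (Finset.card_pos.mpr ⟨_, hS⟩)
    simp only [hn, Nat.add_sub_cancel, treeBound] at ih ⊢
    omega
  | @plug _ _ _ _ _ C t hS h hu hv ihu ihv =>
    simp only [Finset.card_erase_of_mem hS] at ihu ihv
    obtain ⟨n, hn⟩ := Nat.exists_eq_add_one.mpr (Finset.card_pos.mpr ⟨_, hS⟩)
    simp only [hn, Nat.add_sub_cancel, treeBound] at ihu ihv ⊢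
    have := C.height_plug_le t
    omega
  | erase hS h hu ih =>
    simp only [Finset.card_erase_of_mem hS] at ih
    obtain ⟨n, hn⟩ := Nat.exists_eq_add_one.mpr (Finset.card_pos.mpr ⟨_, hS⟩)
    simp only [hn, Nat.add_sub_cancel, treeBound] at ih ⊢
    omega
  | hole => exact Nat.zero_le _
  | ctxNode f φs i ts C hU hC h ihC ih =>
    simp only [Finset.card_erase_of_mem hU] at ihC
    obtain ⟨n, hn⟩ := Nat.exists_eq_add_one.mpr (Finset.card_pos.mpr ⟨_, hU⟩)
    simp only [hn, Nat.add_sub_cancel, ctxBound, Ctx.height] at ihC ih ⊢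
    have := Finset.sup_le (s := Finset.univ) fun j _ => ih j
    omega
  | @comp _ _ _ _ _ C D hU h hu hv ihu ihv =>
    simp only [Finset.card_erase_of_mem hU] at ihu ihv
    obtain ⟨n, hn⟩ := Nat.exists_eq_add_one.mpr (Finset.card_pos.mpr ⟨_, hU⟩)
    simp only [hn, Nat.add_sub_cancel, ctxBound] at ihu ihv ⊢
    have := C.height_comp_le D
    omega

/-- A form `ψ` that derives trees either can be avoided in a derivation, or it occurs in it. -/
theorem RepeatFree.erase_or_tree (ψ : Form Δ G.N₀ G.N₁) (h : RepeatFree W S U φ v) :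
    match v with
    | .tree t => RepeatFree W (S.erase ψ) U φ (.tree t) ∨ ∃ K r, t = Ctx.plug K r ∧
        RepeatFree W S W ψ (.tree r) ∧ ∀ r', G.Der ψ (.tree r') → G.Der φ (.tree (K.plug r'))
    | .ctx C => RepeatFree W (S.erase ψ) U φ (.ctx C) ∨ ∃ (κ : Tree Δ → Ctx Δ) (r : Tree Δ),
        C = κ r ∧ RepeatFree W S W ψ (.tree r) ∧
        (∀ r', G.Der ψ (.tree r') → G.Der φ (.ctx (κ r'))) ∧
        ∀ s, ∃ K : Ctx Δ, ∀ r', (κ r').plug s = K.plug r' := by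
  induction h with
  | @node S _ f φs ts hS h ih =>
    by_cases hψ : .node f φs = ψ
    · subst hψ
      exact Or.inr ⟨.hole, _, rfl, .node f φs ts hS h, fun r' hr' => hr'⟩
    · by_cases hall : ∀ j, RepeatFree W ((S.erase (.node f φs)).erase ψ) W (φs j)
          (.tree (ts j))
      · refine Or.inl (.node f φs ts (Finset.mem_erase.mpr ⟨hψ, hS⟩) fun j => ?_)
        rw [Finset.erase_right_comm]
        exact hall j
      · push Not at hall
        obtain ⟨i, hi⟩ := hall
        obtain ⟨K, r, hK, hr, hrep⟩ := (ih i).resolve_left hi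
        refine Or.inr ⟨.node f i (fun j => ts j) K, r, ?_,
          hr.mono (Finset.erase_subset _ _) subset_rfl, fun r' hr' => ?_⟩
        · rw [node_eq_plug, ← hK, Function.update_eq_self]
        · rw [node_eq_plug]
          exact Der.node_update (fun j => (h j).der) i (hrep r' hr')
  | @nt₀ _ _ A _ _ hS h hu ih =>
    by_cases hψ : .nt₀ A = ψ
    · subst hψ
      exact Or.inr ⟨.hole, _, rfl, .nt₀ hS h hu, fun r' hr' => hr'⟩
    · rcases ih with ih | ⟨K, r, hK, hr, hrep⟩
      · refine Or.inl (.nt₀ (Finset.mem_erase.mpr ⟨hψ, hS⟩) h ?_)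
        rwa [Finset.erase_right_comm]
      · exact Or.inr ⟨K, r, hK, hr.mono (Finset.erase_subset _ _) subset_rfl,
          fun r' hr' => .nt₀ h (hrep r' hr')⟩
  | @plug _ _ A _ v C t hS h hu hv ihu ihv =>
    by_cases hψ : .nt₁ A v = ψ
    · subst hψ
      exact Or.inr ⟨.hole, _, rfl, .plug hS h hu hv, fun r' hr' => hr'⟩
    · rcases ihu with ihu | ⟨κ, r, hK, hr, hrep, hκ⟩
      · rcases ihv with ihv | ⟨K, r, hK, hr, hrep⟩
        · refine Or.inl (.plug (Finset.mem_erase.mpr ⟨hψ, hS⟩) h ?_ ?_)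
          · rwa [Finset.erase_right_comm]
          · rwa [Finset.erase_right_comm]
        · refine Or.inr ⟨C.comp K, r, by rw [hK, Ctx.plug_comp],
            hr.mono (Finset.erase_subset _ _) subset_rfl, fun r' hr' => ?_⟩
          rw [Ctx.plug_comp]
          exact .plug h hu.der (hrep r' hr')
      · obtain ⟨K, hK'⟩ := hκ t
        refine Or.inr ⟨K, r, by rw [hK, hK'], hr.mono (Finset.erase_subset _ _) subset_rfl,
          fun r' hr' => ?_⟩
        rw [← hK']
        exact .plug h (hrep r' hr') hv.der
  | @erase _ _ A _ v t hS h hu ih =>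
    by_cases hψ : .nt₁ A v = ψ
    · subst hψ
      exact Or.inr ⟨.hole, _, rfl, .erase hS h hu, fun r' hr' => hr'⟩
    · rcases ih with ih | ⟨K, r, hK, hr, hrep⟩
      · refine Or.inl (.erase (Finset.mem_erase.mpr ⟨hψ, hS⟩) h ?_)
        rwa [Finset.erase_right_comm]
      · exact Or.inr ⟨K, r, hK, hr.mono (Finset.erase_subset _ _) subset_rfl,
          fun r' hr' => .erase _ h (hrep r' hr')⟩
  | hole => exact Or.inl .hole
  | @ctxNode S _ f φs i ts C hU hC h ihC ih =>
    rcases ihC with ihC | ⟨κ, r, hK, hr, hrep, hκ⟩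
    · by_cases hall : ∀ j : {j // j ≠ i}, RepeatFree W (S.erase ψ) W (φs j) (.tree (ts j))
      · exact Or.inl (.ctxNode f φs i ts C hU ihC hall)
      · push Not at hall
        obtain ⟨j, hj⟩ := hall
        obtain ⟨K, r, hK, hr, hrep⟩ := (ih j).resolve_left hj
        refine Or.inr ⟨fun r' => .node f i (Function.update ts j (K.plug r')) C, r, ?_, hr,
          fun r' hr' => Der.ctxNode_update hC.der (fun k => (h k).der) j (hrep r' hr'),
          fun s => ?_⟩
        · simp only [← hK, Function.update_eq_self]
        · obtain ⟨K', hK'⟩ := ctxNode_update_plug ts C j s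
          exact ⟨K'.comp K, fun r' => by rw [hK', Ctx.plug_comp]⟩
    · refine Or.inr ⟨fun r' => .node f i ts (κ r'), r, by simp only [← hK], hr,
        fun r' hr' => .ctxNode f φs i ts _ (hrep r' hr') fun k => (h k).der, fun s => ?_⟩
      obtain ⟨K, hK'⟩ := hκ s
      exact ⟨(Ctx.node f i ts .hole).comp K, fun r' => by rw [Ctx.plug_comp, ← hK']; rfl⟩
  | @comp _ _ A _ v C D hU h hu hv ihu ihv =>
    rcases ihu with ihu | ⟨κ, r, hK, hr, hrep, hκ⟩
    · rcases ihv with ihv | ⟨κ, r, hK, hr, hrep, hκ⟩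
      · exact Or.inl (.comp hU h ihu ihv)
      · refine Or.inr ⟨fun r' => C.comp (κ r'), r, by rw [hK], hr,
          fun r' hr' => .comp h hu.der (hrep r' hr'), fun s => ?_⟩
        obtain ⟨K, hK'⟩ := hκ s
        exact ⟨C.comp K, fun r' => by rw [Ctx.plug_comp, Ctx.plug_comp, hK']⟩
    · refine Or.inr ⟨fun r' => (κ r').comp D, r, by rw [hK], hr,
        fun r' hr' => .comp h (hrep r' hr') hv.der, fun s => ?_⟩
      obtain ⟨K, hK'⟩ := hκ (D.plug s)
      exact ⟨K, fun r' => by rw [Ctx.plug_comp, hK']⟩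

/-- A form `ψ` that derives contexts either can be avoided on the path to the hole, or it occurs
there. -/
theorem RepeatFree.erase_or_ctx (ψ : Form Δ G.N₀ G.N₁) (h : RepeatFree W S U φ v) :
    match v with
    | .tree _ => True
    | .ctx C => RepeatFree W S (U.erase ψ) φ (.ctx C) ∨ ∃ C₂ C₃ C₄ : Ctx Δ, C = C₂.comp (C₃.comp C₄) ∧
        RepeatFree W S U ψ (.ctx C₃) ∧
        ∀ D, G.Der ψ (.ctx D) → G.Der φ (.ctx (C₂.comp (D.comp C₄))) := by
  induction h with
  | hole => exact Or.inl .hole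
  | ctxNode f φs i ts C hU hC h ihC ih =>
    by_cases hψ : .node f φs = ψ
    · subst hψ
      exact Or.inr ⟨.hole, _, .hole, by simp, .ctxNode f φs i ts C hU hC h, by simp⟩
    · rcases ihC with ihC | ⟨C₂, C₃, C₄, hC', hr, hrep⟩
      · refine Or.inl (.ctxNode f φs i ts C (Finset.mem_erase.mpr ⟨hψ, hU⟩) ?_ h)
        rwa [Finset.erase_right_comm]
      · exact Or.inr ⟨.node f i ts C₂, C₃, C₄, by rw [hC', Ctx.comp],
          hr.mono subset_rfl (Finset.erase_subset _ _),
          fun D hD => .ctxNode f φs i ts _ (hrep D hD) fun j => (h j).der⟩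
  | @comp _ _ A _ v C D hU h hu hv ihu ihv =>
    by_cases hψ : .nt₁ A v = ψ
    · subst hψ
      exact Or.inr ⟨.hole, _, .hole, by simp, .comp hU h hu hv, by simp⟩
    · rcases ihu with ihu | ⟨C₂, C₃, C₄, hC', hr, hrep⟩
      · rcases ihv with ihv | ⟨C₂, C₃, C₄, hC', hr, hrep⟩
        · refine Or.inl (.comp (Finset.mem_erase.mpr ⟨hψ, hU⟩) h ?_ ?_)
          · rwa [Finset.erase_right_comm]
          · rwa [Finset.erase_right_comm]
        · refine Or.inr ⟨C.comp C₂, C₃, C₄, by rw [hC', Ctx.comp_assoc],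
            hr.mono subset_rfl (Finset.erase_subset _ _), fun D' hD' => ?_⟩
          rw [Ctx.comp_assoc]
          exact .comp h hu.der (hrep D' hD')
      · refine Or.inr ⟨C₂, C₃, C₄.comp D, by rw [hC']; simp only [Ctx.comp_assoc],
          hr.mono subset_rfl (Finset.erase_subset _ _), fun D' hD' => ?_⟩
        rw [← Ctx.comp_assoc D', ← Ctx.comp_assoc C₂]
        exact .comp h (hrep D' hD') hv.der
  | _ => trivial

/-- A family of trees that is obtained by pumping contexts of bounded height. -/
def IsPumpFamily (p : ℕ) (τ : ℕ → Tree Δ) : Prop :=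
  ∃ (C₁ C₂ C₃ C₄ : Ctx Δ) (t₅ : Tree Δ), (∀ i, τ i = C₁.plug ((Ctx.pump C₂ C₃ C₄ i).plug t₅)) ∧
    (C₂.comp (C₃.comp C₄)).height ≤ p ∧ 0 < C₂.height + C₄.height

theorem IsPumpFamily.plug {p : ℕ} {τ : ℕ → Tree Δ} (h : IsPumpFamily p τ) (K : Ctx Δ) :
    IsPumpFamily p fun i => K.plug (τ i) := by
  obtain ⟨C₁, C₂, C₃, C₄, t₅, hτ, h⟩ := h
  exact ⟨K.comp C₁, C₂, C₃, C₄, t₅, fun i => by simp only [hτ, Ctx.plug_comp], h⟩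

/-- A value that belongs to a family of values derived by `φ` and obtained by pumping. -/
def Pumpable (p : ℕ) (φ : Form Δ G.N₀ G.N₁) : Val Δ → Prop
  | .tree t => ∃ τ : ℕ → Tree Δ, τ 1 = t ∧ IsPumpFamily p τ ∧ ∀ i, G.Der φ (.tree (τ i))
  | .ctx C => ∃ κ : ℕ → Ctx Δ, κ 1 = C ∧ (∀ s, IsPumpFamily p fun i => (κ i).plug s) ∧
      ∀ i, G.Der φ (.ctx (κ i))

/-- A loop that generates nothing is cut out, which leaves the repeat-free derivation of `r`. Any
other loop is iterated, with trivial `C₃` and `C₄`. -/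
theorem RepeatFree.or_pumpable_tree {p : ℕ} {K : Ctx Δ} {r : Tree Δ}
    (hr : RepeatFree W S U φ (.tree r)) (hp : (K.plug r).height ≤ p)
    (hrep : ∀ r', G.Der φ (.tree r') → G.Der φ (.tree (K.plug r'))) :
    RepeatFree W S U φ (.tree (K.plug r)) ∨ Pumpable p φ (.tree (K.plug r)) := by
  rcases Nat.eq_zero_or_pos K.height with h0 | h0
  · rw [Ctx.eq_hole h0]
    exact Or.inl hr
  · refine Or.inr ⟨fun i => (Ctx.pump K .hole .hole i).plug r, by simp [Ctx.pump],
      ⟨.hole, K, .hole, .hole, r, fun i => rfl, ?_, by omega⟩, fun i => ?_⟩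
    · simpa using (K.height_le_plug r).trans hp
    · induction i with
      | zero => exact hr.der
      | succ i ih => simpa [Ctx.pump, Ctx.plug_comp] using hrep _ ih

/-- The same alternative for a loop among contexts; here both `C₂` above and `C₄` below are
iterated. -/
theorem RepeatFree.or_pumpable_ctx {p : ℕ} {C₂ C₃ C₄ : Ctx Δ}
    (hr : RepeatFree W S U φ (.ctx C₃)) (hp : (C₂.comp (C₃.comp C₄)).height ≤ p)
    (hrep : ∀ D, G.Der φ (.ctx D) → G.Der φ (.ctx (C₂.comp (D.comp C₄)))) :
    RepeatFree W S U φ (.ctx (C₂.comp (C₃.comp C₄))) ∨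
      Pumpable p φ (.ctx (C₂.comp (C₃.comp C₄))) := by
  rcases Nat.eq_zero_or_pos (C₂.height + C₄.height) with h0 | h0
  · rw [Ctx.eq_hole (by omega : C₂.height = 0), Ctx.eq_hole (by omega : C₄.height = 0)]
    simpa using Or.inl hr
  · refine Or.inr ⟨Ctx.pump C₂ C₃ C₄, rfl,
      fun s => ⟨.hole, C₂, C₃, C₄, s, fun i => rfl, hp, h0⟩, fun i => ?_⟩
    induction i with
    | zero => exact hr.der
    | succ i ih => exact hrep _ ih

/-- By induction on the derivation. A pumpable part is carried up to the root. Otherwise all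
immediate subderivations are repeat-free over all of `W`, so the value has height at most the stated
bound, where `W.card + 1` allows for the root step. If the root form recurs below, the loop from the
root to the recurrence is removed or pumped within this bounded value. -/
theorem Der.repeatFree_or_pumpable (h : G.Der φ v) (hφ : φ ∈ W)
    (hnode : ∀ f φs, .node f φs ∈ W → ∀ j, φs j ∈ W) (hnt : ∀ A v, .nt₁ A v ∈ W → v ∈ W)
    (h₀ : ∀ A u, (A, u) ∈ G.rules₀ → u ∈ W) (h₁ : ∀ A u, (A, u) ∈ G.rules₁ → u ∈ W) :
    RepeatFree W W W φ v ∨ Pumpable (ctxBound (treeBound W.card W.card) (W.card + 1)) φ v := by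
  induction h with
  | node f φs ts h ih =>
    by_cases hall : ∀ j, RepeatFree W W W (φs j) (.tree (ts j))
    · by_cases hall' : ∀ j, RepeatFree W (W.erase (.node f φs)) W (φs j) (.tree (ts j))
      · exact Or.inl (.node f φs ts hφ hall')
      · push Not at hall'
        obtain ⟨i, hi⟩ := hall'
        obtain ⟨K, r, hK, hr, hrep⟩ := ((hall i).erase_or_tree (.node f φs)).resolve_left hi
        have he : Tree.node f ts = (Ctx.node f i (fun j => ts j) K).plug r := by
          rw [node_eq_plug, ← hK, Function.update_eq_self]
        have hb : (Tree.node f ts).height ≤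
            ctxBound (treeBound W.card W.card) (W.card + 1) := by
          have := Finset.sup_le (s := Finset.univ) fun j _ => (hall j).height_le
          simp only [Tree.height, ctxBound] at this ⊢
          omega
        rw [he] at hb ⊢
        refine hr.or_pumpable_tree hb fun r' hr' => ?_
        rw [node_eq_plug]
        exact Der.node_update h i (hrep r' hr')
    · push Not at hall
      obtain ⟨i, hi⟩ := hall
      obtain ⟨τ, h1, hτ, hd⟩ := (ih i (hnode f φs hφ i)).resolve_left hi
      refine Or.inr ⟨fun n => (Ctx.node f i (fun j => ts j) .hole).plug (τ n), ?_, hτ.plug _,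
        fun n => ?_⟩
      · simp only [node_eq_plug, Ctx.hole_plug, h1, Function.update_eq_self]
      · show G.Der _ (.tree ((Ctx.node f i (fun j => ts j) .hole).plug (τ n)))
        rw [node_eq_plug]
        exact Der.node_update h i (hd n)
  | @nt₀ A u t h hu ih =>
    rcases ih (h₀ A u h) with ih | ⟨τ, h1, hτ, hd⟩
    · rcases ih.erase_or_tree (.nt₀ A) with ih' | ⟨K, r, rfl, hr, hrep⟩
      · exact Or.inl (.nt₀ hφ h ih')
      · refine hr.or_pumpable_tree ?_ fun r' hr' => .nt₀ h (hrep r' hr')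
        have := ih.height_le
        simp only [ctxBound] at this ⊢
        omega
    · exact Or.inr ⟨τ, h1, hτ, fun i => .nt₀ h (hd i)⟩
  | @plug A u v C t h hu hv ihu ihv =>
    rcases ihu (h₁ A u h) with ihu | ⟨κ, h1, hκ, hd⟩
    · rcases ihv (hnt A v hφ) with ihv | ⟨τ, h1, hτ, hd⟩
      · have hb : (C.plug t).height ≤ ctxBound (treeBound W.card W.card) (W.card + 1) := by
          have h1 := ihu.height_le
          have h2 := ihv.height_le
          have h3 := C.height_plug_le t
          simp only [ctxBound] at h1 h2 ⊢
          omega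
        rcases ihu.erase_or_tree (.nt₁ A v) with ihu' | ⟨κ, r, rfl, hr, hrep, hκ⟩
        · rcases ihv.erase_or_tree (.nt₁ A v) with ihv' | ⟨K, r, rfl, hr, hrep⟩
          · exact Or.inl (.plug hφ h ihu' ihv')
          · rw [← Ctx.plug_comp] at hb ⊢
            refine hr.or_pumpable_tree hb fun r' hr' => ?_
            rw [Ctx.plug_comp]
            exact .plug h hu (hrep r' hr')
        · obtain ⟨K, hK⟩ := hκ t
          rw [hK] at hb ⊢
          refine hr.or_pumpable_tree hb fun r' hr' => ?_
          rw [← hK]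
          exact .plug h (hrep r' hr') hv
      · exact Or.inr ⟨fun i => C.plug (τ i), by simp only [h1], hτ.plug C,
          fun i => .plug h hu (hd i)⟩
    · exact Or.inr ⟨fun i => (κ i).plug t, by simp only [h1], hκ t, fun i => .plug h (hd i) hv⟩
  | @erase A u v t h hu ih =>
    rcases ih (h₁ A u h) with ih | ⟨τ, h1, hτ, hd⟩
    · rcases ih.erase_or_tree (.nt₁ A v) with ih' | ⟨K, r, rfl, hr, hrep⟩
      · exact Or.inl (.erase hφ h ih')
      · refine hr.or_pumpable_tree ?_ fun r' hr' => .erase _ h (hrep r' hr')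
        have := ih.height_le
        simp only [ctxBound] at this ⊢
        omega
    · exact Or.inr ⟨τ, h1, hτ, fun i => .erase _ h (hd i)⟩
  | hole => exact Or.inl .hole
  | ctxNode f φs i ts C hC h ihC ih =>
    rcases ihC (hnode f φs hφ i) with ihC | ⟨κ, h1, hκ, hd⟩
    · by_cases hall : ∀ j : {j // j ≠ i}, RepeatFree W W W (φs j) (.tree (ts j))
      · rcases ihC.erase_or_ctx (.node f φs) with ihC' | ⟨C₂, C₃, C₄, rfl, hr, hrep⟩
        · exact Or.inl (.ctxNode f φs i ts C hφ ihC' hall)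
        · refine hr.or_pumpable_ctx (C₂ := .node f i ts C₂) ?_
            fun D hD => .ctxNode f φs i ts _ (hrep D hD) h
          have h1 := ihC.height_le
          have h2 := Finset.sup_le (s := Finset.univ) fun j _ => (hall j).height_le
          simp only [Ctx.comp, Ctx.height, ctxBound] at h1 h2 ⊢
          omega
      · push Not at hall
        obtain ⟨j, hj⟩ := hall
        obtain ⟨τ, h1, hτ, hd⟩ := (ih j (hnode f φs hφ j)).resolve_left hj
        refine Or.inr ⟨fun n => .node f i (Function.update ts j (τ n)) C, ?_, fun s => ?_,
          fun n => Der.ctxNode_update hC h j (hd n)⟩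
        · simp only [h1, Function.update_eq_self]
        · obtain ⟨K, hK⟩ := ctxNode_update_plug ts C j s
          simpa only [hK] using hτ.plug K
    · exact Or.inr ⟨fun n => .node f i ts (κ n), by simp only [h1],
        fun s => (hκ s).plug (.node f i ts .hole), fun n => .ctxNode f φs i ts _ (hd n) h⟩
  | @comp A u v C D h hu hv ihu ihv =>
    rcases ihu (h₁ A u h) with ihu | ⟨κ, h1, hκ, hd⟩
    · rcases ihv (hnt A v hφ) with ihv | ⟨κ, h1, hκ, hd⟩
      · have hb : (C.comp D).height ≤ ctxBound (treeBound W.card W.card) (W.card + 1) := by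
          have h1 := ihu.height_le
          have h2 := ihv.height_le
          have h3 := C.height_comp_le D
          simp only [ctxBound] at h1 h2 ⊢
          omega
        rcases ihu.erase_or_ctx (.nt₁ A v) with ihu' | ⟨C₂, C₃, C₄, rfl, hr, hrep⟩
        · rcases ihv.erase_or_ctx (.nt₁ A v) with ihv' | ⟨C₂, C₃, C₄, rfl, hr, hrep⟩
          · exact Or.inl (.comp hφ h ihu' ihv')
          · rw [← Ctx.comp_assoc] at hb ⊢
            refine hr.or_pumpable_ctx hb fun D' hD' => ?_
            rw [Ctx.comp_assoc]
            exact .comp h hu (hrep D' hD')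
        · rw [Ctx.comp_assoc, Ctx.comp_assoc] at hb ⊢
          refine hr.or_pumpable_ctx hb fun D' hD' => ?_
          rw [← Ctx.comp_assoc D', ← Ctx.comp_assoc C₂]
          exact .comp h (hrep D' hD') hv
      · refine Or.inr ⟨fun i => C.comp (κ i), by simp only [h1], fun s => ?_,
          fun i => .comp h hu (hd i)⟩
        simpa only [Ctx.plug_comp] using (hκ s).plug C
    · refine Or.inr ⟨fun i => (κ i).comp D, by simp only [h1], fun s => ?_,
        fun i => .comp h (hd i) hv⟩
      simpa only [Ctx.plug_comp] using hκ (D.plug s)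

end Pumping

/-- The pumping lemma for linear monadic context-free tree grammars. -/
theorem exists_pumpingHeight (G : LMCFTG Δ) : ∃ p, IsPumpingHeight G.language p := by
  classical
  have hfin : ({.nt₀ G.start} ∪ ((⋃ r ∈ G.rules₀, r.2.subforms) ∪
      ⋃ r ∈ G.rules₁, r.2.subforms)).Finite :=
    (Set.finite_singleton _).union ((G.fin₀.biUnion fun r _ => r.2.finite_subforms).union
      (G.fin₁.biUnion fun r _ => r.2.finite_subforms))
  obtain ⟨W, hW⟩ := hfin.exists_finset
  have hW' : ∀ {φ}, φ ∈ W ↔ φ = .nt₀ G.start ∨ (∃ r ∈ G.rules₀, φ ∈ r.2.subforms) ∨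
      ∃ r ∈ G.rules₁, φ ∈ r.2.subforms := by
    intro φ
    rw [hW]
    simp
  have hnode : ∀ f φs, .node f φs ∈ W → ∀ j, φs j ∈ W := by
    intro f φs h j
    rcases hW'.mp h with h | ⟨r, hr, h⟩ | ⟨r, hr, h⟩
    · exact absurd h (by simp)
    · exact hW'.mpr (Or.inr (Or.inl ⟨r, hr, Form.mem_subforms_of_node h j⟩))
    · exact hW'.mpr (Or.inr (Or.inr ⟨r, hr, Form.mem_subforms_of_node h j⟩))
  have hnt : ∀ A v, .nt₁ A v ∈ W → v ∈ W := by
    intro A v h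
    rcases hW'.mp h with h | ⟨r, hr, h⟩ | ⟨r, hr, h⟩
    · exact absurd h (by simp)
    · exact hW'.mpr (Or.inr (Or.inl ⟨r, hr, Form.mem_subforms_of_nt₁ h⟩))
    · exact hW'.mpr (Or.inr (Or.inr ⟨r, hr, Form.mem_subforms_of_nt₁ h⟩))
  refine ⟨ctxBound (treeBound W.card W.card) (W.card + 1), fun t ht hp => ?_⟩
  have key : RepeatFree W W W (.nt₀ G.start) (.tree t) ∨ Pumpable _ _ _ :=
    (mem_language_iff.mp ht).repeatFree_or_pumpable (hW'.mpr (Or.inl rfl)) hnode hnt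
      (fun A u h => hW'.mpr (Or.inr (Or.inl ⟨_, h, Form.self_mem_subforms u⟩)))
      fun A u h => hW'.mpr (Or.inr (Or.inr ⟨_, h, Form.self_mem_subforms u⟩))
  rcases key with h | ⟨τ, h1, ⟨C₁, C₂, C₃, C₄, t₅, hτ, hh, hpos⟩, hd⟩
  · have := h.height_le
    simp only [ctxBound] at this hp
    omega
  · refine ⟨C₁, C₂, C₃, C₄, t₅, ?_, hh, hpos, fun i => ?_⟩
    · rw [← h1, hτ 1]
      simp [Ctx.pump, Ctx.plug_comp]
    · rw [← hτ i]
      exact mem_language_iff.mpr (hd i)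

end LMCFTG

end Grammar

end SemCap
namespace SemCap

/-! ## Concatenations of blocks -/

section Strings

/-- Barred letters. -/
def Token.isBar : Token → Bool
  | .sym (.bar _) => true
  | _ => false

/-- The number of barred letters. -/
def bars (s : List Token) : ℕ := s.countP Token.isBar

/-- The number of opening brackets. -/
def opens (s : List Token) : ℕ := s.count .lbr

/-- The number of closing brackets. -/
def closes (s : List Token) : ℕ := s.count .rbr

/-- Strings without core letters. -/
def Coreless (s : List Token) : Prop := ∀ z, Token.core z ∉ s

@[simp] theorem bars_append (s t : List Token) : bars (s ++ t) = bars s + bars t :=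
  List.countP_append

@[simp] theorem opens_append (s t : List Token) : opens (s ++ t) = opens s + opens t :=
  List.count_append

@[simp] theorem closes_append (s t : List Token) : closes (s ++ t) = closes s + closes t :=
  List.count_append

@[simp] theorem bars_core_cons (z : Letter) (s : List Token) :
    bars (Token.core z :: s) = bars s := by
  simp [bars, Token.isBar]

@[simp] theorem opens_core_cons (z : Letter) (s : List Token) :
    opens (Token.core z :: s) = opens s := by
  simp [opens]

@[simp] theorem closes_core_cons (z : Letter) (s : List Token) :
    closes (Token.core z :: s) = closes s := by
  simp [closes]

theorem count_bar_le_bars (z : Letter) (s : List Token) : s.count (Token.bar z) ≤ bars s := by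
  rw [List.count, bars]
  refine List.countP_mono_left fun t _ h => ?_
  rw [beq_iff_eq] at h
  rw [h]
  rfl

theorem bars_eq_zero {s : List Token} (h : ∀ z, Token.bar z ∉ s) : bars s = 0 := by
  rw [bars, List.countP_eq_zero]
  rintro ((z | z) | _ | _) ht
  · simp [Token.isBar]
  · exact absurd ht (h z)
  · simp [Token.isBar]
  · simp [Token.isBar]

theorem exists_bar_mem {s : List Token} (h : 0 < bars s) : ∃ z, Token.bar z ∈ s := by
  by_contra! h'
  exact h.ne' (bars_eq_zero h')

theorem three_mul_le_length (s : List Token) : bars s + opens s + closes s ≤ s.length := by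
  induction s with
  | nil => simp [bars, opens, closes]
  | cons t s ih =>
    rcases t with (z | z) | _ | _ <;>
      simp [bars, opens, closes, Token.isBar, List.countP_cons] at ih ⊢ <;> omega

/-- A block without its core letter. -/
def blockTail (z : Letter) (k : ℕ) : List Token :=
  List.replicate k Token.lbr ++ List.replicate k (Token.bar z) ++ List.replicate k Token.rbr

/-- A concatenation of blocks. -/
def blockString (L : List (Letter × ℕ)) : List Token := L.flatMap fun q => block q.1 q.2

@[simp] theorem blockString_nil : blockString [] = [] := rfl

theorem blockString_cons (z : Letter) (k : ℕ) (L : List (Letter × ℕ)) :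
    blockString ((z, k) :: L) = Token.core z :: (blockTail z k ++ blockString L) := by
  simp [blockString, block, blockTail]

theorem blockString_append (L L' : List (Letter × ℕ)) :
    blockString (L ++ L') = blockString L ++ blockString L' := by
  simp [blockString]

theorem coreless_blockTail (z : Letter) (k : ℕ) : Coreless (blockTail z k) := by
  intro q hq
  simp [blockTail, List.mem_replicate] at hq

@[simp] theorem bars_blockTail (z : Letter) (k : ℕ) : bars (blockTail z k) = k := by
  simp [blockTail, bars, List.countP_replicate, Token.isBar]

@[simp] theorem opens_blockTail (z : Letter) (k : ℕ) : opens (blockTail z k) = k := by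
  simp [blockTail, opens, List.count_replicate]

@[simp] theorem closes_blockTail (z : Letter) (k : ℕ) : closes (blockTail z k) = k := by
  simp [blockTail, closes, List.count_replicate]

theorem eq_of_bar_mem_blockTail {z q : Letter} {k : ℕ} (h : Token.bar z ∈ blockTail q k) :
    z = q := by
  simp [blockTail, List.mem_replicate] at h
  exact h.2

theorem count_bar_blockTail (z : Letter) (k : ℕ) : (blockTail z k).count (Token.bar z) = k := by
  simp [blockTail, List.count_replicate]

/-- The position of a token in a block. -/
def Token.rank : Token → ℕ
  | .sym (.core _) => 0
  | .lbr => 1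
  | .sym (.bar _) => 2
  | .rbr => 3

/-- Sortedness expresses that no opening bracket follows and no closing bracket precedes a barred
letter, in a form inherited by substrings. -/
theorem pairwise_blockTail (z : Letter) (k : ℕ) :
    (blockTail z k).Pairwise fun s t => s.rank ≤ t.rank := by
  simp only [blockTail, List.pairwise_append, List.pairwise_replicate, List.mem_append,
    List.mem_replicate]
  refine ⟨⟨Or.inr le_rfl, Or.inr le_rfl, ?_⟩, Or.inr le_rfl, ?_⟩
  · rintro a ⟨_, rfl⟩ b ⟨_, rfl⟩
    simp [Token.rank]
  · rintro a (⟨_, rfl⟩ | ⟨_, rfl⟩) b ⟨_, rfl⟩ <;> simp [Token.rank]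

theorem bars_eq_opens (L : List (Letter × ℕ)) :
    bars (blockString L) = opens (blockString L) := by
  induction L with
  | nil => rfl
  | cons q L ih =>
    obtain ⟨z, k⟩ := q
    simp [blockString_cons, ih]

theorem bars_eq_closes (L : List (Letter × ℕ)) :
    bars (blockString L) = closes (blockString L) := by
  induction L with
  | nil => rfl
  | cons q L ih =>
    obtain ⟨z, k⟩ := q
    simp [blockString_cons, ih]

/-- Once `p` contains a barred letter, it contains all `k` opening brackets; symmetrically for `s`
and the closing brackets. -/
theorem blockTail_prefix {z : Letter} {k : ℕ} {p s : List Token} (h : blockTail z k = p ++ s) :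
    bars p ≤ opens p ∧ bars s ≤ closes s := by
  have hs := pairwise_blockTail z k
  have h1 := bars_blockTail z k
  have h2 := opens_blockTail z k
  have h3 := closes_blockTail z k
  rw [h] at hs h1 h2 h3
  rw [List.pairwise_append] at hs
  simp only [bars_append, opens_append, closes_append] at h1 h2 h3
  constructor
  · rcases Nat.eq_zero_or_pos (bars p) with h0 | h0
    · omega
    · obtain ⟨q, hq⟩ := exists_bar_mem h0
      have : opens s = 0 := List.count_eq_zero.mpr fun hl => by
        simpa [Token.rank] using hs.2.2 _ hq _ hl
      omega
  · rcases Nat.eq_zero_or_pos (bars s) with h0 | h0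
    · omega
    · obtain ⟨q, hq⟩ := exists_bar_mem h0
      have : closes p = 0 := List.count_eq_zero.mpr fun hl => by
        simpa [Token.rank] using hs.2.2 _ hl _ hq
      omega

theorem bars_le_opens_of_prefix {L : List (Letter × ℕ)} {u v : List Token}
    (h : blockString L = u ++ v) : bars u ≤ opens u := by
  induction L generalizing u with
  | nil =>
    simp only [blockString_nil, List.nil_eq, List.append_eq_nil_iff] at h
    simp [h.1, bars]
  | cons q L ih =>
    obtain ⟨z, k⟩ := q
    rw [blockString_cons] at h
    rcases u with _ | ⟨t, u⟩
    · simp [bars]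
    · rw [List.cons_append, List.cons.injEq] at h
      obtain ⟨rfl, h⟩ := h
      simp only [bars_core_cons, opens_core_cons]
      rcases List.append_eq_append_iff.mp h with ⟨a, rfl, h'⟩ | ⟨a, h', -⟩
      · simpa using ih h'
      · exact (blockTail_prefix h').1

theorem bars_le_closes_of_suffix {L : List (Letter × ℕ)} {u v : List Token}
    (h : blockString L = u ++ v) : bars v ≤ closes v := by
  induction L generalizing u with
  | nil =>
    simp only [blockString_nil, List.nil_eq, List.append_eq_nil_iff] at h
    simp [h.2, bars]
  | cons q L ih =>
    obtain ⟨z, k⟩ := q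
    rcases u with _ | ⟨t, u⟩
    · rw [List.nil_append] at h
      rw [← h]
      exact (bars_eq_closes _).le
    · rw [blockString_cons, List.cons_append, List.cons.injEq] at h
      obtain ⟨-, h⟩ := h
      rcases List.append_eq_append_iff.mp h with ⟨a, rfl, h'⟩ | ⟨a, h', rfl⟩
      · exact ih h'
      · have h1 := (blockTail_prefix h').2
        have h2 := bars_eq_closes L
        simp only [bars_append, closes_append]
        omega

theorem blockString_split {L : List (Letter × ℕ)} {u w : List Token} {q : Letter}
    (h : blockString L = u ++ Token.core q :: w) : ∃ L₁ k L₂, L = L₁ ++ (q, k) :: L₂ ∧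
      u = blockString L₁ ∧ w = blockTail q k ++ blockString L₂ := by
  induction L generalizing u with
  | nil => simp at h
  | cons p L ih =>
    obtain ⟨z, k⟩ := p
    rw [blockString_cons] at h
    rcases u with _ | ⟨t, u⟩
    · simp only [List.nil_append, List.cons.injEq, Token.sym.injEq, Sym.core.injEq] at h
      obtain ⟨rfl, rfl⟩ := h
      exact ⟨[], k, L, rfl, rfl, rfl⟩
    · rw [List.cons_append, List.cons.injEq] at h
      obtain ⟨rfl, h⟩ := h
      rcases List.append_eq_append_iff.mp h with ⟨a, rfl, h'⟩ | ⟨a, h', h''⟩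
      · obtain ⟨L₁, k', L₂, rfl, rfl, rfl⟩ := ih h'
        exact ⟨(z, k) :: L₁, k', L₂, rfl, (blockString_cons _ _ _).symm, rfl⟩
      · rcases a with _ | ⟨t, a⟩
        · rw [List.append_nil] at h'
          rw [List.nil_append] at h''
          obtain ⟨L₁, k', L₂, rfl, h1, rfl⟩ := ih (u := []) h''.symm
          refine ⟨(z, k) :: L₁, k', L₂, rfl, ?_, rfl⟩
          rw [blockString_cons, ← h1, h', List.append_nil]
        · rw [List.cons_append, List.cons.injEq] at h''
          refine absurd ?_ (coreless_blockTail z k q)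
          rw [h', h''.1]
          simp

theorem exists_last {P : Token → Prop} {u : List Token} (h : ∃ t ∈ u, P t) :
    ∃ u₁ t u₂, u = u₁ ++ t :: u₂ ∧ P t ∧ ∀ s ∈ u₂, ¬P s := by
  induction u with
  | nil => simp at h
  | cons t u ih =>
    by_cases hu : ∃ s ∈ u, P s
    · obtain ⟨u₁, s, u₂, rfl, hs⟩ := ih hu
      exact ⟨t :: u₁, s, u₂, rfl, hs⟩
    · push Not at hu
      obtain ⟨s, hs, hP⟩ := h
      rcases List.mem_cons.mp hs with rfl | hs
      · exact ⟨[], s, u, rfl, hP, hu⟩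
      · exact absurd hP (hu s hs)

theorem exists_last_core {u : List Token} (h : ¬Coreless u) :
    ∃ u₁ q u₂, u = u₁ ++ Token.core q :: u₂ ∧ Coreless u₂ := by
  simp only [Coreless, not_forall, not_not] at h
  obtain ⟨z, hz⟩ := h
  obtain ⟨u₁, _, u₂, rfl, ⟨q, rfl⟩, h⟩ := exists_last (P := fun t => ∃ q, t = Token.core q)
    ⟨_, hz, z, rfl⟩
  exact ⟨u₁, q, u₂, rfl, fun z hz => h _ hz ⟨z, rfl⟩⟩

/-- A string without core letters cannot reach beyond the block in which it starts. -/
theorem blockString_split_coreless {L : List (Letter × ℕ)} {u v w : List Token} {q : Letter}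
    (h : blockString L = u ++ Token.core q :: (v ++ w)) (hv : Coreless v) : ∃ L₁ k L₂,
      L = L₁ ++ (q, k) :: L₂ ∧ v ++ w = blockTail q k ++ blockString L₂ ∧
        v <+: blockTail q k := by
  obtain ⟨L₁, k, L₂, hL, -, h2⟩ := blockString_split h
  refine ⟨L₁, k, L₂, hL, h2, ?_⟩
  rcases List.append_eq_append_iff.mp h2 with ⟨a, ha, -⟩ | ⟨a, rfl, ha⟩
  · exact ⟨a, ha.symm⟩
  · rcases L₂ with _ | ⟨⟨z, k'⟩, L₂⟩
    · rw [blockString_nil, List.nil_eq, List.append_eq_nil_iff] at ha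
      simp [ha.1]
    · rw [blockString_cons] at ha
      rcases a with _ | ⟨t, a⟩
      · simp
      · rw [List.cons_append, List.cons.injEq] at ha
        refine absurd ?_ (hv z)
        rw [ha.1]
        simp

theorem eq_of_bar_after_core {L : List (Letter × ℕ)} {u v w : List Token} {q z : Letter}
    (h : blockString L = u ++ Token.core q :: (v ++ Token.bar z :: w)) (hv : Coreless v) :
    z = q := by
  have h' : blockString L = u ++ Token.core q :: ((v ++ [Token.bar z]) ++ w) := by simp [h]
  obtain ⟨_, k, _, -, -, hp⟩ := blockString_split_coreless h' (by
    intro p hp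
    rw [List.mem_append] at hp
    rcases hp with hp | hp
    · exact hv p hp
    · simp at hp)
  exact eq_of_bar_mem_blockTail (hp.subset (by simp : Token.bar z ∈ v ++ [Token.bar z]))

theorem not_coreless_of_bar {L : List (Letter × ℕ)} {u w : List Token} {z : Letter}
    (h : blockString L = u ++ Token.bar z :: w) : ¬Coreless u := by
  intro hu
  cases L with
  | nil => simp at h
  | cons p L =>
    obtain ⟨q, k⟩ := p
    rw [blockString_cons] at h
    rcases u with _ | ⟨t, u⟩
    · simp at h
    · rw [List.cons_append, List.cons.injEq] at h
      exact hu q (by simp [h.1])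

/-- A barred letter belongs to the block opened by the last core letter before it. -/
theorem core_mem_of_bar {L : List (Letter × ℕ)} {u w : List Token} {z : Letter}
    (h : blockString L = u ++ Token.bar z :: w) :
    ∃ u₁ u₂, u = u₁ ++ Token.core z :: u₂ ∧ Coreless u₂ := by
  obtain ⟨u₁, q, u₂, rfl, hu₂⟩ := exists_last_core (not_coreless_of_bar h)
  obtain rfl : z = q := eq_of_bar_after_core (L := L) (u := u₁) (v := u₂) (w := w) (by simp [h]) hu₂
  exact ⟨u₁, u₂, rfl, hu₂⟩

theorem bar_not_mem_of_prefix {L : List (Letter × ℕ)} {u w : List Token} {z : Letter}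
    (h : blockString L = u ++ w) (hz : Token.core z ∉ u) : Token.bar z ∉ u := by
  intro hb
  obtain ⟨a, b, rfl⟩ := List.append_of_mem hb
  obtain ⟨u₁, u₂, rfl, -⟩ := core_mem_of_bar (L := L) (u := a) (w := b ++ w) (z := z) (by simp [h])
  simp at hz

theorem bar_not_mem_of_core_between {L : List (Letter × ℕ)} {u v w : List Token} {q z : Letter}
    (h : blockString L = u ++ Token.core q :: (v ++ w)) (hv : Token.core z ∉ v) (hq : q ≠ z) :
    Token.bar z ∉ v := by
  intro hb
  obtain ⟨a, b, rfl⟩ := List.append_of_mem hb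
  obtain ⟨u₁, u₂, hu, hc⟩ := core_mem_of_bar (L := L) (u := u ++ Token.core q :: a) (w := b ++ w) (z := z)
    (by simp [h])
  rcases List.append_eq_append_iff.mp hu with ⟨c, rfl, hc'⟩ | ⟨c, rfl, hc'⟩
  · rcases c with _ | ⟨t, c⟩
    · simp at hc'
      exact hq hc'.1
    · rw [List.cons_append, List.cons.injEq] at hc'
      rw [hc'.2] at hv
      simp at hv
  · rcases c with _ | ⟨t, c⟩
    · simp at hc'
      exact hq hc'.1.symm
    · rw [List.cons_append, List.cons.injEq] at hc'
      exact hc q (by simp [hc'.2])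

theorem bars_le_opens_after_core {L : List (Letter × ℕ)} {u v w : List Token} {q : Letter}
    (h : blockString L = u ++ Token.core q :: (v ++ w)) : bars v ≤ opens v := by
  obtain ⟨L₁, k, L₂, -, -, h2⟩ := blockString_split h
  have : blockString ((q, k) :: L₂) = (Token.core q :: v) ++ w := by
    rw [blockString_cons, ← h2, List.cons_append]
  simpa using bars_le_opens_of_prefix this

theorem bars_le_closes_before_core {L : List (Letter × ℕ)} {u v w : List Token} {q : Letter}
    (h : blockString L = u ++ v ++ Token.core q :: w) : bars v ≤ closes v := by
  obtain ⟨L₁, k, L₂, -, h1, -⟩ := blockString_split h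
  exact bars_le_closes_of_suffix h1.symm

theorem bars_eq_closes_after_core {L : List (Letter × ℕ)} {u w : List Token} {q : Letter}
    (h : blockString L = u ++ Token.core q :: w) : bars w = closes w := by
  obtain ⟨L₁, k, L₂, -, -, rfl⟩ := blockString_split h
  have := bars_eq_closes L₂
  simp [this]

/-- Bars and closing brackets balance after a core letter, so an excess of closing brackets in `w`
is matched by bars in `v`. This serves to bound `Ctx.depth`. -/
theorem closes_le_of_core_mem {L : List (Letter × ℕ)} {u v w : List Token} {q : Letter}
    (h : blockString L = u ++ v ++ w) (hq : Token.core q ∈ v) : closes w ≤ bars w + bars v := by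
  obtain ⟨a, b, rfl⟩ := List.append_of_mem hq
  have := bars_eq_closes_after_core (L := L) (u := u ++ a) (w := b ++ w) (q := q) (by simp [h])
  simp only [bars_append, closes_append, bars_core_cons] at this ⊢
  omega

theorem bars_eq_count_of_coreless {L : List (Letter × ℕ)} {u v w : List Token} {q : Letter}
    (h : blockString L = u ++ Token.core q :: (v ++ w)) (hv : Coreless v) :
    bars v = v.count (Token.bar q) := by
  obtain ⟨_, k, _, -, -, hp⟩ := blockString_split_coreless h hv
  refine le_antisymm ?_ (count_bar_le_bars q v)
  rw [List.count, bars]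
  refine List.countP_mono_left fun t ht h => ?_
  rcases t with (z | z) | _ | _
  · simp [Token.isBar] at h
  · rw [eq_of_bar_mem_blockTail (hp.subset ht)]
    simp
  · simp [Token.isBar] at h
  · simp [Token.isBar] at h

theorem closes_le_of_coreless {L : List (Letter × ℕ)} {u v w : List Token} {q : Letter}
    (h : blockString L = u ++ Token.core q :: (v ++ w)) (hv : Coreless v) :
    closes w ≤ bars w + v.count (Token.bar q) := by
  have h1 := bars_eq_closes_after_core h
  have h2 := bars_eq_count_of_coreless h hv
  simp only [bars_append, closes_append] at h1
  omega

theorem coreless_of_bar {L : List (Letter × ℕ)} {u m w : List Token} {z : Letter}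
    (h : blockString L = u ++ m ++ Token.bar z :: w) (hm : Token.core z ∉ m) : Coreless m := by
  by_contra hc
  obtain ⟨m₁, q, m₂, rfl, hm₂⟩ := exists_last_core hc
  obtain rfl : z = q := eq_of_bar_after_core (L := L) (u := u ++ m₁) (v := m₂) (w := w) (by simp [h]) hm₂
  simp at hm

theorem closes_eq_zero_of_bar {L : List (Letter × ℕ)} {u m w : List Token} {q z : Letter}
    (h : blockString L = u ++ Token.core q :: (m ++ Token.bar z :: w)) (hm : Token.core z ∉ m) :
    closes m = 0 := by
  have hc : Coreless m := coreless_of_bar (L := L) (u := u ++ [Token.core q]) (w := w) (z := z)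
    (by simp [h]) hm
  have h' : blockString L = u ++ Token.core q :: ((m ++ [Token.bar z]) ++ w) := by simp [h]
  obtain ⟨_, k, _, -, -, hp⟩ := blockString_split_coreless h' (by
    intro p hp
    rw [List.mem_append] at hp
    rcases hp with hp | hp
    · exact hc p hp
    · simp at hp)
  have hs := (pairwise_blockTail q k).sublist hp.sublist
  rw [List.pairwise_append] at hs
  refine List.count_eq_zero.mpr fun hr => ?_
  simpa [Token.rank] using hs.2.2 _ hr (Token.bar z) (by simp)

/-- With no `z` in between, both `z̄` lie in the same block, and between two bars of a block there
are only bars. -/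
theorem brackets_between_bars {L : List (Letter × ℕ)} {u m w : List Token} {z : Letter}
    (h : blockString L = u ++ Token.bar z :: m ++ Token.bar z :: w) (hm : Token.core z ∉ m) :
    Token.lbr ∉ m ∧ Token.rbr ∉ m := by
  have hc : Coreless m := coreless_of_bar (L := L) (u := u ++ [Token.bar z]) (w := w) (z := z)
    (by simp [h]) hm
  obtain ⟨u₁, u₂, rfl, hu₂⟩ := core_mem_of_bar (L := L) (u := u) (w := m ++ Token.bar z :: w) (z := z)
    (by simp [h])
  have h' : blockString L = u₁ ++ Token.core z ::
      ((u₂ ++ (Token.bar z :: (m ++ [Token.bar z]))) ++ w) := by simp [h]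
  obtain ⟨_, k, _, -, -, hp⟩ := blockString_split_coreless h' (by
    intro p hp
    simp only [List.mem_append, List.mem_cons, List.not_mem_nil, or_false] at hp
    rcases hp with hp | hp | hp | hp
    · exact hu₂ p hp
    · simp at hp
    · exact hc p hp
    · simp at hp)
  have hs := (pairwise_blockTail z k).sublist hp.sublist
  rw [List.pairwise_append, List.pairwise_cons, List.pairwise_append] at hs
  obtain ⟨-, ⟨h1, -, -, h2⟩, -⟩ := hs
  constructor
  · intro hl
    simpa [Token.rank] using h1 Token.lbr (by simp [hl])
  · intro hr
    simpa [Token.rank] using h2 Token.rbr hr (Token.bar z) (by simp)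

/-- If `v = a z̄ b`, the square contains `z̄ b a z̄`. Hence `b a`, which has the same brackets as
`v`, has none. -/
theorem brackets_of_square {L : List (Letter × ℕ)} {u v w : List Token} {z : Letter}
    (h : blockString L = u ++ (v ++ v) ++ w) (hb : Token.bar z ∈ v) (hc : Token.core z ∉ v) :
    opens v = 0 ∧ closes v = 0 := by
  obtain ⟨a, b, rfl⟩ := List.append_of_mem hb
  have := brackets_between_bars (u := u ++ a) (m := b ++ a) (w := b ++ w) (z := z) (L := L)
    (by simp [h]) (by simp at hc ⊢; tauto)
  simp only [List.mem_append, not_or] at this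
  constructor
  · exact List.count_eq_zero.mpr (by simp; tauto)
  · exact List.count_eq_zero.mpr (by simp; tauto)

/-! ## Runs -/

theorem bddAbove_runs (z : Token) (s : List Token) :
    BddAbove {n : ℕ | List.replicate n z <:+: s} :=
  ⟨s.length, fun n hn => by simpa using hn.length_le⟩

theorem le_maxRun {z : Token} {s : List Token} {n : ℕ} (h : List.replicate n z <:+: s) :
    n ≤ maxRun z s :=
  le_csSup (bddAbove_runs z s) h

theorem replicate_maxRun (z : Token) (s : List Token) :
    List.replicate (maxRun z s) z <:+: s :=
  Nat.sSup_mem ⟨0, by simp⟩ (bddAbove_runs z s)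

theorem le_maxRun_blockString {L₁ L₂ : List (Letter × ℕ)} {q : Letter} {k : ℕ} :
    k ≤ maxRun (Token.bar q) (blockString (L₁ ++ (q, k) :: L₂)) := by
  refine le_maxRun ⟨blockString L₁ ++ Token.core q :: List.replicate k .lbr,
    List.replicate k .rbr ++ blockString L₂, ?_⟩
  simp [blockString_append, blockString_cons, blockTail]

/-- Without a letter `z`, the string `v` can contain `z̄` only from the block of the last `z` before
it, and the bars of one block form a run. -/
theorem count_bar_le_maxRun {L : List (Letter × ℕ)} {u v w : List Token} {z : Letter}
    (h : blockString L = u ++ v ++ w) (hv : Token.core z ∉ v) :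
    v.count (Token.bar z) ≤ maxRun (Token.bar z) (blockString L) := by
  by_cases hu : Token.core z ∈ u
  · obtain ⟨u₁, _, u₂, rfl, rfl, hu₂⟩ := exists_last (P := fun t => t = Token.core z) ⟨_, hu, rfl⟩
    obtain ⟨L₁, k, L₂, rfl, -, h2⟩ := blockString_split (L := L) (u := u₁) (q := z)
      (w := (u₂ ++ v) ++ w) (by simp [h])
    refine le_trans ?_ (le_maxRun_blockString (L₁ := L₁) (L₂ := L₂) (k := k))
    have hle : v.count (Token.bar z) ≤ (u₂ ++ v).count (Token.bar z) := by simp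
    refine hle.trans ?_
    rcases List.append_eq_append_iff.mp h2 with ⟨a, ha, -⟩ | ⟨a, ha, ha'⟩
    · have := congrArg (List.count (Token.bar z)) ha
      rw [count_bar_blockTail, List.count_append] at this
      omega
    · have : Token.bar z ∉ a := by
        refine bar_not_mem_of_prefix ha' fun hm => ?_
        have : Token.core z ∈ u₂ ++ v := by simp [ha, hm]
        rcases List.mem_append.mp this with hm | hm
        · exact hu₂ _ hm rfl
        · exact hv hm
      rw [ha, List.count_append, count_bar_blockTail, List.count_eq_zero.mpr this]
      omega
  · have := bar_not_mem_of_prefix (L := L) (z := z) h (by simp [hu, hv])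
    rw [List.count_eq_zero.mpr fun hm => this (List.mem_append_right _ hm)]
    exact Nat.zero_le _

/-- The letters `z` cut `v` into one more piece than there are such letters, and each piece meets
one run. -/
theorem count_bar_le_mul_maxRun {L : List (Letter × ℕ)} {z : Letter} (v : List Token) :
    ∀ {u w : List Token}, blockString L = u ++ v ++ w →
      v.count (Token.bar z) ≤
        (v.count (Token.core z) + 1) * maxRun (Token.bar z) (blockString L) := by
  induction hn : v.count (Token.core z) generalizing v with
  | zero =>
    intro u w h
    simpa using count_bar_le_maxRun h (List.count_eq_zero.mp hn)
  | succ n ih =>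
    intro u w h
    obtain ⟨v₁, _, v₂, rfl, rfl, hv₂⟩ := exists_last (P := fun t => t = Token.core z)
      ⟨_, List.count_pos_iff.mp (by omega : 0 < v.count (Token.core z)), rfl⟩
    have h0 : v₂.count (Token.core z) = 0 := List.count_eq_zero.mpr fun hm => hv₂ _ hm rfl
    have hn1 : v₁.count (Token.core z) = n := by simp [h0] at hn; omega
    have h1 := ih v₁ hn1 (u := u) (w := Token.core z :: v₂ ++ w) (by simp [h])
    have h2 := count_bar_le_maxRun (L := L) (u := u ++ v₁ ++ [Token.core z]) (v := v₂) (w := w)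
      (z := z) (by simp [h]) (fun hm => hv₂ _ hm rfl)
    simp only [List.count_append, List.count_cons]
    simp only [beq_iff_eq, Token.sym.injEq, reduceCtorEq, if_false, Nat.add_zero]
    have : (n + 1 + 1) * maxRun (Token.bar z) (blockString L) =
        (n + 1) * maxRun (Token.bar z) (blockString L) +
          maxRun (Token.bar z) (blockString L) := by ring
    omega

/-- Complete blocks are balanced, so any surplus of opening brackets comes from the current
`z`-block. With `exists_opens_eq_maxRun`, this makes the longest run a maximum of prefix counts,
which change linearly under pumping. -/
theorem opens_le_maxRun {L : List (Letter × ℕ)} {u w : List Token} {z : Letter}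
    (h : blockString L = u ++ Token.bar z :: w) :
    opens u ≤ bars u + maxRun (Token.bar z) (blockString L) := by
  obtain ⟨u₁, u₂, rfl, hu₂⟩ := core_mem_of_bar h
  obtain ⟨L₁, k, L₂, rfl, -, hp⟩ := blockString_split_coreless (L := L) (u := u₁) (q := z) (v := u₂)
    (w := Token.bar z :: w) (by simp [h]) hu₂
  obtain ⟨L₁', _, _, -, rfl, -⟩ := blockString_split (L := L₁ ++ (z, k) :: L₂) (u := u₁) (q := z)
    (w := u₂ ++ Token.bar z :: w) (by simpa using h)
  have h1 := le_maxRun_blockString (L₁ := L₁) (L₂ := L₂) (k := k) (q := z)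
  have h2 : opens u₂ ≤ k := (opens_blockTail z k) ▸ hp.sublist.count_le _
  have h3 := bars_eq_opens L₁'
  simp only [opens_append, bars_append, opens_core_cons, bars_core_cons]
  omega

/-- The surplus is attained at the first `z̄` of the block that contains a longest run. -/
theorem exists_opens_eq_maxRun {L : List (Letter × ℕ)} {z : Letter}
    (h : 0 < maxRun (Token.bar z) (blockString L)) : ∃ u w,
      blockString L = u ++ Token.bar z :: w ∧
        maxRun (Token.bar z) (blockString L) + bars u ≤ opens u := by
  obtain ⟨a, b, hab⟩ := replicate_maxRun (Token.bar z) (blockString L)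
  set K := maxRun (Token.bar z) (blockString L) with hK
  obtain ⟨n, hn⟩ := Nat.exists_eq_add_one.mpr h
  obtain ⟨u₁, u₂, rfl, hu₂⟩ := core_mem_of_bar (L := L) (u := a) (z := z)
    (w := List.replicate n (Token.bar z) ++ b) (by
      rw [← hab, hn, List.replicate_succ]
      simp)
  obtain ⟨L₁, k, L₂, hL, -, hp⟩ := blockString_split_coreless (L := L) (u := u₁) (q := z)
    (v := u₂ ++ List.replicate K (Token.bar z)) (w := b) (by simp [← hab]) (by
      intro p hp
      rcases List.mem_append.mp hp with hp | hp
      · exact hu₂ p hp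
      · simp [List.mem_replicate] at hp)
  have hKk : K ≤ k := by
    have := hp.sublist.count_le (Token.bar z)
    rw [count_bar_blockTail, List.count_append, List.count_replicate_self] at this
    omega
  obtain ⟨m, rfl⟩ := Nat.exists_eq_add_one.mpr (h.trans_le hKk)
  refine ⟨blockString L₁ ++ Token.core z :: List.replicate (m + 1) .lbr,
    List.replicate m (Token.bar z) ++ (List.replicate (m + 1) .rbr ++ blockString L₂), ?_, ?_⟩
  · rw [hL, blockString_append, blockString_cons, blockTail, List.replicate_succ (a := Token.bar z)]
    simp
  · have h3 := bars_eq_opens L₁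
    have h4 : opens (List.replicate (m + 1) Token.lbr) = m + 1 := by
      simp [opens]
    have h5 : bars (List.replicate (m + 1) Token.lbr) = 0 := by
      simp [bars, List.countP_replicate, Token.isBar]
    simp only [opens_append, bars_append, opens_core_cons, bars_core_cons]
    omega

/-! ## Pumping strings -/

/-- The `i`-th power of a string. -/
def power (i : ℕ) (v : List Token) : List Token := (List.replicate i v).flatten

@[simp] theorem power_zero (v : List Token) : power 0 v = [] := rfl

theorem power_succ (i : ℕ) (v : List Token) : power (i + 1) v = v ++ power i v := by
  simp [power, List.replicate_succ]

theorem power_succ' (i : ℕ) (v : List Token) : power (i + 1) v = power i v ++ v := by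
  simp [power, List.replicate_succ']

@[simp] theorem power_one (v : List Token) : power 1 v = v := by
  simp [power_succ]

theorem power_two (v : List Token) : power 2 v = v ++ v := by
  simp [power_succ]

theorem countP_power (P : Token → Bool) (i : ℕ) (v : List Token) :
    (power i v).countP P = i * v.countP P := by
  induction i with
  | zero => simp
  | succ i ih =>
    rw [power_succ, List.countP_append, ih]
    ring

theorem bars_power (i : ℕ) (v : List Token) : bars (power i v) = i * bars v :=
  countP_power _ i v

theorem opens_power (i : ℕ) (v : List Token) : opens (power i v) = i * opens v :=
  countP_power _ i v

theorem closes_power (i : ℕ) (v : List Token) : closes (power i v) = i * closes v :=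
  countP_power _ i v

theorem le_of_forall_add_mul_le {a b c d : ℕ} (h : ∀ i, a + i * b ≤ c + i * d) : b ≤ d := by
  by_contra! hlt
  have h1 := h (c + 1)
  have h2 : (c + 1) * (d + 1) ≤ (c + 1) * b := Nat.mul_le_mul_left _ hlt
  have h3 : (c + 1) * (d + 1) = (c + 1) * d + (c + 1) := by ring
  omega

/-- Without `z`, the square of `v` forces `v` to be free of brackets. Each copy then adds a bar but
no opening bracket, which eventually violates `bars_le_opens_of_prefix`. The three variants below
use suffixes, and stretches before or after a core letter, instead. -/
theorem core_mem_of_pump_prefix {u v : List Token} {z : Letter}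
    (h : ∀ i, ∃ L w, blockString L = u ++ power i v ++ w) (hb : Token.bar z ∈ v) :
    Token.core z ∈ v := by
  by_contra hc
  obtain ⟨L, w, h2⟩ := h 2
  rw [power_two] at h2
  have h0 := (brackets_of_square h2 hb hc).1
  have hpos : 0 < v.count (Token.bar z) := List.count_pos_iff.mpr hb
  have hle := count_bar_le_bars z v
  have : bars v ≤ opens v := le_of_forall_add_mul_le (a := bars u) (c := opens u) fun i => by
    obtain ⟨L, w, hi⟩ := h i
    simpa [bars_power, opens_power] using bars_le_opens_of_prefix hi
  omega

theorem bars_le_closes_of_pump_suffix {u v : List Token}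
    (h : ∀ i, ∃ L w, blockString L = w ++ (power i v ++ u)) : bars v ≤ closes v :=
  le_of_forall_add_mul_le (a := bars u) (c := closes u) fun i => by
    obtain ⟨L, w, hi⟩ := h i
    simpa [bars_power, closes_power, add_comm] using bars_le_closes_of_suffix hi

theorem core_mem_of_pump_suffix {u v : List Token} {z : Letter}
    (h : ∀ i, ∃ L w, blockString L = w ++ (power i v ++ u)) (hb : Token.bar z ∈ v) :
    Token.core z ∈ v := by
  by_contra hc
  obtain ⟨L, w, h2⟩ := h 2
  rw [power_two, ← List.append_assoc] at h2
  have h0 := (brackets_of_square h2 hb hc).2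
  have hpos : 0 < v.count (Token.bar z) := List.count_pos_iff.mpr hb
  have hle := count_bar_le_bars z v
  have := bars_le_closes_of_pump_suffix h
  omega

theorem core_mem_of_pump_before_core {v a : List Token} {q z : Letter}
    (h : ∀ i, ∃ L u w, blockString L = u ++ (power i v ++ a) ++ Token.core q :: w)
    (hb : Token.bar z ∈ v) : Token.core z ∈ v := by
  by_contra hc
  obtain ⟨L, u, w, h2⟩ := h 2
  rw [power_two] at h2
  have h0 := (brackets_of_square (L := L) (u := u) (v := v) (w := a ++ Token.core q :: w) (by simp [h2])
    hb hc).2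
  have hpos : 0 < v.count (Token.bar z) := List.count_pos_iff.mpr hb
  have hle := count_bar_le_bars z v
  have : bars v ≤ closes v := le_of_forall_add_mul_le (a := bars a) (c := closes a) fun i => by
    obtain ⟨L, u, w, hi⟩ := h i
    simpa [bars_power, closes_power, add_comm] using bars_le_closes_before_core hi
  omega

theorem core_mem_of_pump_after_core {v a : List Token} {q z : Letter}
    (h : ∀ i, ∃ L u w, blockString L = u ++ Token.core q :: ((a ++ power i v) ++ w))
    (hb : Token.bar z ∈ v) : Token.core z ∈ v := by
  by_contra hc
  obtain ⟨L, u, w, h2⟩ := h 2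
  rw [power_two] at h2
  have h0 := (brackets_of_square (L := L) (u := u ++ Token.core q :: a) (v := v) (w := w) (by simp [h2])
    hb hc).1
  have hpos : 0 < v.count (Token.bar z) := List.count_pos_iff.mpr hb
  have hle := count_bar_le_bars z v
  have : bars v ≤ opens v := le_of_forall_add_mul_le (a := bars a) (c := opens a) fun i => by
    obtain ⟨L, u, w, hi⟩ := h i
    simpa [bars_power, opens_power] using bars_le_opens_after_core hi
  omega

/-- `pumped [(a₁, v₁), …, (aₙ, vₙ)] e i` is `a₁ v₁ⁱ … aₙ vₙⁱ e`. -/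
def pumped : List (List Token × List Token) → List Token → ℕ → List Token
  | [], e, _ => e
  | (a, v) :: Q, e, i => a ++ (power i v ++ pumped Q e i)

/-- A token of the unpumped string survives in every pumped one, and all counts in the prefix before
it are affine in `i`. -/
theorem exists_pumped_split {c : Token} (Q : List (List Token × List Token)) {e u w : List Token}
    (h : pumped Q e 0 = u ++ c :: w) : ∃ f g : ℕ → List Token,
      (∀ i, pumped Q e i = f i ++ c :: g i) ∧ f 0 = u ∧
        ∀ P, ∃ d, ∀ i, (f i).countP P = u.countP P + i * d := by
  induction Q generalizing u with
  | nil => exact ⟨fun _ => u, fun _ => w, fun i => h, rfl, fun P => ⟨0, fun i => by simp⟩⟩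
  | cons p Q ih =>
    obtain ⟨a, v⟩ := p
    simp only [pumped, power_zero, List.nil_append] at h
    have hrest : ∀ u', u = a ++ u' → pumped Q e 0 = u' ++ c :: w → ∃ f g : ℕ → List Token,
      (∀ i, pumped ((a, v) :: Q) e i = f i ++ c :: g i) ∧ f 0 = u ∧
        ∀ P, ∃ d, ∀ i, (f i).countP P = u.countP P + i * d := by
      rintro u' rfl h'
      obtain ⟨f, g, hfg, h0, hP⟩ := ih h'
      refine ⟨fun i => a ++ (power i v ++ f i), g, fun i => by simp [pumped, hfg], by simp [h0],
        fun P => ?_⟩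
      obtain ⟨d, hd⟩ := hP P
      refine ⟨v.countP P + d, fun i => ?_⟩
      simp only [List.countP_append, countP_power, hd]
      ring
    rcases List.append_eq_append_iff.mp h with ⟨b, rfl, h'⟩ | ⟨b, rfl, h'⟩
    · exact hrest b rfl h'
    · rcases b with _ | ⟨t, b⟩
      · exact hrest [] (by simp) (by simpa using h'.symm)
      · rw [List.cons_append, List.cons.injEq] at h'
        obtain ⟨rfl, rfl⟩ := h'
        exact ⟨fun _ => u, fun i => b ++ (power i v ++ pumped Q e i), fun i => by simp [pumped],
          rfl, fun P => ⟨0, fun i => by simp⟩⟩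

/-- Follow the `z̄` before which the surplus of opening brackets equals the longest run. Since no
prefix of any pumped string has more bars than opening brackets, the surplus before this token
cannot fall as `i` grows; for `i = 1` it is bounded by the longest run there. -/
theorem maxRun_pumped_le {Q : List (List Token × List Token)} {e : List Token} {z : Letter}
    (h : ∀ i, ∃ L, blockString L = pumped Q e i) :
    maxRun (Token.bar z) (pumped Q e 0) ≤ maxRun (Token.bar z) (pumped Q e 1) := by
  rcases Nat.eq_zero_or_pos (maxRun (Token.bar z) (pumped Q e 0)) with h0 | hpos
  · rw [h0]
    exact Nat.zero_le _
  · obtain ⟨L, hL⟩ := h 0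
    rw [← hL] at hpos
    obtain ⟨u, w, huw, hle⟩ := exists_opens_eq_maxRun hpos
    rw [hL] at huw hle
    obtain ⟨f, g, hfg, hf0, hP⟩ := exists_pumped_split Q huw
    obtain ⟨d, hd⟩ := hP Token.isBar
    obtain ⟨d', hd'⟩ := hP (fun t => t == Token.lbr)
    have hb : ∀ i, bars (f i) = bars u + i * d := hd
    have ho : ∀ i, opens (f i) = opens u + i * d' := hd'
    have hdd : d ≤ d' := le_of_forall_add_mul_le (a := bars u) (c := opens u) fun i => by
      obtain ⟨L, hi⟩ := h i
      rw [← hb, ← ho]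
      exact bars_le_opens_of_prefix (hi.trans (hfg i))
    obtain ⟨L', hL'⟩ := h 1
    have h1 := opens_le_maxRun (hL'.trans (hfg 1))
    rw [hL', hb, ho] at h1
    omega

/-! ## The strings of `CSDs` -/

theorem blocks_eq_blockString (z : Letter) (l : List ℕ) :
    blocks z l = blockString (l.map fun k => (z, k)) := by
  simp [blocks, blockString, List.flatMap_map]

theorem exists_blockString {s : List Token} (h : s ∈ CSDs) : ∃ L, blockString L = s := by
  obtain ⟨ka, kb, kc, kd, -, -, -, -, rfl⟩ := h
  simp only [blocks_eq_blockString, ← blockString_append]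
  exact ⟨_, rfl⟩

theorem count_core_blocks (z q : Letter) (l : List ℕ) :
    (blocks z l).count (Token.core q) = if z = q then l.length else 0 := by
  induction l with
  | nil => simp [blocks]
  | cons k l ih =>
    have : blocks z (k :: l) = block z k ++ blocks z l := by simp [blocks]
    rw [this, List.count_append, ih]
    by_cases h : z = q
    · simp [h, block, List.count_replicate]
      omega
    · simp [h, block, List.count_replicate]

theorem count_core_of_mem {s : List Token} (h : s ∈ CSDs) {x y : Letter} (hxy : Sep x y) :
    s.count (Token.core x) = s.count (Token.core y) ∧ 0 < s.count (Token.core x) := by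
  obtain ⟨ka, kb, kc, kd, ha, hb, hc, hd, rfl⟩ := h
  cases hxy <;> simp [count_core_blocks] <;> omega

end Strings

end SemCap
namespace SemCap

/-! ### Strings with four factors pumped simultaneously -/

section PumpedStrings

variable {l₁ l₂ l₃ l₄ w r₄ r₃ r₂ r₁ : List Token}

/-- The string `l₁ l₂ⁱ l₃ l₄ⁱ w r₄ⁱ r₃ r₂ⁱ r₁`. -/
def pumpString (l₁ l₂ l₃ l₄ w r₄ r₃ r₂ r₁ : List Token) (i : ℕ) : List Token :=
  l₁ ++ (power i l₂ ++ (l₃ ++ (power i l₄ ++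
    (w ++ (power i r₄ ++ (r₃ ++ (power i r₂ ++ r₁)))))))

/-- All pumped strings are concatenations of blocks. -/
def PumpsBlocks (l₁ l₂ l₃ l₄ w r₄ r₃ r₂ r₁ : List Token) : Prop :=
  ∀ i, ∃ L, blockString L = pumpString l₁ l₂ l₃ l₄ w r₄ r₃ r₂ r₁ i

namespace PumpsBlocks

theorem core_mem_outer_left (hs : PumpsBlocks l₁ l₂ l₃ l₄ w r₄ r₃ r₂ r₁)
    {z : Letter} (hb : Token.bar z ∈ l₂) : Token.core z ∈ l₂ :=
  core_mem_of_pump_prefix (u := l₁) (fun i => by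
    obtain ⟨L, hL⟩ := hs i
    exact ⟨L, _, hL.trans (List.append_assoc _ _ _).symm⟩) hb

theorem core_mem_outer_right (hs : PumpsBlocks l₁ l₂ l₃ l₄ w r₄ r₃ r₂ r₁)
    {z : Letter} (hb : Token.bar z ∈ r₂) : Token.core z ∈ r₂ :=
  core_mem_of_pump_suffix (u := r₁) (fun i => by
    obtain ⟨L, hL⟩ := hs i
    exact ⟨L, l₁ ++ (power i l₂ ++ (l₃ ++ (power i l₄ ++ (w ++ (power i r₄ ++ r₃))))),
      by simp [hL, pumpString]⟩) hb

theorem bars_outer_right_le (hs : PumpsBlocks l₁ l₂ l₃ l₄ w r₄ r₃ r₂ r₁) : bars r₂ ≤ closes r₂ :=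
  bars_le_closes_of_pump_suffix (u := r₁) fun i => by
    obtain ⟨L, hL⟩ := hs i
    exact ⟨L, l₁ ++ (power i l₂ ++ (l₃ ++ (power i l₄ ++ (w ++ (power i r₄ ++ r₃))))),
      by simp [hL, pumpString]⟩

theorem bars_right_le (hs : PumpsBlocks l₁ l₂ l₃ l₄ w r₄ r₃ r₂ r₁) :
    bars r₄ + bars r₂ ≤ closes r₄ + closes r₂ :=
  le_of_forall_add_mul_le (a := bars r₃ + bars r₁) (c := closes r₃ + closes r₁) fun i => by
    obtain ⟨L, hL⟩ := hs i
    have := bars_le_closes_of_suffix (L := L)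
      (u := l₁ ++ (power i l₂ ++ (l₃ ++ (power i l₄ ++ w))))
      (v := power i r₄ ++ (r₃ ++ (power i r₂ ++ r₁))) (by simp [hL, pumpString])
    simp only [bars_append, closes_append, bars_power, closes_power] at this
    rw [mul_add, mul_add]
    omega

theorem core_mem_inner_left_of_core_mem_left (hs : PumpsBlocks l₁ l₂ l₃ l₄ w r₄ r₃ r₂ r₁)
    {q z : Letter} (hq : Token.core q ∈ l₃)
    (hb : Token.bar z ∈ l₄) : Token.core z ∈ l₄ := by
  obtain ⟨a, b, rfl⟩ := List.append_of_mem hq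
  refine core_mem_of_pump_after_core (a := b) (q := q) (fun i => ?_) hb
  obtain ⟨L, hL⟩ := hs i
  exact ⟨L, l₁ ++ (power i l₂ ++ a), w ++ (power i r₄ ++ (r₃ ++ (power i r₂ ++ r₁))),
    by simp [hL, pumpString]⟩

theorem core_mem_inner_right_of_core_mem_right (hs : PumpsBlocks l₁ l₂ l₃ l₄ w r₄ r₃ r₂ r₁)
    {q z : Letter} (hq : Token.core q ∈ r₃)
    (hb : Token.bar z ∈ r₄) : Token.core z ∈ r₄ := by
  obtain ⟨a, b, rfl⟩ := List.append_of_mem hq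
  refine core_mem_of_pump_before_core (a := a) (q := q) (fun i => ?_) hb
  obtain ⟨L, hL⟩ := hs i
  exact ⟨L, l₁ ++ (power i l₂ ++ (l₃ ++ (power i l₄ ++ w))), b ++ (power i r₂ ++ r₁),
    by simp [hL, pumpString]⟩

theorem core_mem_inner_left (hs : PumpsBlocks l₁ l₂ l₃ l₄ w r₄ r₃ r₂ r₁)
    {q z : Letter} (hq : Token.core q ∈ w)
    (hb : Token.bar z ∈ l₄) : Token.core z ∈ l₄ := by
  obtain ⟨a, b, rfl⟩ := List.append_of_mem hq
  refine core_mem_of_pump_before_core (a := a) (q := q) (fun i => ?_) hb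
  obtain ⟨L, hL⟩ := hs i
  exact ⟨L, l₁ ++ (power i l₂ ++ l₃), b ++ (power i r₄ ++ (r₃ ++ (power i r₂ ++ r₁))),
    by simp [hL, pumpString]⟩

theorem core_mem_inner_right (hs : PumpsBlocks l₁ l₂ l₃ l₄ w r₄ r₃ r₂ r₁)
    {q z : Letter} (hq : Token.core q ∈ w)
    (hb : Token.bar z ∈ r₄) : Token.core z ∈ r₄ := by
  obtain ⟨a, b, rfl⟩ := List.append_of_mem hq
  refine core_mem_of_pump_after_core (a := b) (q := q) (fun i => ?_) hb
  obtain ⟨L, hL⟩ := hs i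
  exact ⟨L, l₁ ++ (power i l₂ ++ (l₃ ++ (power i l₄ ++ a))), r₃ ++ (power i r₂ ++ r₁),
    by simp [hL, pumpString]⟩

theorem maxRun_le (hs : PumpsBlocks l₁ l₂ l₃ l₄ w r₄ r₃ r₂ r₁) (z : Letter) :
    maxRun (Token.bar z) (pumpString l₁ l₂ l₃ l₄ w r₄ r₃ r₂ r₁ 0) ≤
      maxRun (Token.bar z) (pumpString l₁ l₂ l₃ l₄ w r₄ r₃ r₂ r₁ 1) :=
  maxRun_pumped_le (Q := [(l₁, l₂), (l₃, l₄), (w, r₄), (r₃, r₂)]) (e := r₁) hs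

theorem bars_eq_opens (hs : PumpsBlocks l₁ l₂ l₃ l₄ w r₄ r₃ r₂ r₁) :
    bars l₂ + bars l₄ + bars r₄ + bars r₂ =
    opens l₂ + opens l₄ + opens r₄ + opens r₂ := by
  obtain ⟨L, hL⟩ := hs 0
  obtain ⟨L', hL'⟩ := hs 1
  have h := SemCap.bars_eq_opens L
  have h' := SemCap.bars_eq_opens L'
  rw [hL] at h
  rw [hL'] at h'
  simp only [pumpString, power_zero, power_one, bars_append, opens_append, List.nil_append] at h h'
  omega

theorem bars_eq_closes (hs : PumpsBlocks l₁ l₂ l₃ l₄ w r₄ r₃ r₂ r₁) :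
    bars l₂ + bars l₄ + bars r₄ + bars r₂ =
    closes l₂ + closes l₄ + closes r₄ + closes r₂ := by
  obtain ⟨L, hL⟩ := hs 0
  obtain ⟨L', hL'⟩ := hs 1
  have h := SemCap.bars_eq_closes L
  have h' := SemCap.bars_eq_closes L'
  rw [hL] at h
  rw [hL'] at h'
  simp only [pumpString, power_zero, power_one, bars_append, closes_append, List.nil_append] at h h'
  omega

end PumpsBlocks

end PumpedStrings

/-! ### The invariant comparing edges and tokens below a cut -/

section CutBounds

variable {Δ : Signature} {c : Sym → Δ.Op → ℕ} {x y : Letter} {l : ℕ}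

/-- The number of unmatched closing brackets to the right of the hole. -/
def Ctx.depth (E : Ctx Δ) : ℕ := closes E.right - bars E.right

/-- Bounds for the difference between the numbers of tokens and edges of the subtree `t` of
`E[t]`. -/
structure CutBound (c : Sym → Δ.Op → ℕ) (x y : Letter) (l : ℕ) (E : Ctx Δ) (t : Tree Δ) :
    Prop where
  edges_le : t.weight (c (.bar x)) ≤
    t.yield.count (Token.bar x) + (E.plug t).yield.count (Token.core x) * l
  le_run : t.yield.count (Token.bar y) ≤ t.weight (c (.bar y)) +
    (E.plug t).yield.count (Token.core x) * l + maxRun (Token.bar y) (E.plug t).yield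
  le_depth : 3 * t.yield.count (Token.bar y) ≤ 3 * t.weight (c (.bar y)) +
    3 * ((E.plug t).yield.count (Token.core x) * l) + max (3 * E.depth) l
  le_last : ∀ u v, t.yield = u ++ Token.core y :: v → Coreless v →
    t.yield.count (Token.bar y) ≤ t.weight (c (.bar y)) +
      (E.plug t).yield.count (Token.core x) * l + v.count (Token.bar y)

theorem CutBound.of_le {E : Ctx Δ} {t : Tree Δ}
    (hn : 0 < (E.plug t).yield.count (Token.core x))
    (hx : t.weight (c (.bar x)) ≤ t.yield.count (Token.bar x) + l)
    (hy : t.yield.count (Token.bar y) ≤ t.weight (c (.bar y)) + l) : CutBound c x y l E t := by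
  have := Nat.le_mul_of_pos_left l hn
  exact ⟨by omega, by omega, by omega, fun _ _ _ _ => by omega⟩

/-- As no `a` is lost, the `a` after `u` survives, and what follows it only shrinks. -/
theorem exists_last_of_sublist {α : Type*} [DecidableEq α] {a : α} {s s' u v : List α}
    (hsub : s'.Sublist s) (hc : s'.count a = s.count a) (hs : s = u ++ a :: v) :
    ∃ u' v', s' = u' ++ a :: v' ∧ v'.Sublist v := by
  subst hs
  obtain ⟨b, d, rfl, hb, hd⟩ := List.sublist_append_iff.mp hsub
  rcases List.sublist_cons_iff.mp hd with hd | ⟨e, rfl, he⟩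
  · have h1 := hb.count_le a
    have h2 := hd.count_le a
    simp at hc
    omega
  · exact ⟨b, e, rfl, he⟩

theorem depth_le_of_last {L : List (Letter × ℕ)} {E : Ctx Δ} {t : Tree Δ}
    (hL : blockString L = (E.plug t).yield) {u v : List Token}
    (h : t.yield = u ++ Token.core y :: v) (hv : Coreless v) :
    E.depth ≤ v.count (Token.bar y) := by
  rw [Ctx.yield_plug, h] at hL
  have := closes_le_of_coreless (L := L) (u := E.left ++ u) (q := y) (v := v) (w := E.right)
    (by simp [hL]) hv
  unfold Ctx.depth
  omega

/-- If the number of `x` is unchanged, so is that of `y`. As the `y` all lie in `t` and `t'`, the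
last `y` of `t` survives in `t'`, and `le_last` transfers. If the number of `x` drops, the last `y`
may change, and `le_last` is recovered from `le_depth`, which refers to `E` only, via
`depth_le_of_last`. One step costs at most a third of `l` for the `ȳ`-discrepancy and another third
for the depth; the `max` with `l` adds at most a third more, and the drop of `nₓ l` pays for all of
this. -/
theorem CutBound.step {L : List (Letter × ℕ)} {E E' : Ctx Δ} {t t' : Tree Δ}
    (hb : CutBound c x y l E' t') (hL : blockString L = (E.plug t).yield)
    (hy : Token.core y ∉ E.yield) (hy' : Token.core y ∉ E'.yield)
    (hc : (E.plug t).yield.count (Token.core x) = (E.plug t).yield.count (Token.core y))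
    (hc' : (E'.plug t').yield.count (Token.core x) = (E'.plug t').yield.count (Token.core y))
    (hsub : t'.yield.Sublist t.yield)
    (hle : (E'.plug t').yield.count (Token.core x) ≤ (E.plug t).yield.count (Token.core x))
    (hrun : maxRun (Token.bar y) (E'.plug t').yield ≤ maxRun (Token.bar y) (E.plug t).yield)
    (hx : t.weight (c (.bar x)) + t'.yield.count (Token.bar x) ≤
      t.yield.count (Token.bar x) + t'.weight (c (.bar x)) + l)
    (hx₀ : (E'.plug t').yield.count (Token.core x) = (E.plug t).yield.count (Token.core x) →
      t.weight (c (.bar x)) + t'.yield.count (Token.bar x) ≤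
        t.yield.count (Token.bar x) + t'.weight (c (.bar x)))
    (hd : 3 * t.yield.count (Token.bar y) + 3 * t'.weight (c (.bar y)) ≤
      3 * t.weight (c (.bar y)) + 3 * t'.yield.count (Token.bar y) + l)
    (hd₀ : (E'.plug t').yield.count (Token.core x) = (E.plug t).yield.count (Token.core x) →
      t.yield.count (Token.bar y) + t'.weight (c (.bar y)) ≤
        t.weight (c (.bar y)) + t'.yield.count (Token.bar y))
    (hD : 3 * E'.depth ≤ 3 * E.depth + l)
    (hD₀ : (E'.plug t').yield.count (Token.core x) = (E.plug t).yield.count (Token.core x) →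
      3 * E'.depth ≤ max (3 * E.depth) l) : CutBound c x y l E t := by
  obtain ⟨h1, h2, h3, h4⟩ := hb
  rcases hle.eq_or_lt with heq | hlt
  · have hx := hx₀ heq
    have hd := hd₀ heq
    have hD := hD₀ heq
    rw [heq] at h1 h2 h3 h4
    refine ⟨by omega, by omega, by omega, fun u v huv hv => ?_⟩
    have hcount : t'.yield.count (Token.core y) = t.yield.count (Token.core y) := by
      rw [hc, hc', Ctx.yield_plug, Ctx.yield_plug] at heq
      rw [← List.count_eq_zero] at hy hy'
      simp only [Ctx.yield, List.count_append] at hy hy' heq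
      omega
    obtain ⟨u', v', huv', hsub'⟩ := exists_last_of_sublist hsub hcount huv
    have := h4 u' v' huv' fun z hz => hv z (hsub'.subset hz)
    have := hsub'.count_le (Token.bar y)
    omega
  · have hmul := Nat.mul_le_mul_right l hlt
    rw [Nat.succ_mul] at hmul
    refine ⟨by omega, by omega, by omega, fun u v huv hv => ?_⟩
    have := depth_le_of_last hL huv hv
    omega

/-- All `ȳ` of `t` are counted directly: at most `|u|` lie before the last `y`, and the others lie
in its block, hence in one run. A `ȳ` follows `m` in that block, so `m` has no closing bracket, and
the bars of the tail exceed the depth of `E` by at most `|v|`. -/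
theorem CutBound.of_tail {L : List (Letter × ℕ)} {E : Ctx Δ} {t : Tree Δ}
    (hL : blockString L = (E.plug t).yield)
    (hn : 0 < (E.plug t).yield.count (Token.core x))
    (hx : t.weight (c (.bar x)) ≤
      t.yield.count (Token.bar x) + (E.plug t).yield.count (Token.core x) * l)
    {u m v : List Token} (ht : t.yield = u ++ Token.core y :: (m ++ Token.bar y :: v))
    (hm : Token.core y ∉ m) (hv : Token.core y ∉ v) (hlen : u.length + v.length ≤ l) :
    CutBound c x y l E t := by
  have hl := Nat.le_mul_of_pos_left l hn
  have hu := List.count_le_length (a := Token.bar y) (l := u)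
  have hcount : t.yield.count (Token.bar y) =
      u.count (Token.bar y) + (m ++ Token.bar y :: v).count (Token.bar y) := by
    rw [ht]
    simp
  have hL' := hL
  rw [Ctx.yield_plug, ht] at hL'
  have hy : Token.core y ∉ m ++ Token.bar y :: v := by simp [hm, hv]
  refine ⟨hx, ?_, ?_, fun u' v' huv hv' => ?_⟩
  · have := count_bar_le_maxRun (L := L) (u := E.left ++ u ++ [Token.core y])
      (v := m ++ Token.bar y :: v) (w := E.right) (z := y) (by simp [hL']) hy
    rw [hL] at this
    omega
  · have h1 := closes_eq_zero_of_bar (L := L) (u := E.left ++ u) (q := y) (m := m)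
      (w := v ++ E.right) (z := y) (by simp [hL']) hm
    have h2 := bars_eq_closes_after_core (L := L) (u := E.left ++ u) (q := y)
      (w := (m ++ Token.bar y :: v) ++ E.right) (by simp [hL'])
    have h3 : closes (m ++ Token.bar y :: v) = closes v := by
      simp [closes] at h1 ⊢
      exact h1
    have h4 : closes v ≤ v.length := List.count_le_length
    have h5 := count_bar_le_bars y (m ++ Token.bar y :: v)
    rw [bars_append, closes_append, h3] at h2
    unfold Ctx.depth
    omega
  · obtain ⟨rfl, rfl⟩ : u' = u ∧ v' = m ++ Token.bar y :: v := by
      rw [huv] at ht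
      rcases List.append_eq_append_iff.mp ht with ⟨a, rfl, h'⟩ | ⟨a, rfl, h'⟩
      · rcases a with _ | ⟨b, a⟩
        · simpa using h'
        · rw [List.cons_append, List.cons.injEq] at h'
          exact absurd (by simp [h'.2]) (hv' y)
      · rcases a with _ | ⟨b, a⟩
        · simpa using h'.symm
        · rw [List.cons_append, List.cons.injEq] at h'
          exact absurd (by simp [h'.2]) hy
    omega

end CutBounds

end SemCap
namespace SemCap

/-! ### Tokens and weights of pumped contexts -/

section Pumping

variable {Δ : Signature} {c : Sym → Δ.Op → ℕ} {x y : Letter} {l : ℕ}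

/-- The trees of `T` have concatenations of blocks as yields, with as many letters `x` as `y`, and
the weights `c z̄` of a tree add up to its number of `z̄`-tokens. -/
structure IsBalanced (c : Sym → Δ.Op → ℕ) (x y : Letter) (T : Set (Tree Δ)) : Prop where
  blocks : ∀ t ∈ T, ∃ L, blockString L = t.yield
  weight_eq : ∀ t ∈ T, ∀ z, t.weight (c (.bar z)) = t.yield.count (Token.bar z)
  count_eq : ∀ t ∈ T, t.yield.count (Token.core x) = t.yield.count (Token.core y)
  pos : ∀ t ∈ T, 0 < t.yield.count (Token.core x)

/-- The pumped trees belong to `T`, and the pumped part has size at most `l`. -/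
structure Pumps (c : Sym → Δ.Op → ℕ) (l : ℕ) (T : Set (Tree Δ)) (C₁ C₂ C₃ C₄ : Ctx Δ)
    (t₅ : Tree Δ) : Prop where
  mem : ∀ i, C₁.plug ((Ctx.pump C₂ C₃ C₄ i).plug t₅) ∈ T
  length_le : (C₂.comp (C₃.comp C₄)).yield.length ≤ l
  weight_le : ∀ z, (C₂.comp (C₃.comp C₄)).weight (c z) ≤ l

theorem Ctx.left_pump (C₂ C₃ C₄ : Ctx Δ) (i : ℕ) :
    (Ctx.pump C₂ C₃ C₄ i).left = power i C₂.left ++ (C₃.left ++ power i C₄.left) := by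
  induction i with
  | zero => simp [Ctx.pump]
  | succ i ih =>
    rw [Ctx.pump, Ctx.left_comp, Ctx.left_comp, ih, power_succ, power_succ']
    simp only [List.append_assoc]

theorem Ctx.right_pump (C₂ C₃ C₄ : Ctx Δ) (i : ℕ) :
    (Ctx.pump C₂ C₃ C₄ i).right = power i C₄.right ++ (C₃.right ++ power i C₂.right) := by
  induction i with
  | zero => simp [Ctx.pump]
  | succ i ih =>
    rw [Ctx.pump, Ctx.right_comp, Ctx.right_comp, ih, power_succ, power_succ']
    simp only [List.append_assoc]

theorem yield_pump (C₁ C₂ C₃ C₄ : Ctx Δ) (t₅ : Tree Δ) (i : ℕ) :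
    (C₁.plug ((Ctx.pump C₂ C₃ C₄ i).plug t₅)).yield =
      pumpString C₁.left C₂.left C₃.left C₄.left t₅.yield C₄.right C₃.right C₂.right C₁.right i := by
  simp [Ctx.yield_plug, Ctx.left_pump, Ctx.right_pump, pumpString]

/-- The pumped contexts contain neither `x` nor `y`. -/
def Still (x y : Letter) (C₂ C₄ : Ctx Δ) : Prop :=
  ∀ z, z = x ∨ z = y → Token.core z ∉ C₂.left ∧ Token.core z ∉ C₄.left ∧
    Token.core z ∉ C₄.right ∧ Token.core z ∉ C₂.right

namespace Pumps

variable {T : Set (Tree Δ)} {C₁ C₂ C₃ C₄ : Ctx Δ} {t₅ : Tree Δ}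

theorem mem_zero (h : Pumps c l T C₁ C₂ C₃ C₄ t₅) :
    C₁.plug (C₃.plug t₅) ∈ T := h.mem 0

theorem mem_one (h : Pumps c l T C₁ C₂ C₃ C₄ t₅) :
    C₁.plug (C₂.plug (C₃.plug (C₄.plug t₅))) ∈ T := by
  simpa [Ctx.pump, Ctx.plug_comp] using h.mem 1


theorem strings (hT : IsBalanced c x y T) (h : Pumps c l T C₁ C₂ C₃ C₄ t₅) :
    PumpsBlocks C₁.left C₂.left C₃.left C₄.left t₅.yield C₄.right C₃.right C₂.right
    C₁.right := fun i => by
  rw [← yield_pump]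
  exact hT.blocks _ (h.mem i)

/-- Weights and tokens agree before and after pumping, hence also on `C₂` and `C₄` taken together,
though not on each of them. -/
theorem weight_eq (hT : IsBalanced c x y T) (h : Pumps c l T C₁ C₂ C₃ C₄ t₅)
    (z : Letter) : C₂.weight (c (.bar z)) + C₄.weight (c (.bar z)) =
    C₂.left.count (Token.bar z) + C₄.left.count (Token.bar z) + C₄.right.count (Token.bar z) +
      C₂.right.count (Token.bar z) := by
  have h0 := hT.weight_eq _ h.mem_zero z
  have h1 := hT.weight_eq _ h.mem_one z
  simp only [Ctx.weight_plug, Ctx.yield_plug, List.count_append] at h0 h1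
  omega

theorem count_core_eq (hT : IsBalanced c x y T) (h : Pumps c l T C₁ C₂ C₃ C₄ t₅) :
    (C₂.comp C₄).yield.count (Token.core x) =
    (C₂.comp C₄).yield.count (Token.core y) := by
  have h0 := hT.count_eq _ h.mem_zero
  have h1 := hT.count_eq _ h.mem_one
  simp only [Ctx.yield_plug, Ctx.yield, Ctx.left_comp, Ctx.right_comp, List.count_append]
    at h0 h1 ⊢
  omega

/-- The pumped strings together contain equally many bars, opening and closing brackets. This is the
origin of the factor 3 in `CutBound`. -/
theorem three_mul_bars_le (hT : IsBalanced c x y T) (h : Pumps c l T C₁ C₂ C₃ C₄ t₅) :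
    3 * (bars C₂.left + bars C₄.left + bars C₄.right + bars C₂.right) ≤ l := by
  have h1 := (h.strings hT).bars_eq_opens
  have h2 := (h.strings hT).bars_eq_closes
  have h3 := h.length_le
  have h4 := three_mul_le_length C₂.left
  have h5 := three_mul_le_length C₄.left
  have h6 := three_mul_le_length C₂.right
  have h7 := three_mul_le_length C₄.right
  simp only [Ctx.yield, Ctx.left_comp, Ctx.right_comp, List.length_append] at h3
  omega

theorem three_mul_count_bar_le (hT : IsBalanced c x y T) (h : Pumps c l T C₁ C₂ C₃ C₄ t₅)
    (z : Letter) :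
    3 * (C₂.left.count (Token.bar z) + C₄.left.count (Token.bar z) +
      C₄.right.count (Token.bar z) + C₂.right.count (Token.bar z)) ≤ l := by
  have h1 := h.three_mul_bars_le hT
  have h4 := count_bar_le_bars z C₂.left
  have h5 := count_bar_le_bars z C₄.left
  have h6 := count_bar_le_bars z C₂.right
  have h7 := count_bar_le_bars z C₄.right
  omega

theorem still (hT : IsBalanced c x y T) (h : Pumps c l T C₁ C₂ C₃ C₄ t₅)
    (heq : (C₁.plug (C₃.plug t₅)).yield.count (Token.core x) =
    (C₁.plug (C₂.plug (C₃.plug (C₄.plug t₅)))).yield.count (Token.core x)) :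
    Still x y C₂ C₄ := by
  have h1 := h.count_core_eq hT
  simp only [Ctx.yield_plug, Ctx.yield, Ctx.left_comp, Ctx.right_comp, List.count_append]
    at heq h1
  rintro z (rfl | rfl) <;> simp only [← List.count_eq_zero] <;> omega

theorem count_bar_outer (hT : IsBalanced c x y T) (h : Pumps c l T C₁ C₂ C₃ C₄ t₅)
    (hst : Still x y C₂ C₄) {z : Letter} (hz : z = x ∨ z = y) :
    C₂.left.count (Token.bar z) = 0 ∧ C₂.right.count (Token.bar z) = 0 := by
  obtain ⟨h1, -, -, h4⟩ := hst z hz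
  exact ⟨List.count_eq_zero.mpr fun hb => h1 ((h.strings hT).core_mem_outer_left hb),
    List.count_eq_zero.mpr fun hb => h4 ((h.strings hT).core_mem_outer_right hb)⟩

theorem count_bar_inner (hT : IsBalanced c x y T) (h : Pumps c l T C₁ C₂ C₃ C₄ t₅)
    (hst : Still x y C₂ C₄) {q z : Letter} (hq : Token.core q ∈ t₅.yield)
    (hz : z = x ∨ z = y) :
    C₄.left.count (Token.bar z) = 0 ∧ C₄.right.count (Token.bar z) = 0 := by
  obtain ⟨-, h2, h3, -⟩ := hst z hz
  exact ⟨List.count_eq_zero.mpr fun hb => h2 ((h.strings hT).core_mem_inner_left hq hb),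
    List.count_eq_zero.mpr fun hb => h3 ((h.strings hT).core_mem_inner_right hq hb)⟩

theorem core_mem (hT : IsBalanced c x y T) (h : Pumps c l T C₁ C₂ C₃ C₄ t₅) :
    Token.core y ∈ (C₁.plug (C₃.plug t₅)).yield := by
  have h1 := hT.pos _ h.mem_zero
  rw [hT.count_eq _ h.mem_zero] at h1
  exact List.count_pos_iff.mp h1

/-- A core letter in `t₅`, or in `C₃` on the same side as a pumped factor of `C₄`, forbids `ȳ` in
that factor, and on the left `ȳ` also needs an earlier `y`. The remaining possibility is a `y`-block
that opens in `C₃.left` and whose `ȳ` are pumped in `C₄.right`. -/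
theorem bar_inner (hT : IsBalanced c x y T) (h : Pumps c l T C₁ C₂ C₃ C₄ t₅)
    (hst : Still x y C₂ C₄) (hy : Token.core y ∉ C₁.yield) :
    (C₄.left.count (Token.bar y) = 0 ∧ C₄.right.count (Token.bar y) = 0) ∨
      (Token.core y ∈ C₃.left ∧ Token.core y ∉ t₅.yield ∧ Token.core y ∉ C₃.right ∧
        Token.bar y ∈ C₄.right) := by
  by_cases hw : Token.core y ∈ t₅.yield
  · exact Or.inl (h.count_bar_inner hT hst hw (Or.inr rfl))
  have hs := h.strings hT
  obtain ⟨h1, h2, h3, h4⟩ := hst y (Or.inr rfl)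
  simp only [Ctx.yield, List.mem_append, not_or] at hy
  have hl : Token.bar y ∉ C₄.left := by
    by_cases h3 : Token.core y ∈ C₃.left
    · exact fun hb => h2 (hs.core_mem_inner_left_of_core_mem_left h3 hb)
    · obtain ⟨L, hL⟩ := hs 1
      have := bar_not_mem_of_prefix (L := L) (z := y)
        (u := C₁.left ++ (C₂.left ++ (C₃.left ++ C₄.left)))
        (w := t₅.yield ++ (C₄.right ++ (C₃.right ++ (C₂.right ++ C₁.right))))
        (by simp [hL, pumpString]) (by simp [hy, h1, h2, h3])
      simp only [List.mem_append, not_or] at this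
      exact this.2.2.2
  by_cases hr : Token.bar y ∈ C₄.right
  · have h5 : Token.core y ∉ C₃.right := fun h5 =>
      h3 (hs.core_mem_inner_right_of_core_mem_right h5 hr)
    have h6 := h.core_mem hT
    simp only [Ctx.yield_plug, List.mem_append, hw, h5, hy, or_false, false_or] at h6
    exact Or.inr ⟨h6, hw, h5, hr⟩
  · exact Or.inl ⟨List.count_eq_zero.mpr hl, List.count_eq_zero.mpr hr⟩

/-- The transfer of bounds from a cut of `C₁[C₃[t₅]]` to a cut of `C₁[C₂[C₃[C₄[t₅]]]]`. -/
theorem step (hT : IsBalanced c x y T) (h : Pumps c l T C₁ C₂ C₃ C₄ t₅)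
    {E E' : Ctx Δ} {t t' : Tree Δ}
    (hE : E.plug t = C₁.plug (C₂.plug (C₃.plug (C₄.plug t₅))))
    (hE' : E'.plug t' = C₁.plug (C₃.plug t₅)) (hb : CutBound c x y l E' t')
    (hy : Token.core y ∉ E.yield) (hy' : Token.core y ∉ E'.yield)
    (hsub : t'.yield.Sublist t.yield)
    (hx : t.weight (c (.bar x)) + t'.yield.count (Token.bar x) ≤
      t.yield.count (Token.bar x) + t'.weight (c (.bar x)) + l)
    (hx₀ : Still x y C₂ C₄ → t.weight (c (.bar x)) + t'.yield.count (Token.bar x) ≤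
        t.yield.count (Token.bar x) + t'.weight (c (.bar x)))
    (hd : 3 * t.yield.count (Token.bar y) + 3 * t'.weight (c (.bar y)) ≤
      3 * t.weight (c (.bar y)) + 3 * t'.yield.count (Token.bar y) + l)
    (hd₀ : Still x y C₂ C₄ → t.yield.count (Token.bar y) + t'.weight (c (.bar y)) ≤
        t.weight (c (.bar y)) + t'.yield.count (Token.bar y) ∨ CutBound c x y l E t)
    (hD : 3 * E'.depth ≤ 3 * E.depth + l)
    (hD₀ : Still x y C₂ C₄ → 3 * E'.depth ≤ max (3 * E.depth) l) : CutBound c x y l E t := by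
  by_cases hN : Still x y C₂ C₄ ∧ CutBound c x y l E t
  · exact hN.2
  have hst := h.still hT
  rw [← hE, ← hE'] at hst
  have hm0 := h.mem_zero
  have hm1 := h.mem_one
  have hrun := (h.strings hT).maxRun_le y
  rw [← yield_pump, ← yield_pump] at hrun
  simp only [Ctx.pump, Ctx.plug_comp] at hrun
  rw [← hE'] at hm0 hrun
  rw [← hE] at hm1 hrun
  obtain ⟨L, hL⟩ := hT.blocks _ hm1
  refine hb.step hL hy hy' (hT.count_eq _ hm1) (hT.count_eq _ hm0) hsub ?_ hrun hx
    (fun heq => hx₀ (hst heq)) hd (fun heq => ?_) hD (fun heq => hD₀ (hst heq))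
  · rw [hE, hE']
    simp only [Ctx.yield_plug, List.count_append]
    omega
  · exact (hd₀ (hst heq)).resolve_right fun hc => hN ⟨hst heq, hc⟩

/-- The exceptional case of `bar_inner`: what lies before the last `y` and after some `ȳ` of
`C₄.right` comes from the small pumped part, so `CutBound.of_tail` applies however large `t₅` is. -/
theorem tail (hT : IsBalanced c x y T) (h : Pumps c l T C₁ C₂ C₃ C₄ t₅)
    {E : Ctx Δ} {t : Tree Δ}
    (hE : E.plug t = C₁.plug (C₂.plug (C₃.plug (C₄.plug t₅)))) (hst : Still x y C₂ C₄)
    (hx : t.weight (c (.bar x)) ≤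
      t.yield.count (Token.bar x) + (E.plug t).yield.count (Token.core x) * l)
    {u v : List Token} (ht : t.yield = u ++ C₄.left ++ t₅.yield ++ C₄.right ++ v)
    (hu : Token.core y ∈ u) (hw : Token.core y ∉ t₅.yield) (hr : Token.bar y ∈ C₄.right)
    (hv : Token.core y ∉ v) (hlen : u.length + C₄.right.length + v.length ≤ l) :
    CutBound c x y l E t := by
  obtain ⟨-, h2, h3, -⟩ := hst y (Or.inr rfl)
  obtain ⟨a, _, b, rfl, rfl, hb⟩ := exists_last (P := fun t => t = Token.core y) ⟨_, hu, rfl⟩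
  obtain ⟨d, e, hde⟩ := List.append_of_mem hr
  have hm := h.mem_one
  rw [← hE] at hm
  obtain ⟨L, hL⟩ := hT.blocks _ hm
  have hb : Token.core y ∉ b := fun hy => hb _ hy rfl
  rw [hde] at h3 ht hlen
  simp only [List.mem_append, List.mem_cons, not_or] at h3
  simp only [List.length_append, List.length_cons] at hlen
  refine CutBound.of_tail hL (hT.pos _ hm) hx (u := a)
    (m := b ++ C₄.left ++ t₅.yield ++ d) (v := e ++ v) (by simp [ht]) ?_ ?_ ?_
  · simp [hb, h2, hw, h3]
  · simp [h3, hv]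
  · simp only [List.length_append]
    omega

end Pumps

end Pumping

end SemCap
namespace SemCap

/-! ### Positions of a cut relative to a pumping decomposition -/

section Cuts

variable {Δ : Signature} {c : Sym → Δ.Op → ℕ} {x y : Letter} {l : ℕ}

namespace Pumps

variable {T : Set (Tree Δ)} {C₁ C₂ C₃ C₄ : Ctx Δ} {t₅ t : Tree Δ}

/-- The cut is in `C₁`, above the pumped contexts. -/
theorem cut_above (hT : IsBalanced c x y T) {E F : Ctx Δ}
    (h : Pumps c l T (E.comp F) C₂ C₃ C₄ t₅)
    (hb : CutBound c x y l E (F.plug (C₃.plug t₅))) (hy : Token.core y ∉ E.yield) :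
    CutBound c x y l E (F.plug (C₂.plug (C₃.plug (C₄.plug t₅)))) := by
  have hx := h.weight_eq hT x
  have hd := h.weight_eq hT y
  refine h.step hT (Ctx.plug_comp _ _ _).symm (Ctx.plug_comp _ _ _).symm hb hy hy ?_ ?_
    (fun _ => ?_) ?_ (fun _ => Or.inl ?_) (by omega) (fun _ => by omega)
  · simp only [Ctx.yield_plug]
    refine List.Sublist.append (List.Sublist.append (List.Sublist.refl _) ?_)
      (List.Sublist.refl _)
    refine List.Sublist.trans ?_ (List.sublist_append_left _ _)
    refine List.Sublist.trans ?_ (List.sublist_append_right _ _)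
    refine List.Sublist.append (List.Sublist.append (List.Sublist.refl _) ?_)
      (List.Sublist.refl _)
    refine List.Sublist.trans ?_ (List.sublist_append_left _ _)
    exact List.sublist_append_right _ _
  all_goals
    simp only [Ctx.yield_plug, Ctx.weight_plug, List.count_append]
    omega

/-- The cut is in `C₁`, beside the pumped contexts. -/
theorem cut_beside (hT : IsBalanced c x y T) (h : Pumps c l T C₁ C₂ C₃ C₄ t₅)
    {K : Tree Δ → Ctx Δ} (hK : C₁.Incomparable t K)
    (hb : Token.core y ∉ (K (C₃.plug t₅)).yield → CutBound c x y l (K (C₃.plug t₅)) t)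
    (hy : Token.core y ∉ (K (C₂.plug (C₃.plug (C₄.plug t₅)))).yield) :
    CutBound c x y l (K (C₂.plug (C₃.plug (C₄.plug t₅)))) t := by
  have hbal := (h.strings hT).bars_eq_closes
  have hD : (K (C₃.plug t₅)).depth = (K (C₂.plug (C₃.plug (C₄.plug t₅)))).depth := by
    unfold Ctx.depth
    rcases hK.side with ⟨α, β, γ, hs⟩ | ⟨α, β, γ, hs⟩
    · simp only [hs, Ctx.yield_plug, closes_append, bars_append]
      omega
    · simp only [hs]
  have hy' : Token.core y ∉ (K (C₃.plug t₅)).yield := by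
    rcases hK.side with ⟨α, β, γ, hs⟩ | ⟨α, β, γ, hs⟩ <;>
    · simp only [Ctx.yield, hs, Ctx.yield_plug, List.mem_append] at hy ⊢
      tauto
  exact h.step hT (hK.plug_eq _) (hK.plug_eq _) (hb hy') hy hy' (List.Sublist.refl _)
    (by omega) (fun _ => by omega) (by omega) (fun _ => Or.inl (by omega)) (by omega)
    (fun _ => by omega)

/-- The cut is in `t₅`. -/
theorem cut_below (hT : IsBalanced c x y T) {F : Ctx Δ}
    (h : Pumps c l T C₁ C₂ C₃ C₄ (F.plug t))
    (hb : Token.core y ∉ (C₁.comp (C₃.comp F)).yield → CutBound c x y l (C₁.comp (C₃.comp F)) t)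
    (hy : Token.core y ∉ (C₁.comp (C₂.comp (C₃.comp (C₄.comp F)))).yield) :
    CutBound c x y l (C₁.comp (C₂.comp (C₃.comp (C₄.comp F)))) t := by
  have hle := (h.strings hT).bars_right_le
  have hD : (C₁.comp (C₃.comp F)).depth ≤ (C₁.comp (C₂.comp (C₃.comp (C₄.comp F)))).depth := by
    simp only [Ctx.depth, Ctx.right_comp, closes_append, bars_append]
    omega
  have hy' : Token.core y ∉ (C₁.comp (C₃.comp F)).yield := by
    simp only [Ctx.yield, Ctx.left_comp, Ctx.right_comp, List.mem_append] at hy ⊢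
    tauto
  exact h.step hT (by simp only [Ctx.plug_comp]) (by simp only [Ctx.plug_comp]) (hb hy') hy hy'
    (List.Sublist.refl _)
    (by omega) (fun _ => by omega) (by omega) (fun _ => Or.inl (by omega)) (by omega)
    (fun _ => by omega)

/-- The cut is in `C₂`. -/
theorem cut_outer (hT : IsBalanced c x y T) {A B : Ctx Δ}
    (h : Pumps c l T C₁ (A.comp B) C₃ C₄ t₅)
    (hb : Token.core y ∉ C₁.yield → CutBound c x y l C₁ (C₃.plug t₅))
    (hy : Token.core y ∉ (C₁.comp A).yield) :
    CutBound c x y l (C₁.comp A) (B.plug (C₃.plug (C₄.plug t₅))) := by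
  have hs := h.strings hT
  have hx := h.weight_eq hT x
  have hd := h.weight_eq hT y
  have hxl := h.three_mul_count_bar_le hT x
  have hyl := h.three_mul_count_bar_le hT y
  have hbl := h.three_mul_bars_le hT
  have hlen := h.length_le
  have hy' : Token.core y ∉ C₁.yield := by
    simp only [Ctx.yield, Ctx.left_comp, Ctx.right_comp, List.mem_append] at hy ⊢
    tauto
  have hE : (C₁.comp A).plug (B.plug (C₃.plug (C₄.plug t₅))) =
      C₁.plug ((A.comp B).plug (C₃.plug (C₄.plug t₅))) := by
    simp only [Ctx.plug_comp]
  have hb := hb hy'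
  -- The outer strings contain no `x̄`, so the whole `x̄`-weight of `C₂` and `C₄` is matched by
  -- tokens of `C₄`, and these lie below the cut.
  have hx₀ : Still x y (A.comp B) C₄ →
      (B.plug (C₃.plug (C₄.plug t₅))).weight (c (.bar x)) +
        (C₃.plug t₅).yield.count (Token.bar x) ≤
      (B.plug (C₃.plug (C₄.plug t₅))).yield.count (Token.bar x) +
        (C₃.plug t₅).weight (c (.bar x)) := by
    intro hst
    have := h.count_bar_outer hT hst (Or.inl rfl)
    simp only [Ctx.yield_plug, Ctx.weight_plug, Ctx.weight_comp, Ctx.left_comp, Ctx.right_comp,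
      List.count_append] at hx this ⊢
    omega
  refine h.step hT hE rfl hb hy hy' ?_ ?_ hx₀ ?_ (fun hst => ?_) ?_ (fun hst => ?_)
  · simp only [Ctx.yield_plug]
    refine List.Sublist.trans ?_ (List.sublist_append_left _ _)
    refine List.Sublist.trans ?_ (List.sublist_append_right _ _)
    refine List.Sublist.append (List.Sublist.append (List.Sublist.refl _) ?_)
      (List.Sublist.refl _)
    refine List.Sublist.trans ?_ (List.sublist_append_left _ _)
    exact List.sublist_append_right _ _
  · simp only [Ctx.yield_plug, Ctx.weight_plug, Ctx.weight_comp, Ctx.left_comp, Ctx.right_comp,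
      List.count_append] at hx hxl ⊢
    omega
  · simp only [Ctx.yield_plug, Ctx.weight_plug, Ctx.weight_comp, Ctx.left_comp, Ctx.right_comp,
      List.count_append] at hd hyl ⊢
    omega
  · rcases h.bar_inner hT hst hy' with h0 | ⟨h3, hw, hr3, hr⟩
    · have := h.count_bar_outer hT hst (Or.inr rfl)
      left
      simp only [Ctx.yield_plug, Ctx.weight_plug, Ctx.left_comp, Ctx.right_comp,
        List.count_append] at this ⊢
      omega
    · right
      obtain ⟨-, -, -, hst2⟩ := hst y (Or.inr rfl)
      rw [Ctx.right_comp, List.mem_append, not_or] at hst2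
      refine h.tail hT hE hst ?_ (u := B.left ++ C₃.left) (v := C₃.right ++ B.right)
        (by simp [Ctx.yield_plug]) (by simp [h3]) hw hr (by simp [hr3, hst2]) ?_
      · have h1 := hx₀ hst
        have h2 := hb.edges_le
        have h3 : (C₁.plug (C₃.plug t₅)).yield.count (Token.core x) ≤
            ((C₁.comp A).plug (B.plug (C₃.plug (C₄.plug t₅)))).yield.count (Token.core x) := by
          simp only [Ctx.yield_plug, Ctx.left_comp, Ctx.right_comp, List.count_append]
          omega
        have := Nat.mul_le_mul_right l h3
        omega
      · simp only [Ctx.yield, Ctx.left_comp, Ctx.right_comp, List.length_append] at hlen ⊢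
        omega
  · simp only [Ctx.depth, Ctx.right_comp, closes_append, bars_append] at hbl ⊢
    omega
  -- If `A.right` has more bars than closing brackets, then `C₂.right` contains a barred letter and
  -- hence its core letter. The depth of `C₁` is then at most the number of bars in `C₂.right`, a
  -- third of `l`.
  · by_cases hA : bars A.right ≤ closes A.right
    · simp only [Ctx.depth, Ctx.right_comp, closes_append, bars_append]
      omega
    · obtain ⟨z, hz⟩ := exists_bar_mem (s := A.right) (by omega)
      have hz := hs.core_mem_outer_right (z := z) (by simp [Ctx.right_comp, hz])
      obtain ⟨L, hL⟩ := hs 1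
      have := closes_le_of_core_mem (L := L) (u := C₁.left ++ ((A.comp B).left ++ (C₃.left ++
        (C₄.left ++ (t₅.yield ++ (C₄.right ++ C₃.right)))))) (v := (A.comp B).right)
        (w := C₁.right) (by simp [hL, pumpString]) hz
      simp only [Ctx.depth]
      omega

/-- The cut is in `C₃`. -/
theorem cut_middle (hT : IsBalanced c x y T) {A B : Ctx Δ}
    (h : Pumps c l T C₁ C₂ (A.comp B) C₄ t₅)
    (hb : Token.core y ∉ (C₁.comp A).yield → CutBound c x y l (C₁.comp A) (B.plug t₅))
    (hy : Token.core y ∉ (C₁.comp (C₂.comp A)).yield) :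
    CutBound c x y l (C₁.comp (C₂.comp A)) (B.plug (C₄.plug t₅)) := by
  have hs := h.strings hT
  have hx := h.weight_eq hT x
  have hd := h.weight_eq hT y
  have hxl := h.three_mul_count_bar_le hT x
  have hyl := h.three_mul_count_bar_le hT y
  have hlen := h.length_le
  have hy' : Token.core y ∉ (C₁.comp A).yield := by
    simp only [Ctx.yield, Ctx.left_comp, Ctx.right_comp, List.mem_append] at hy ⊢
    tauto
  have hy₁ : Token.core y ∉ C₁.yield := by
    simp only [Ctx.yield, Ctx.left_comp, Ctx.right_comp, List.mem_append] at hy ⊢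
    tauto
  have hE : (C₁.comp (C₂.comp A)).plug (B.plug (C₄.plug t₅)) =
      C₁.plug (C₂.plug ((A.comp B).plug (C₄.plug t₅))) := by
    simp only [Ctx.plug_comp]
  have hb := hb hy'
  have hx₀ : Still x y C₂ C₄ →
      (B.plug (C₄.plug t₅)).weight (c (.bar x)) + (B.plug t₅).yield.count (Token.bar x) ≤
      (B.plug (C₄.plug t₅)).yield.count (Token.bar x) + (B.plug t₅).weight (c (.bar x)) := by
    intro hst
    have := h.count_bar_outer hT hst (Or.inl rfl)
    simp only [Ctx.yield_plug, Ctx.weight_plug, List.count_append]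
    omega
  refine h.step hT hE (by simp only [Ctx.plug_comp]) hb hy hy' ?_ ?_ hx₀ ?_ (fun hst => ?_) ?_
    (fun hst => ?_)
  · simp only [Ctx.yield_plug]
    refine List.Sublist.append (List.Sublist.append (List.Sublist.refl _) ?_)
      (List.Sublist.refl _)
    refine List.Sublist.trans ?_ (List.sublist_append_left _ _)
    exact List.sublist_append_right _ _
  · simp only [Ctx.yield_plug, Ctx.weight_plug, List.count_append]
    omega
  · simp only [Ctx.yield_plug, Ctx.weight_plug, List.count_append]
    omega
  · rcases h.bar_inner hT hst hy₁ with h0 | ⟨h3, hw, hr3, hr⟩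
    · left
      simp only [Ctx.yield_plug, Ctx.weight_plug, List.count_append]
      omega
    · right
      -- The `y` of `C₃.left` cannot come from `A`, which lies above the cut.
      have hBl : Token.core y ∈ B.left := by
        simp only [Ctx.yield, Ctx.left_comp, Ctx.right_comp, List.mem_append] at hy h3
        tauto
      rw [Ctx.right_comp, List.mem_append, not_or] at hr3
      refine h.tail hT hE hst ?_ (u := B.left) (v := B.right)
        (by simp [Ctx.yield_plug]) hBl hw hr hr3.1 ?_
      · have h1 := hx₀ hst
        have h2 := hb.edges_le
        have h3 : ((C₁.comp A).plug (B.plug t₅)).yield.count (Token.core x) ≤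
            ((C₁.comp (C₂.comp A)).plug (B.plug (C₄.plug t₅))).yield.count (Token.core x) := by
          simp only [Ctx.yield_plug, Ctx.left_comp, Ctx.right_comp, List.count_append]
          omega
        have := Nat.mul_le_mul_right l h3
        omega
      · simp only [Ctx.yield, Ctx.left_comp, Ctx.right_comp, List.length_append] at hlen ⊢
        omega
  all_goals
    have := hs.bars_outer_right_le
    simp only [Ctx.depth, Ctx.right_comp, closes_append, bars_append]
    omega

/-- The cut is in `C₄`. -/
theorem cut_inner (hT : IsBalanced c x y T) {A B : Ctx Δ}
    (h : Pumps c l T C₁ C₂ C₃ (A.comp B) t₅)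
    (hb : Token.core y ∉ (C₁.comp C₃).yield → CutBound c x y l (C₁.comp C₃) t₅)
    (hy : Token.core y ∉ (C₁.comp (C₂.comp (C₃.comp A))).yield) :
    CutBound c x y l (C₁.comp (C₂.comp (C₃.comp A))) (B.plug t₅) := by
  have hs := h.strings hT
  have hx := h.weight_eq hT x
  have hd := h.weight_eq hT y
  have hxl := h.three_mul_count_bar_le hT x
  have hyl := h.three_mul_count_bar_le hT y
  have hbl := h.three_mul_bars_le hT
  have hr2 := hs.bars_outer_right_le
  have hy' : Token.core y ∉ (C₁.comp C₃).yield := by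
    simp only [Ctx.yield, Ctx.left_comp, Ctx.right_comp, List.mem_append] at hy ⊢
    tauto
  -- The contexts around `t₅` in the pumped-down tree contain no `y`. A core letter in `t₅` excludes
  -- the exceptional case of `bar_inner`.
  have hw : Token.core y ∈ t₅.yield := by
    have := h.core_mem hT
    simp only [Ctx.yield, Ctx.yield_plug, Ctx.left_comp, Ctx.right_comp, List.mem_append]
      at this hy'
    tauto
  refine h.step hT (by simp only [Ctx.plug_comp]) (by simp only [Ctx.plug_comp]) (hb hy') hy hy'
    ?_ ?_ (fun hst => ?_) ?_ (fun hst => Or.inl ?_) ?_ (fun hst => ?_)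
  · rw [Ctx.yield_plug]
    refine List.Sublist.trans ?_ (List.sublist_append_left _ _)
    exact List.sublist_append_right _ _
  · simp only [Ctx.yield_plug, Ctx.weight_plug, Ctx.weight_comp, Ctx.left_comp, Ctx.right_comp,
      List.count_append] at hx hxl ⊢
    omega
  · have h1 := h.count_bar_inner hT hst hw (Or.inl rfl)
    have h2 := h.count_bar_outer hT hst (Or.inl rfl)
    simp only [Ctx.yield_plug, Ctx.weight_plug, Ctx.weight_comp, Ctx.left_comp, Ctx.right_comp,
      List.count_append] at hx h1 h2 ⊢
    omega
  · simp only [Ctx.yield_plug, Ctx.weight_plug, Ctx.weight_comp, Ctx.left_comp, Ctx.right_comp,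
      List.count_append] at hd hyl ⊢
    omega
  · have h1 := h.count_bar_inner hT hst hw (Or.inr rfl)
    simp only [Ctx.yield_plug, Ctx.weight_plug, Ctx.left_comp, Ctx.right_comp,
      List.count_append] at h1 ⊢
    omega
  · simp only [Ctx.depth, Ctx.right_comp, closes_append, bars_append] at hbl ⊢
    omega
  -- As for a cut in `C₂`: otherwise `C₄.right` contains a core letter, and the depth is at most its
  -- number of bars. Omitting `C₂.right` does not increase the depth, as it has at least as many
  -- closing brackets as bars.
  · by_cases hA : bars A.right ≤ closes A.right
    · simp only [Ctx.depth, Ctx.right_comp, closes_append, bars_append]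
      omega
    · obtain ⟨z, hz⟩ := exists_bar_mem (s := A.right) (by omega)
      have hz := hs.core_mem_inner_right (z := z) hw (by simp [Ctx.right_comp, hz])
      obtain ⟨L, hL⟩ := hs 1
      have := closes_le_of_core_mem (L := L) (u := C₁.left ++ (C₂.left ++ (C₃.left ++
        ((A.comp B).left ++ t₅.yield)))) (v := (A.comp B).right)
        (w := C₃.right ++ (C₂.right ++ C₁.right)) (by simp [hL, pumpString]) hz
      simp only [Ctx.depth, Ctx.right_comp, closes_append, bars_append] at this hbl ⊢
      omega

/-- The cut subtree is generated by `C₂`, `C₃` or `C₄`. -/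
theorem cut_small {C E : Ctx Δ} (hmem : 0 < (E.plug t).yield.count (Token.core x))
    {K : Tree Δ → Ctx Δ} (hK : C.Incomparable t K) (hlen : C.yield.length ≤ l)
    (hw : ∀ z, C.weight (c z) ≤ l) : CutBound c x y l E t := by
  have h1 := hK.yield_sublist.length_le
  have h2 := hK.weight_le (c (.bar x))
  have h3 := hw (.bar x)
  have h4 := List.count_le_length (a := Token.bar y) (l := t.yield)
  exact CutBound.of_le hmem (by omega) (by omega)

/-- Comparing the cut with the holes of `C₁`, `C₂`, `C₃`, `C₄` in turn locates it. Beside the path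
inside `C₂`, `C₃` or `C₄`, the subtree itself is small. -/
theorem cutBound (hT : IsBalanced c x y T) (h : Pumps c l T C₁ C₂ C₃ C₄ t₅)
    (ih : ∀ E t, E.plug t = C₁.plug (C₃.plug t₅) → Token.core y ∉ E.yield →
      CutBound c x y l E t) {E : Ctx Δ}
    (hE : C₁.plug (C₂.plug (C₃.plug (C₄.plug t₅))) = E.plug t) (hy : Token.core y ∉ E.yield) :
    CutBound c x y l E t := by
  have hpos := hT.pos _ h.mem_one
  have hlen := h.length_le
  have hwt := h.weight_le
  rw [hE] at hpos
  simp only [Ctx.yield, Ctx.left_comp, Ctx.right_comp, List.length_append] at hlen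
  simp only [Ctx.weight_comp] at hwt
  rcases C₁.compare E _ _ hE with ⟨F, rfl, rfl⟩ | ⟨F, rfl, hF⟩ | ⟨K, rfl, hK⟩
  · exact h.cut_above hT (ih _ _ (by simp only [Ctx.plug_comp]) hy) hy
  · rcases C₂.compare F _ _ hF with ⟨B, rfl, rfl⟩ | ⟨F, rfl, hF'⟩ | ⟨K, rfl, hK⟩
    · exact h.cut_outer hT (ih _ _ rfl) hy
    · rcases C₃.compare F _ _ hF' with ⟨B, rfl, rfl⟩ | ⟨F, rfl, hF''⟩ | ⟨K, rfl, hK⟩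
      · exact h.cut_middle hT (ih _ _ (by simp only [Ctx.plug_comp])) hy
      · rcases C₄.compare F _ _ hF'' with ⟨B, rfl, rfl⟩ | ⟨F, rfl, rfl⟩ | ⟨K, rfl, hK⟩
        · exact h.cut_inner hT (ih _ _ (by simp only [Ctx.plug_comp])) hy
        · exact h.cut_below hT (ih _ _ (by simp only [Ctx.plug_comp])) hy
        · exact cut_small hpos hK (by simp only [Ctx.yield, List.length_append]; omega)
            fun z => by have := hwt z; omega
      · exact cut_small hpos hK (by simp only [Ctx.yield, List.length_append]; omega)
          fun z => by have := hwt z; omega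
    · exact cut_small hpos hK (by simp only [Ctx.yield, List.length_append]; omega)
        fun z => by have := hwt z; omega
  · exact h.cut_beside hT hK (ih _ _ (hK.plug_eq _)) hy

end Pumps

/-- The whole tree is balanced, so any discrepancy of `t` is opposite to that of the small context
`E`. -/
theorem cutBound_of_height_le {T : Set (Tree Δ)} (hT : IsBalanced c x y T) {E : Ctx Δ} {t : Tree Δ}
    (ht : E.plug t ∈ T) (hlen : E.yield.length ≤ l) (hw : ∀ z, E.weight (c z) ≤ l) :
    CutBound c x y l E t := by
  have hx := hT.weight_eq _ ht x
  have hy := hT.weight_eq _ ht y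
  have h1 := hw (.bar y)
  have h2 := List.count_le_length (a := Token.bar x) (l := E.yield)
  have h3 : E.yield.count (Token.bar x) = E.left.count (Token.bar x) + E.right.count (Token.bar x) :=
    List.count_append
  simp only [Ctx.weight_plug, Ctx.yield_plug, List.count_append] at hx hy
  exact CutBound.of_le (hT.pos _ ht) (by omega) (by omega)

/-- The induction is on the number of nodes, because pumping down removes nodes but need not lower
the height. -/
theorem cutBound {T : Set (Tree Δ)} (hT : IsBalanced c x y T) {p : ℕ} (hp : IsPumpingHeight T p)
    (hlen : ∀ C : Ctx Δ, C.height ≤ p → C.yield.length ≤ l)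
    (hw : ∀ C : Ctx Δ, C.height ≤ p → ∀ z, C.weight (c z) ≤ l) {E : Ctx Δ} {t : Tree Δ}
    (ht : E.plug t ∈ T) (hy : Token.core y ∉ E.yield) : CutBound c x y l E t := by
  induction hN : (E.plug t).weight (fun _ => 1) using Nat.strong_induction_on generalizing E t with
  | _ N ih =>
  rcases le_or_gt (E.plug t).height p with hh | hh
  · have := (E.height_le_plug t).trans hh
    exact cutBound_of_height_le hT ht (hlen E this) (hw E this)
  · obtain ⟨C₁, C₂, C₃, C₄, t₅, hdec⟩ := hp _ ht hh
    have h : Pumps c l T C₁ C₂ C₃ C₄ t₅ :=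
      ⟨hdec.mem, hlen _ hdec.height_le, hw _ hdec.height_le⟩
    refine h.cutBound hT (fun E' t' hE' hy' => ?_) hdec.eq.symm hy
    refine ih _ ?_ (hE' ▸ h.mem_zero) hy' rfl
    rw [← hN, hE', hdec.eq]
    have hpos : 0 < C₂.weight (fun _ => 1) + C₄.weight (fun _ => 1) := by
      have := hdec.height_pos
      rcases Nat.eq_zero_or_pos C₂.height with h0 | h0
      · have := C₄.weight_pos (by omega)
        omega
      · have := C₂.weight_pos h0
        omega
    simp only [Ctx.weight_plug]
    omega

end Cuts

end SemCap
namespace SemCap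

/-! ### From the cut bound to asynchrony -/

section Asynchrony

variable {Δ : Signature} {x y : Letter} {l : ℕ}

theorem Graph.Iso.refl {Λ : Type} (g : Graph Λ) : g.Iso g :=
  ⟨Equiv.refl _, Equiv.refl _, fun _ => ⟨rfl, rfl, rfl⟩⟩

theorem isBalanced_of_isCSD {Λ : Type} {k : ℕ} {G : LMCFTG Δ} {h : Hom Δ Λ k}
    (hR : IsCSD (REL G h)) (hxy : Sep x y) : IsBalanced h.edges x y G.language := by
  have hmem : ∀ t ∈ G.language, (t.yield, (h.graph t).toGraph) ∈ REL G h :=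
    fun t ht => ⟨t, ht, rfl, Graph.Iso.refl _⟩
  have hs : ∀ t ∈ G.language, t.yield ∈ CSDs := fun t ht => (hR.strings _).mp ⟨_, hmem t ht⟩
  refine ⟨fun t ht => exists_blockString (hs t ht), fun t ht z => ?_,
    fun t ht => (count_core_of_mem (hs t ht) hxy).1,
    fun t ht => (count_core_of_mem (hs t ht) hxy).2⟩
  rw [← Hom.edgeCount_graph]
  exact hR.edges _ _ (hmem t ht) _

theorem Separated.exists_isMinimalSeparation {t : Tree Δ} (ht : Separated x y l t) :
    ∃ Dx D₀ ty, IsMinimalSeparation x y l t Dx D₀ ty := by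
  classical
  have hex : ∃ n Dx D₀ ty, IsSeparation x y l t Dx D₀ ty ∧ D₀.height = n := by
    obtain ⟨Dx, D₀, ty, h⟩ := ht
    exact ⟨_, Dx, D₀, ty, h, rfl⟩
  obtain ⟨Dx, D₀, ty, h, hn⟩ := Nat.find_spec hex
  exact ⟨Dx, D₀, ty, h, fun Ex E₀ sy h' => hn ▸ Nat.find_min' hex ⟨Ex, E₀, sy, h', rfl⟩⟩

theorem IsSeparation.count_bar_le {L : List (Letter × ℕ)} {t ty : Tree Δ} {Dx D₀ : Ctx Δ}
    (hs : IsSeparation x y l t Dx D₀ ty) (hL : blockString L = t.yield) :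
    (D₀.plug ty).yield.count (Token.bar x) ≤ maxRun (Token.bar x) t.yield * (l + 1) := by
  have h1 := hs.middle
  have h2 := hs.inner
  have h3 : (D₀.plug ty).yield.count (Token.core x) ≤ l := by
    rw [Ctx.yield, List.count_append] at h1
    rw [Ctx.yield_plug, List.count_append, List.count_append]
    omega
  have h4 : blockString L = Dx.left ++ (D₀.plug ty).yield ++ Dx.right := by
    rw [hL, hs.eq, Ctx.yield_plug]
  refine (count_bar_le_mul_maxRun _ h4).trans ?_
  rw [hL, mul_comm]
  exact Nat.mul_le_mul_left _ (by omega)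

/-- This passes from the `ȳ` in `t` to those of the whole tree. None lie in `E.left`, and those in
`E.right` must continue the last `y`-block of `t`. -/
theorem CutBound.count_bar_le {c : Sym → Δ.Op → ℕ} {L : List (Letter × ℕ)} {E : Ctx Δ}
    {t : Tree Δ} (hb : CutBound c x y l E t) (hL : blockString L = (E.plug t).yield)
    (hy : Token.core y ∉ E.yield) (hc : Token.core y ∈ (E.plug t).yield) :
    (E.plug t).yield.count (Token.bar y) ≤ t.weight (c (.bar y)) +
      (E.plug t).yield.count (Token.core x) * l + maxRun (Token.bar y) (E.plug t).yield := by
  have hL' := hL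
  rw [Ctx.yield_plug] at hL'
  simp only [Ctx.yield, List.mem_append, not_or] at hy
  have hl : E.left.count (Token.bar y) = 0 := List.count_eq_zero.mpr
    (bar_not_mem_of_prefix (L := L) (w := t.yield ++ E.right) (by simp [hL']) hy.1)
  have hcount : (E.plug t).yield.count (Token.bar y) =
      t.yield.count (Token.bar y) + E.right.count (Token.bar y) := by
    rw [Ctx.yield_plug, List.count_append, List.count_append, hl, zero_add]
  have hyt : Token.core y ∈ t.yield := by
    simpa [Ctx.yield_plug, hy] using hc
  obtain ⟨u, _, v, huv, rfl, hv⟩ := exists_last (P := fun t => t = Token.core y) ⟨_, hyt, rfl⟩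
  have hv : Token.core y ∉ v := fun h => hv _ h rfl
  rw [huv] at hL'
  -- If the last `y`-block is still open at the end of `t`, its tail `v` and the `ȳ` of `E.right`
  -- share a single run, and `le_last` charges just `v`. Otherwise `E.right` has no `ȳ`, and
  -- `le_run` suffices.
  by_cases hcl : Coreless v
  · have h1 := hb.le_last u v huv hcl
    have h2 := count_bar_le_maxRun (L := L) (u := E.left ++ u ++ [Token.core y])
      (v := v ++ E.right) (w := []) (z := y) (by simp [hL']) (by simp [hv, hy])
    rw [hL, List.count_append] at h2
    omega
  · obtain ⟨v₁, q, v₂, rfl, -⟩ := exists_last_core hcl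
    have hq : q ≠ y := by
      rintro rfl
      simp at hv
    have hr : E.right.count (Token.bar y) = 0 := by
      refine List.count_eq_zero.mpr fun hr => ?_
      refine bar_not_mem_of_core_between (L := L) (u := E.left ++ (u ++ Token.core y :: v₁))
        (q := q) (v := v₂ ++ E.right) (w := []) (z := y) (by simp [hL']) ?_ hq
        (List.mem_append_right _ hr)
      simp only [List.mem_append, List.mem_cons, not_or] at hv ⊢
      exact ⟨hv.2.2, hy.2⟩
    have := hb.le_run
    omega

theorem asynchronous_of_separated {Λ : Type} {k : ℕ} {h : Hom Δ Λ k} {T : Set (Tree Δ)}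
    (hT : IsBalanced h.edges x y T) {p : ℕ} (hp : IsPumpingHeight T p)
    (hl : IsGenerationBound h p l) {t : Tree Δ} (ht : t ∈ T) (hsep : Separated x y l t) :
    Asynchronous h x y l t := by
  obtain ⟨Dx, D₀, ty, hmin⟩ := hsep.exists_isMinimalSeparation
  refine ⟨Dx, D₀, ty, hmin, ?_⟩
  obtain ⟨L, hL⟩ := hT.blocks t ht
  have hx := hmin.1.count_bar_le hL
  have hy := List.count_eq_zero.mp hmin.1.outer
  have hc : 0 < t.yield.count (Token.core y) := hT.count_eq t ht ▸ hT.pos t ht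
  obtain rfl := hmin.1.eq
  have hb := cutBound hT hp (fun C hC => (hl C hC).1)
    (fun C hC z => (h.sum_edges_le C z).trans (hl C hC).2) ht hy
  have h1 := hb.edges_le
  have h2 := hb.count_bar_le hL hy (List.count_pos_iff.mp hc)
  rw [Hom.edgeCount_graph, Hom.edgeCount_graph]
  constructor
  · omega
  · zify at h2
    linarith

end Asynchrony

end SemCap

theorem lemma8 {Δ : SemCap.Signature} {Λ : Type} {k : ℕ}
    (G : SemCap.LMCFTG Δ) (h : SemCap.Hom Δ Λ k)
    (CSD : Set (List SemCap.Token × SemCap.Graph Λ)) (hCSD : SemCap.IsCSD CSD)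
    (hREL : CSD = SemCap.REL G h) :
    (∃ p : ℕ, SemCap.IsPumpingHeight G.language p) ∧
      ∀ p : ℕ, SemCap.IsPumpingHeight G.language p →
        (∃ l₀ : ℕ, SemCap.IsGenerationBound h p l₀) ∧
          ∀ l₀ : ℕ, SemCap.IsGenerationBound h p l₀ →
            ∀ x y : SemCap.Letter, SemCap.Sep x y →
              ∀ t ∈ G.language, SemCap.Separated x y l₀ t →
                SemCap.Asynchronous h x y l₀ t := by
  subst hREL
  refine ⟨G.exists_pumpingHeight, fun p hp => ⟨SemCap.exists_generationBound h p, ?_⟩⟩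
  intro l₀ hl x y hxy t ht hsep
  exact SemCap.asynchronous_of_separated (SemCap.isBalanced_of_isCSD hCSD hxy) hp hl ht hsep
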